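/- Let $n\ge 2$ and let $\Omega\subset\mathbb{R}^n$ be a nonempty, bounded, open, convex set with $C^1$ boundary; write $|\cdot|=\mathcal{H}^{n-1}$ for $(n-1)$-dimensional surface area and $\sigma$ for the surface measure. A set $\Sigma\subset\overline\Omega$ is called piecewise differentiable if, up to a set of zero surface area, it is a finite union of measurable pieces of $C^1$ hypersurfaces; $n(x)$ denotes a unit normal of $\Sigma$ at $x$ (defined up to sign for almost every $x\in\Sigma$), and $$E(\Sigma)=\int_\Sigma\int_\Sigma\frac{|\langle n(x),y-x\rangle\langle y-x,n(y)\rangle|}{\|x-y\|^{n+1}}\,d\sigma(x)\,d\sigma(y)\in[0,\infty].$$ There is a constant $c_\Omega>0$ such that the following holds whenever $m\in\mathbb{N}=\{0,1,2,\dots\}$ and $0\le L-m|\partial\Omega|\le c_\Omega$; moreover the area $|\Omega\cap H|$ of any hyperplane section of $\Omega$, in particular the largest such area, is an admissible choice of $c_\Omega$. Among all piecewise differentiable $\Sigma\subset\overline\Omega$ with $|\Sigma|=L$ the energy $E$ is minimized by $m$ copies of $\partial\Omega$ and a piece of a hyperplane, in the following sense. (i) There is a convex set $K\subset\Omega$ contained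 in a hyperplane with $m|\partial\Omega|+|K|=L$. (ii) Let $K\subset\Omega$ be any measurable subset of a hyperplane with $m|\partial\Omega|+|K|=L$, and let $p\in\Omega$. For $t=(t_1,\dots,t_m)$ with pairwise distinct $t_i\in(0,1]$, let $\Sigma_t$ be the union of $K$ and of the $m$ pairwise disjoint copies $p+t_i(\partial\Omega-p)$ of the boundary. Then, as $t\to(1,\dots,1)$, $$E(\Sigma_t)\longrightarrow\inf\{E(\Sigma):\Sigma\subset\overline\Omega\ \text{piecewise differentiable},\ |\Sigma|=L\}.$$ (iii) If $m\le 1$, then for every such $K$ the set $\Sigma_0=K$ (if $m=0$), respectively $\Sigma_0=\partial\Omega\cup K$ (if $m=1$), is itself piecewise differentiable with $\Sigma_0\subset\overline\Omega$ and $|\Sigma_0|=L$, and $E(\Sigma_0)\le E(\Sigma)$ for all piecewise differentiable $\Sigma\subset\overline\Omega$ with $|\Sigma|=L$. -/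

import Mathlib

open MeasureTheory Set Filter Topology
open scoped ENNReal

noncomputable section

namespace QuadraticCrofton

/-- Euclidean space `ℝⁿ`. -/
abbrev Space (n : ℕ) : Type := EuclideanSpace ℝ (Fin n)

/-- The surface area of a set in `ℝⁿ`: the `(n-1)`-dimensional Hausdorff measure, normalised to be
Lebesgue measure on hyperplanes. -/
def surfaceMeasure (n : ℕ) : Measure (Space n) := Measure.euclideanHausdorffMeasure (n - 1)

/-- `Ω` has `C¹` boundary: near each boundary point `Ω` is the sublevel set `{φ < 0}` of a
`C¹` function with nonvanishing gradient. -/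
def HasC1Boundary {n : ℕ} (Ω : Set (Space n)) : Prop :=
  ∀ x ∈ frontier Ω, ∃ (U : Set (Space n)) (φ : Space n → ℝ), IsOpen U ∧ x ∈ U ∧
    ContDiffOn ℝ 1 φ U ∧ gradient φ x ≠ 0 ∧ Ω ∩ U = {y ∈ U | φ y < 0}

/-- Near `x`, the set `S` is a `C¹` hypersurface through `x` (a regular level set), and `v` is one
of its two unit normal vectors at `x`. -/
def IsUnitNormalAt {n : ℕ} (S : Set (Space n)) (x v : Space n) : Prop :=
  x ∈ S ∧ ∃ (U : Set (Space n)) (φ : Space n → ℝ), IsOpen U ∧ x ∈ U ∧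
    ContDiffOn ℝ 1 φ U ∧ gradient φ x ≠ 0 ∧ S ∩ U = {y ∈ U | φ y = 0} ∧
    ‖v‖ = 1 ∧ v ∈ Submodule.span ℝ {gradient φ x}

/-- `S` is an (embedded, not necessarily closed) `C¹` hypersurface. -/
def IsC1Hypersurface {n : ℕ} (S : Set (Space n)) : Prop :=
  ∀ x ∈ S, ∃ v, IsUnitNormalAt S x v

/-- `ν` is a unit normal field along the piecewise `C¹` hypersurface `A`: up to a set of zero
surface area, `A` consists of finitely many measurable pieces `M i` of `C¹` hypersurfaces `S i`,
and at the points of `M i` the vector `ν` is a unit normal of `S i`. -/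
def IsUnitNormalField {n : ℕ} (A : Set (Space n)) (ν : Space n → Space n) : Prop :=
  ∃ (N : ℕ) (S M : Fin N → Set (Space n)),
    (∀ i, IsC1Hypersurface (S i) ∧ MeasurableSet (M i) ∧ M i ⊆ S i ∧ M i ⊆ A ∧
      ∀ x ∈ M i, IsUnitNormalAt (S i) x (ν x)) ∧
    surfaceMeasure n (A \ ⋃ i, M i) = 0

/-- `A` is a piecewise differentiable `(n-1)`-dimensional set. -/
def IsPiecewiseC1 {n : ℕ} (A : Set (Space n)) : Prop :=
  ∃ ν, IsUnitNormalField A ν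

open Classical in
/-- A unit normal field `n(x)` along `A`. Up to sign it is unique almost everywhere on `A`. -/
def unitNormal {n : ℕ} (A : Set (Space n)) : Space n → Space n :=
  if h : IsPiecewiseC1 A then h.choose else 0

/-- The energy `∫_A ∫_A |⟨n(x), y - x⟩ ⟨y - x, n(y)⟩| / ‖x - y‖ ^ (n + 1) dσ(x) dσ(y)`. The integrand
is nonnegative, and the value lies in `[0, ∞]`. -/
def energy {n : ℕ} (A : Set (Space n)) : ℝ≥0∞ :=
  ∫⁻ y in A, ∫⁻ x in A,
    ENNReal.ofReal (|inner ℝ (unitNormal A x) (y - x) * inner ℝ (y - x) (unitNormal A y)| /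
      ‖x - y‖ ^ (n + 1)) ∂(surfaceMeasure n) ∂(surfaceMeasure n)

/-- The competitors: piecewise differentiable sets in the closed domain, of surface area `L`. -/
def competitors {n : ℕ} (Ω : Set (Space n)) (L : ℝ≥0∞) : Set (Set (Space n)) :=
  {A | A ⊆ closure Ω ∧ IsPiecewiseC1 A ∧ surfaceMeasure n A = L}

/-- The hyperplane `{x | ⟨v, x⟩ = b}` (for `v ≠ 0`). -/
def hyperplane {n : ℕ} (v : Space n) (b : ℝ) : Set (Space n) := {x | inner ℝ v x = b}

/-- `K` is a piece of a hyperplane, inside `Ω`. -/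
def IsFlatPiece {n : ℕ} (Ω K : Set (Space n)) : Prop :=
  MeasurableSet K ∧ ∃ (v : Space n) (b : ℝ), v ≠ 0 ∧ K ⊆ Ω ∩ hyperplane v b

/-- The union of the boundary copies `p + t i • (∂Ω - p)`, `i < m`. For `p` in a convex open `Ω`
and distinct factors `t i ∈ (0, 1]` they are pairwise disjoint. -/
def boundaryCopies {n m : ℕ} (Ω : Set (Space n)) (p : Space n) (t : Fin m → ℝ) :
    Set (Space n) :=
  ⋃ i, AffineMap.homothety p (t i) '' frontier Ω

/-- `m` pairwise distinct scaling factors in `(0, 1]`. -/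
def distinctFactors (m : ℕ) : Set (Fin m → ℝ) :=
  {t | Function.Injective t ∧ ∀ i, t i ∈ Ioc (0 : ℝ) 1}

/-- Among the piecewise differentiable sets of surface area `L` in the closed domain, the energy is
minimized by `m` copies of the boundary and a piece of a hyperplane:

* there is a (convex) piece `K` of a hyperplane for which `m` copies of `∂Ω` and `K` have total
  area `L`; and, for every piece `K` with this property,
* the energy of `K` and `m` nearby disjoint copies of `∂Ω` tends to the infimum of the energy over
  all competitors, when the copies tend to `∂Ω`;
* if `m ≤ 1`, so that there are no repeated copies, then the set made of `m` copies of `∂Ω` and of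
  `K` is itself a competitor, and the infimum is attained there. -/
def MinimizedByCopies {n : ℕ} (Ω : Set (Space n)) (m : ℕ) (L : ℝ≥0∞) : Prop :=
  (∃ K, IsFlatPiece Ω K ∧ Convex ℝ K ∧
    m * surfaceMeasure n (frontier Ω) + surfaceMeasure n K = L) ∧
  ∀ K, IsFlatPiece Ω K → m * surfaceMeasure n (frontier Ω) + surfaceMeasure n K = L →
    (∀ p ∈ Ω, Tendsto (fun t : Fin m → ℝ => energy (boundaryCopies Ω p t ∪ K))
      (𝓝[distinctFactors m] (fun _ => 1)) (𝓝 (⨅ A ∈ competitors Ω L, energy A))) ∧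
    (m ≤ 1 → (⋃ _ : Fin m, frontier Ω) ∪ K ∈ competitors Ω L ∧
      ∀ A ∈ competitors Ω L, energy ((⋃ _ : Fin m, frontier Ω) ∪ K) ≤ energy A)

end QuadraticCrofton

end

/-! The proof counts intersections with lines. Write `n = d + 1`, and for almost every line let `N`
be the number of points where the line crosses a piecewise differentiable set transversally. With
respect to the invariant measure on lines, Crofton's formula (`IsNormalPair.crofton`) gives `∫ N = c
* area` with a universal finite constant `c`. The energy is the next factorial moment: `∫ N * (N -
1)` (`IsNormalPair.quadratic_crofton`). To see this, fix one point `o` of a pair and project the set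
centrally from `o`. The kernel is exactly the Jacobian of this projection times the density of lines
through `o`, so the inner integral counts the crossings other than `o`. Integrating over `o` counts
ordered pairs of distinct crossings.

Minimizing the second moment for a given mean is then elementary. As `N` is an integer, `(N - 2m) *
(N - 2m - 1) ≥ 0`, that is `N * (N - 1) + 2m * (2m + 1) ≥ 4m * N`. Competitors lie in the closure of
`Ω`, so only lines meeting `Ω` matter, up to a null set of tangent lines. If `T` is the measure of
the lines meeting `Ω`, integration gives `E ≥ 4m * c * L - 2m * (2m + 1) * T` (`le_energy`).
Equality means that almost every line meeting `Ω` has `N = 2m` or `N = 2m + 1`. This is what `m`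
copies of the boundary of a convex set (two crossings each) and a flat piece (at most one crossing)
achieve. Since `c * |∂Ω| = 2 * T` (`croftonConst_mul_frontier`), the bound takes the closed form
`minEnergy`.

For `m ≥ 2` the copies cannot coincide, so they are shrunk slightly. Crossing numbers do not
increase, so the energy stays at most `minEnergy` (`energy_le`), and the lower bound, applied to
areas tending to `L`, gives the limit. To identify this limit with the infimum, competitors of area
exactly `L` are needed: the small area lost by shrinking is restored by a small flat disc, whose
cost tends to zero (`iInf_energy_le`).

The analytic tool is an area formula for maps from hypersurfaces to `ℝ^d`
(`IsNormalPair.lintegral_comp_mul`), used for parallel and for central projections. -/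

noncomputable section

namespace QuadraticCrofton

/-! ### Linear algebra: coordinates on `ℝ^(d+1)` and tangential Jacobians. -/

section

/-- Splitting off the first coordinate of `ℝ^(d+1)`. -/
def consL (d : ℕ) : (ℝ × Space d) ≃L[ℝ] Space (d + 1) :=
  LinearEquiv.toContinuousLinearEquiv
    { toFun := fun p => WithLp.toLp 2 (Fin.cons p.1 p.2)
      invFun := fun v => (v 0, WithLp.toLp 2 fun i => v i.succ)
      map_add' := fun p q => by
        ext i; refine Fin.cases ?_ (fun i => ?_) i <;> simp
      map_smul' := fun c p => by
        ext i; refine Fin.cases ?_ (fun i => ?_) i <;> simp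
      left_inv := fun p => by
        ext <;> simp
      right_inv := fun v => by
        ext i; refine Fin.cases ?_ (fun i => ?_) i <;> simp }

/-- All coordinates but the first. -/
def tail {d : ℕ} : Space (d + 1) →L[ℝ] Space d :=
  (ContinuousLinearMap.snd ℝ ℝ (Space d)).comp (consL d).symm.toContinuousLinearMap

/-- The first coordinate. -/
def head {d : ℕ} : Space (d + 1) →L[ℝ] ℝ :=
  (ContinuousLinearMap.fst ℝ ℝ (Space d)).comp (consL d).symm.toContinuousLinearMap

variable {d : ℕ}

@[simp] theorem consL_zero (p : ℝ × Space d) : consL d p 0 = p.1 := rfl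

@[simp] theorem consL_succ (p : ℝ × Space d) (i : Fin d) : consL d p i.succ = p.2 i := rfl

@[simp] theorem tail_apply (v : Space (d + 1)) (i : Fin d) : tail v i = v i.succ := rfl

theorem head_apply (v : Space (d + 1)) : head v = v 0 := rfl

@[simp] theorem head_consL (p : ℝ × Space d) : head (consL d p) = p.1 := rfl

@[simp] theorem tail_consL (p : ℝ × Space d) : tail (consL d p) = p.2 := by
  ext i; simp

theorem consL_head_tail (v : Space (d + 1)) : consL d (head v, tail v) = v :=
  (consL d).apply_symm_apply v

theorem ext_head_tail {v w : Space (d + 1)} (h0 : head v = head w) (h1 : tail v = tail w) :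
    v = w := by
  rw [← consL_head_tail v, ← consL_head_tail w, h0, h1]

theorem inner_eq_head_tail (v w : Space (d + 1)) :
    inner ℝ v w = head v * head w + inner ℝ (tail v) (tail w) := by
  simp only [PiLp.inner_apply, Fin.sum_univ_succ, head_apply, tail_apply, RCLike.inner_apply,
    conj_trivial]
  ring

theorem norm_sq_eq_head_tail (v : Space (d + 1)) :
    ‖v‖ ^ 2 = head v ^ 2 + ‖tail v‖ ^ 2 := by
  rw [← real_inner_self_eq_norm_sq, ← real_inner_self_eq_norm_sq, inner_eq_head_tail]
  ring

/-- The inclusion of `ℝ^d` as the hyperplane of vectors with vanishing first coordinate. -/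
def incl : Space d →ₗᵢ[ℝ] Space (d + 1) where
  toLinearMap := (consL d).toLinearMap ∘ₗ LinearMap.inr ℝ ℝ (Space d)
  norm_map' z := by
    have h := norm_sq_eq_head_tail (consL d (0, z))
    simp only [head_consL, tail_consL, ne_eq, OfNat.ofNat_ne_zero, not_false_eq_true, zero_pow,
      zero_add] at h
    exact (pow_left_inj₀ (norm_nonneg _) (norm_nonneg _) two_ne_zero).1 h

theorem incl_apply (z : Space d) : incl z = consL d (0, z) := rfl

@[simp] theorem head_incl (z : Space d) : head (incl z) = 0 := rfl

@[simp] theorem tail_incl (z : Space d) : tail (incl z) = z := by simp [incl_apply]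

theorem incl_tail {v : Space (d + 1)} (h : head v = 0) : incl (tail v) = v :=
  ext_head_tail (by simp [h]) (by simp)

/-- The endomorphism `v ↦ (⟨ν, v⟩, L v)` of `ℝ^(d+1)`, whose determinant is the Jacobian of `L` along
the hyperplane orthogonal to `ν`. -/
def bordered (ν : Space (d + 1)) (L : Space (d + 1) →L[ℝ] Space d) :
    Space (d + 1) →L[ℝ] Space (d + 1) :=
  (consL d).toContinuousLinearMap.comp ((innerSL ℝ ν).prod L)

theorem bordered_apply (ν : Space (d + 1)) (L : Space (d + 1) →L[ℝ] Space d) (v : Space (d + 1)) :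
    bordered ν L v = consL d (inner ℝ ν v, L v) := rfl

/-- The tangential Jacobian of a map with derivative `L` along a hypersurface with normal `ν`. -/
def tangentJacobian (ν : Space (d + 1)) (L : Space (d + 1) →L[ℝ] Space d) : ℝ :=
  |(bordered ν L).toLinearMap.det|

theorem det_consL_conj (s : ℝ →ₗ[ℝ] ℝ) (G : Space d →ₗ[ℝ] Space d) :
    ((consL d).toLinearEquiv.toLinearMap ∘ₗ (s.prodMap G) ∘ₗ
      (consL d).toLinearEquiv.symm.toLinearMap).det = s.det * G.det := by
  rw [LinearMap.det_conj, LinearMap.det_prodMap]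

/-- If `G : ℝ^d → ν^⊥` is a right inverse of `L`, its norm determinant is the inverse of the
tangential Jacobian of `L`. -/
theorem tangentJacobian_mul_normDet {ν : Space (d + 1)} (hν : ‖ν‖ = 1)
    {L : Space (d + 1) →L[ℝ] Space d} {G : Space d →ₗ[ℝ] Space (d + 1)}
    (hG : ∀ z, inner ℝ ν (G z) = 0) (hL : ∀ z, L (G z) = z) :
    tangentJacobian ν L * G.normDet = 1 := by
  classical
  set e : Space (d + 1) := consL d (1, 0) with he
  have hen : ‖e‖ = 1 := by
    have h := norm_sq_eq_head_tail e
    simp only [he, head_consL, tail_consL, norm_zero, ne_eq, OfNat.ofNat_ne_zero,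
      not_false_eq_true, zero_pow, add_zero] at h
    exact (pow_left_inj₀ (norm_nonneg _) zero_le_one two_ne_zero).1 h
  have hie : ∀ w, inner ℝ e w = head w := fun w => by
    rw [inner_eq_head_tail]; simp [he]
  set R : Space (d + 1) ≃ₗᵢ[ℝ] Space (d + 1) := (Submodule.reflection (Submodule.span ℝ {ν - e})ᗮ)
    with hR
  have hRν : R ν = e := Submodule.reflection_sub (hν.trans hen.symm)
  have hRs : ∀ w, inner ℝ ν (R.symm w) = head w := fun w => by
    rw [← hie, ← hRν, ← R.inner_map_map, R.apply_symm_apply]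
  have hhead : ∀ z, head (R (G z)) = 0 := fun z => by
    rw [← hRs, R.symm_apply_apply, hG]
  set G₀ : Space d →ₗ[ℝ] Space d := tail.toLinearMap ∘ₗ R.toLinearEquiv.toLinearMap ∘ₗ G with hG₀
  have hRG : R.toLinearEquiv.toLinearMap ∘ₗ G = incl.toLinearMap ∘ₗ G₀ := by
    ext1 z
    exact (incl_tail (hhead z)).symm
  have h1 : G.normDet = |G₀.det| := by
    have ha : (R.toLinearEquiv.toLinearMap ∘ₗ G).normDet = G.normDet := by
      rw [LinearMap.normDet_comp]
      convert one_mul _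
      exact (R.toLinearIsometry.comp G.range.subtypeₗᵢ).normDet_eq_one
    rw [← ha, hRG]
    rw [LinearMap.normDet_comp_of_finrank_eq _ _ rfl, LinearMap.normDet_eq_abs_det,
      incl.normDet_eq_one, one_mul]
  set H := (consL d).toLinearEquiv.toLinearMap ∘ₗ ((LinearMap.id : ℝ →ₗ[ℝ] ℝ).prodMap G₀) ∘ₗ
      (consL d).toLinearEquiv.symm.toLinearMap with hH
  have hHdet : H.det = G₀.det := by rw [hH, det_consL_conj]; simp
  -- `G` only fills the hyperplane orthogonal to `ν`. Extending it by the missing unit normal gives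
  -- a square map, and its composite with the bordered map is a shear, of determinant `1`. The
  -- reflection does not affect absolute determinants.
  have key : (bordered ν L).toLinearMap ∘ₗ R.symm.toLinearEquiv.toLinearMap ∘ₗ H =
      LinearMap.transvection head.toLinearMap (incl (L (R.symm e))) := by
    ext1 w
    have hHw : H w = head w • e + R (G (tail w)) := by
      apply ext_head_tail
      · simp [hhead, he, hH]; rfl
      · simp [he, hH, hG₀]; rfl
    have : R.symm (H w) = head w • R.symm e + G (tail w) := by
      rw [hHw, map_add, map_smul, R.symm_apply_apply]
    change bordered ν L (R.symm (H w)) = _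
    rw [this, LinearMap.transvection.apply, bordered_apply]
    apply ext_head_tail
    · simp [inner_add_right, inner_smul_right, hRs, hG, he]
    · simp [hL, add_comm]
  have h2 := congrArg LinearMap.det key
  rw [LinearMap.det_comp, LinearMap.det_comp, hHdet, LinearMap.transvection.det] at h2
  have h3 := congrArg abs h2
  have hR1 : |R.symm.toLinearEquiv.toLinearMap.det| = 1 := by
    rw [← LinearMap.normDet_eq_abs_det]
    exact R.symm.toLinearIsometry.normDet_eq_one
  rw [abs_mul, abs_mul, hR1, one_mul, ← h1] at h3
  simpa [tangentJacobian] using h3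

theorem tangentJacobian_smul (ν : Space (d + 1)) (L : Space (d + 1) →L[ℝ] Space d) (c : ℝ) :
    tangentJacobian ν (c • L) = |c| ^ d * tangentJacobian ν L := by
  have : (bordered ν (c • L)).toLinearMap =
      ((consL d).toLinearEquiv.toLinearMap ∘ₗ
        ((LinearMap.id : ℝ →ₗ[ℝ] ℝ).prodMap (c • (LinearMap.id : Space d →ₗ[ℝ] Space d))) ∘ₗ
      (consL d).toLinearEquiv.symm.toLinearMap) ∘ₗ (bordered ν L).toLinearMap := by
    ext1 v
    apply ext_head_tail
    · simp [bordered_apply]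
    · simp [bordered_apply]
  rw [tangentJacobian, tangentJacobian, this, LinearMap.det_comp, det_consL_conj, abs_mul]
  simp

/-- The direction with first coordinate `1` and remaining coordinates `b`. -/
def dir (b : Space d) : Space (d + 1) := consL d (1, b)

@[simp] theorem head_dir (b : Space d) : head (dir b) = 1 := rfl

@[simp] theorem tail_dir (b : Space d) : tail (dir b) = b := by simp [dir]

/-- The projection onto `ℝ^d` along the direction `dir b`. -/
def proj (b : Space d) : Space (d + 1) →L[ℝ] Space d := tail - head.smulRight b

theorem proj_apply (b : Space d) (v : Space (d + 1)) : proj b v = tail v - head v • b := rfl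

/-- Composing with the shear along `incl b`, of determinant `1`, turns the tail of the bordered map
into `tail` itself. What remains is a rank one perturbation of the identity, whose determinant is
read off. -/
theorem tangentJacobian_proj (ν : Space (d + 1)) (b : Space d) :
    tangentJacobian ν (proj b) = |inner ℝ ν (dir b)| := by
  classical
  set e : Space (d + 1) := consL d (1, 0) with he
  have hdir : dir b = e + incl b := by
    apply ext_head_tail <;> simp [he]
  let g : Space (d + 1) →ₗ[ℝ] ℝ := (innerSL ℝ ν).toLinearMap +
    (inner ℝ ν (incl b) - 1) • head.toLinearMap
  have key : (bordered ν (proj b)).toLinearMap ∘ₗ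
      LinearMap.transvection head.toLinearMap (incl b) = LinearMap.transvection g e := by
    ext1 v
    change bordered ν (proj b) (v + head v • incl b) = v + (inner ℝ ν v +
      (inner ℝ ν (incl b) - 1) * head v) • e
    rw [bordered_apply]
    apply ext_head_tail
    · simp [inner_add_right, inner_smul_right, he]
      ring
    · simp [proj_apply, he]
  have h2 := congrArg LinearMap.det key
  rw [LinearMap.det_comp, LinearMap.transvection.det, LinearMap.transvection.det] at h2
  have h3 : (bordered ν (proj b)).toLinearMap.det = inner ℝ ν (dir b) := by
    have : head.toLinearMap (incl b) = 0 := rfl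
    rw [this, add_zero, mul_one] at h2
    rw [h2, hdir]
    change 1 + (inner ℝ ν e + (inner ℝ ν (incl b) - 1) * head e) = _
    simp only [he, inner_add_right, head_consL]
    ring
  rw [tangentJacobian, h3]

end

/-! ### Local comparison of surface area with the volume of an image in `ℝ^d`. -/

section

variable {d : ℕ}

theorem surfaceMeasure_succ (s : Set (Space (d + 1))) :
    surfaceMeasure (d + 1) s = Measure.euclideanHausdorffMeasure d s := rfl

theorem surfaceMeasure_image_le {K : NNReal} {ψ : Space (d + 1) → Space (d + 1)}
    {C : Set (Space (d + 1))} (h : LipschitzOnWith K ψ C) :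
    surfaceMeasure (d + 1) (ψ '' C) ≤ K ^ d * surfaceMeasure (d + 1) C := by
  have := h.hausdorffMeasure_image_le (d := (d : ℝ)) (by positivity)
  simp only [surfaceMeasure_succ, Measure.euclideanHausdorffMeasure_def, Measure.smul_apply,
    ENNReal.smul_def, smul_eq_mul]
  rw [ENNReal.rpow_natCast] at this
  refine (mul_le_mul_right this _).trans_eq ?_
  ring

theorem surfaceMeasure_le_image {K : NNReal} {ψ : Space (d + 1) → Space (d + 1)}
    {C : Set (Space (d + 1))} (h : ∀ x ∈ C, ∀ y ∈ C, dist x y ≤ K * dist (ψ x) (ψ y)) :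
    surfaceMeasure (d + 1) C ≤ K ^ d * surfaceMeasure (d + 1) (ψ '' C) := by
  have hinj : InjOn ψ C := fun x hx y hy hxy => by
    have := h x hx y hy
    rw [hxy, dist_self, mul_zero] at this
    exact dist_le_zero.1 this
  have hlip : LipschitzOnWith K (Function.invFunOn ψ C) (ψ '' C) := by
    refine LipschitzOnWith.of_dist_le_mul ?_
    rintro _ ⟨x, hx, rfl⟩ _ ⟨y, hy, rfl⟩
    rw [hinj.leftInvOn_invFunOn hx, hinj.leftInvOn_invFunOn hy]
    exact h x hx y hy
  have := surfaceMeasure_image_le hlip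
  rwa [hinj.leftInvOn_invFunOn.image_image] at this

/-- `ν` is normal to `P` at `y₀`, in a strict sense. -/
def TangentAt (P : Set (Space d)) (ν y₀ : Space d) : Prop :=
  ∀ ε > 0, ∃ U ∈ 𝓝 y₀, ∀ y ∈ P ∩ U, ∀ y' ∈ P ∩ U, |inner ℝ ν (y - y')| ≤ ε * ‖y - y'‖

theorem TangentAt.mono {P Q : Set (Space d)} {ν y : Space d} (h : TangentAt P ν y) (hQ : Q ⊆ P) :
    TangentAt Q ν y := fun ε hε => by
  obtain ⟨U, hU, h⟩ := h ε hε
  exact ⟨U, hU, fun y hy y' hy' => h y ⟨hQ hy.1, hy.2⟩ y' ⟨hQ hy'.1, hy'.2⟩⟩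

theorem norm_consL_le (p : ℝ × Space d) : ‖consL d p‖ ≤ |p.1| + ‖p.2‖ := by
  have h := norm_sq_eq_head_tail (consL d p)
  rw [head_consL, tail_consL] at h
  refine abs_le_of_sq_le_sq' ?_ (by positivity) |>.2
  rw [h, ← sq_abs p.1]
  nlinarith [abs_nonneg p.1, norm_nonneg p.2]

/-- Near a point of a set with normal `ν` where the tangential Jacobian does not vanish, a map is
injective along the set and scales the surface measure approximately by the Jacobian. -/
theorem TangentAt.exists_nhds_measure_image {P : Set (Space (d + 1))} {ν y₀ : Space (d + 1)}
    (hP : TangentAt P ν y₀) (hν : ‖ν‖ = 1) {f : Space (d + 1) → Space d}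
    {L : Space (d + 1) →L[ℝ] Space d} (hf : HasStrictFDerivAt f L y₀)
    (hJ : tangentJacobian ν L ≠ 0) {q : NNReal} (hq : 1 < q) :
    ∃ U ∈ 𝓝 y₀, InjOn f (P ∩ U) ∧ ∀ C ⊆ P ∩ U,
      ENNReal.ofReal (tangentJacobian ν L) * surfaceMeasure (d + 1) C ≤ q * volume (f '' C) ∧
      volume (f '' C) ≤
        q * (ENNReal.ofReal (tangentJacobian ν L) * surfaceMeasure (d + 1) C) := by
  have hdet : (bordered ν L).det ≠ 0 := fun h => hJ (by
    rw [tangentJacobian]; exact abs_eq_zero.2 h)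
  set D := (bordered ν L).toContinuousLinearEquivOfDetNeZero hdet with hD
  have hDa : ∀ v, D v = bordered ν L v := fun v => rfl
  obtain ⟨δ, hδ0, hδ1, hδq, hδq'⟩ : ∃ δ : ℝ, 0 < δ ∧ δ < 1 ∧ (1 + δ) ^ d ≤ q ∧
      ((1 - δ)⁻¹) ^ d ≤ q := by
    have h1 : Tendsto (fun δ : ℝ => (1 + δ) ^ d) (𝓝[>] 0) (𝓝 1) := by
      have : ContinuousAt (fun δ : ℝ => (1 + δ) ^ d) 0 := by fun_prop
      simpa [ContinuousAt] using this.tendsto.mono_left nhdsWithin_le_nhds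
    have h2 : Tendsto (fun δ : ℝ => ((1 - δ)⁻¹) ^ d) (𝓝[>] 0) (𝓝 1) := by
      have : ContinuousAt (fun δ : ℝ => ((1 - δ)⁻¹) ^ d) 0 := by
        refine ContinuousAt.pow (ContinuousAt.inv₀ (by fun_prop) (by norm_num)) _
      simpa [ContinuousAt] using this.tendsto.mono_left nhdsWithin_le_nhds
    have hq' : (1 : ℝ) < q := by exact_mod_cast hq
    have h3 : ∀ᶠ δ : ℝ in 𝓝[>] 0, δ < 1 :=
      nhdsWithin_le_nhds (Iio_mem_nhds one_pos)
    obtain ⟨δ, hδ⟩ := ((h1.eventually (ge_mem_nhds hq')).and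
      ((h2.eventually (ge_mem_nhds hq')).and (h3.and self_mem_nhdsWithin))).exists
    exact ⟨δ, hδ.2.2.2, hδ.2.2.1, hδ.1, hδ.2.1⟩
  set c : ℝ := ‖(D.symm : Space (d + 1) →L[ℝ] Space (d + 1))‖ with hc
  have hc0 : 0 ≤ c := norm_nonneg _
  -- Two errors of relative size `ε`, one from the normal component and one from linearising `f`,
  -- are magnified by at most `c`. They must add up to at most `δ`.
  set ε : ℝ := δ / (2 * (c + 1)) with hε
  have hε0 : 0 < ε := by positivity
  have hcε : c * (2 * ε) ≤ δ := by
    have : c * (2 * ε) = δ * (c / (c + 1)) := by rw [hε]; field_simp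
    rw [this]
    exact mul_le_of_le_one_right hδ0.le ((div_le_one (by positivity)).2 (by linarith))
  obtain ⟨U, hU, hUν⟩ := hP ε hε0
  obtain ⟨V, hV, hVf⟩ := hf.approximates_deriv_on_nhds (c := ⟨ε, hε0.le⟩) (Or.inr hε0)
  -- Undoing the linearisation of `f` makes `ψ` close to the identity along `P`: applied to the
  -- error of `ψ`, the map `D` yields only the normal component of the chord and the linearisation
  -- error of `f`. Hence `ψ` nearly preserves surface area.
  set ψ : Space (d + 1) → Space (d + 1) := fun y => D.symm (incl (f y)) with hψ
  have hψe : ∀ y ∈ P ∩ (U ∩ V), ∀ y' ∈ P ∩ (U ∩ V), ‖ψ y - ψ y' - (y - y')‖ ≤ δ * ‖y - y'‖ := by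
    intro y hy y' hy'
    have h1 : ψ y - ψ y' - (y - y') = D.symm (consL d (-inner ℝ ν (y - y'),
        f y - f y' - L (y - y'))) := by
      apply D.injective
      rw [D.apply_symm_apply, map_sub, map_sub, hψ, D.apply_symm_apply, D.apply_symm_apply, hDa,
        bordered_apply]
      apply ext_head_tail <;> simp
    rw [h1]
    calc _ ≤ c * ‖consL d (-inner ℝ ν (y - y'), f y - f y' - L (y - y'))‖ :=
          (D.symm : Space (d + 1) →L[ℝ] Space (d + 1)).le_opNorm _
      _ ≤ c * (ε * ‖y - y'‖ + ε * ‖y - y'‖) := by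
          refine mul_le_mul_of_nonneg_left ((norm_consL_le _).trans (add_le_add ?_ ?_)) hc0
          · rw [abs_neg]
            exact hUν y ⟨hy.1, hy.2.1⟩ y' ⟨hy'.1, hy'.2.1⟩
          · exact hVf y hy.2.2 y' hy'.2.2
      _ = c * (2 * ε) * ‖y - y'‖ := by ring
      _ ≤ δ * ‖y - y'‖ := mul_le_mul_of_nonneg_right hcε (norm_nonneg _)
  have hup : ∀ y ∈ P ∩ (U ∩ V), ∀ y' ∈ P ∩ (U ∩ V), ‖ψ y - ψ y'‖ ≤ (1 + δ) * ‖y - y'‖ := by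
    intro y hy y' hy'
    have h1 := hψe y hy y' hy'
    have h2 := norm_add_le (ψ y - ψ y' - (y - y')) (y - y')
    rw [sub_add_cancel] at h2
    linarith
  have hlo : ∀ y ∈ P ∩ (U ∩ V), ∀ y' ∈ P ∩ (U ∩ V), ‖y - y'‖ ≤ (1 - δ)⁻¹ * ‖ψ y - ψ y'‖ := by
    intro y hy y' hy'
    have h1 := hψe y hy y' hy'
    have h2 := norm_sub_le (ψ y - ψ y') (ψ y - ψ y' - (y - y'))
    rw [sub_sub_cancel] at h2
    rw [inv_mul_eq_div, le_div_iff₀ (by linarith)]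
    linarith
  have hvol : ∀ C, volume (f '' C) =
      ENNReal.ofReal (tangentJacobian ν L) * surfaceMeasure (d + 1) (ψ '' C) := by
    intro C
    -- `ψ '' C` is the image of `f '' C` under the linear map `G`, a right inverse of `L` with
    -- values orthogonal to `ν`. Its norm determinant is the inverse Jacobian, so here the area
    -- relation is exact.
    set G : Space d →ₗ[ℝ] Space (d + 1) :=
      D.symm.toLinearEquiv.toLinearMap ∘ₗ incl.toLinearMap with hG
    have hDG : ∀ z, bordered ν L (G z) = incl z := fun z => by
      rw [← hDa]; exact D.apply_symm_apply _
    have h1 := tangentJacobian_mul_normDet hν (L := L) (G := G)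
      (fun z => by simpa [bordered_apply] using congrArg head (hDG z))
      (fun z => by simpa [bordered_apply] using congrArg tail (hDG z))
    have h2 := G.euclideanHausdorffMeasure_image_eq_normDet_mul_volume (f '' C)
    rw [finrank_euclideanSpace_fin, image_image] at h2
    change surfaceMeasure (d + 1) (ψ '' C) = _ at h2
    rw [h2, ← mul_assoc, ← ENNReal.ofReal_mul (p := tangentJacobian ν L) (abs_nonneg _), h1, ENNReal.ofReal_one, one_mul]
  refine ⟨U ∩ V, inter_mem hU hV, ?_, fun C hC => ⟨?_, ?_⟩⟩
  · intro y hy y' hy' hyy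
    have := hlo y hy y' hy'
    simp only [hψ, hyy, sub_self, norm_zero, mul_zero] at this
    exact sub_eq_zero.1 (norm_le_zero_iff.1 this)
  · have h1 : surfaceMeasure (d + 1) C ≤ q * surfaceMeasure (d + 1) (ψ '' C) := by
      refine (surfaceMeasure_le_image (K := Real.toNNReal (1 - δ)⁻¹) ?_).trans
        (mul_le_mul_left ?_ _)
      · intro x hx y hy
        rw [Real.coe_toNNReal _ (inv_nonneg.2 (by linarith)), dist_eq_norm, dist_eq_norm]
        exact hlo x (hC hx) y (hC hy)
      · rw [← ENNReal.coe_pow, ENNReal.coe_le_coe, ← NNReal.coe_le_coe, NNReal.coe_pow,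
          Real.coe_toNNReal _ (inv_nonneg.2 (by linarith))]
        exact hδq'
    rw [hvol]
    calc _ ≤ _ * (q * surfaceMeasure (d + 1) (ψ '' C)) := mul_le_mul_right h1 _
      _ = _ := by ring
  · have h1 : surfaceMeasure (d + 1) (ψ '' C) ≤ q * surfaceMeasure (d + 1) C := by
      refine (surfaceMeasure_image_le (K := Real.toNNReal (1 + δ)) ?_).trans
        (mul_le_mul_left ?_ _)
      · refine LipschitzOnWith.of_dist_le_mul fun x hx y hy => ?_
        rw [Real.coe_toNNReal _ (by linarith), dist_eq_norm, dist_eq_norm]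
        exact hup x (hC hx) y (hC hy)
      · rw [← ENNReal.coe_pow, ENNReal.coe_le_coe, ← NNReal.coe_le_coe, NNReal.coe_pow,
          Real.coe_toNNReal _ (by linarith)]
        exact hδq
    rw [hvol]
    calc _ ≤ _ * (q * surfaceMeasure (d + 1) C) := mul_le_mul_right h1 _
      _ = _ := by ring

end

/-! ### The area formula, by counting preimages. -/

section

/-- A measurable set that is locally covered by members of a hereditary family of measurable sets is
a countable disjoint union of such members. -/
theorem exists_countable_partition {X : Type*} [TopologicalSpace X] [SecondCountableTopology X]
    [MeasurableSpace X] [BorelSpace X] {C : Set X} (hC : MeasurableSet C) {p : Set X → Prop}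
    (h0 : p ∅) (h : ∀ y ∈ C, ∃ U ∈ 𝓝 y, ∀ s ⊆ C ∩ U, MeasurableSet s → p s) :
    ∃ S : ℕ → Set X, (∀ i, MeasurableSet (S i) ∧ S i ⊆ C ∧ p (S i)) ∧
      Pairwise (Function.onFun Disjoint S) ∧ ⋃ i, S i = C := by
  rcases C.eq_empty_or_nonempty with rfl | hne
  · exact ⟨fun _ => ∅, fun i => ⟨MeasurableSet.empty, subset_rfl, h0⟩,
      fun i j _ => disjoint_bot_left, by simp⟩
  have h' : ∀ y, ∃ U, y ∈ C → U ∈ 𝓝 y ∧ IsOpen U ∧ ∀ s ⊆ C ∩ U, MeasurableSet s → p s := by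
    intro y
    by_cases hy : y ∈ C
    · obtain ⟨U, hU, hUp⟩ := h y hy
      obtain ⟨V, hVU, hV, hyV⟩ := mem_nhds_iff.1 hU
      exact ⟨V, fun _ => ⟨hV.mem_nhds hyV, hV, fun s hs =>
        hUp s (hs.trans (inter_subset_inter_right _ hVU))⟩⟩
    · exact ⟨univ, fun h => (hy h).elim⟩
  choose U hU using h'
  obtain ⟨t, htC, ht, hcov⟩ := TopologicalSpace.countable_cover_nhdsWithin (f := U) (s := C)
    fun y hy => nhdsWithin_le_nhds (hU y hy).1
  have htne : t.Nonempty := by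
    obtain ⟨y, hy⟩ := hne
    obtain ⟨x, hx, -⟩ := mem_iUnion₂.1 (hcov hy)
    exact ⟨x, hx⟩
  obtain ⟨g, rfl⟩ := ht.exists_eq_range htne
  have hgC : ∀ i, g i ∈ C := fun i => htC (mem_range_self i)
  have hm : ∀ i, MeasurableSet (disjointed (fun i => C ∩ U (g i)) i) := fun i =>
    MeasurableSet.disjointed (fun j => hC.inter (hU _ (hgC j)).2.1.measurableSet) i
  have hs : ∀ i, disjointed (fun i => C ∩ U (g i)) i ⊆ C ∩ U (g i) := fun i => disjointed_subset _ i
  refine ⟨disjointed fun i => C ∩ U (g i), fun i => ⟨hm i, (hs i).trans inter_subset_left,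
    (hU _ (hgC i)).2.2 _ (hs i) (hm i)⟩, disjoint_disjointed _, ?_⟩
  rw [iUnion_disjointed, ← inter_iUnion, inter_eq_left]
  simpa using hcov

/-- The number of preimages in `C`. -/
def fiberCount {X Y : Type*} [MeasurableSpace X] (f : X → Y) (C : Set X) (z : Y) : ℝ≥0∞ :=
  Measure.count (C ∩ f ⁻¹' {z})

theorem fiberCount_iUnion {X Y ι : Type*} [Countable ι] [MeasurableSpace X] [MeasurableSpace Y]
    [MeasurableSingletonClass Y] {f : X → Y} (hf : Measurable f) {S : ι → Set X}
    (hS : ∀ i, MeasurableSet (S i)) (hd : Pairwise (Function.onFun Disjoint S)) (z : Y) :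
    fiberCount f (⋃ i, S i) z = ∑' i, fiberCount f (S i) z := by
  rw [fiberCount, iUnion_inter, measure_iUnion]
  · rfl
  · exact fun i j hij => (hd hij).mono inter_subset_left inter_subset_left
  · exact fun i => (hS i).inter (hf (measurableSet_singleton z))

theorem fiberCount_of_injOn {X Y : Type*} [MeasurableSpace X] [MeasurableSingletonClass X]
    {f : X → Y} {C : Set X} (hf : InjOn f C) (z : Y) :
    fiberCount f C z = (f '' C).indicator 1 z := by
  by_cases hz : z ∈ f '' C
  · rw [indicator_of_mem hz]
    obtain ⟨x, hx, rfl⟩ := hz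
    have : C ∩ f ⁻¹' {f x} = {x} := by
      ext y
      constructor
      · rintro ⟨hy, hyx⟩
        exact hf hy hx hyx
      · rintro rfl
        exact ⟨hx, rfl⟩
    rw [fiberCount, this, Measure.count_singleton, Pi.one_apply]
  · rw [indicator_of_notMem hz]
    have : C ∩ f ⁻¹' {z} = ∅ := by
      ext y
      simp only [mem_inter_iff, mem_preimage, mem_singleton_iff, mem_empty_iff_false, iff_false]
      exact fun h => hz ⟨y, h.1, h.2⟩
    rw [fiberCount, this, measure_empty]

/-- The number of preimages under a locally injective Borel map is measurable. -/
theorem measurable_fiberCount {X Y : Type*} [TopologicalSpace X] [PolishSpace X]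
    [MeasurableSpace X] [BorelSpace X] [TopologicalSpace Y] [T2Space Y]
    [MeasurableSpace Y] [BorelSpace Y] [MeasurableSingletonClass Y]
    [SecondCountableTopology Y]
    {f : X → Y} (hf : Measurable f) {C : Set X} (hC : MeasurableSet C)
    (h : ∀ y ∈ C, ∃ U ∈ 𝓝 y, InjOn f (C ∩ U)) : Measurable (fiberCount f C) := by
  obtain ⟨S, hS, hd, hU⟩ := exists_countable_partition hC (p := fun s => InjOn f s)
    (injOn_empty f) (fun y hy => by
      obtain ⟨U, hU, hi⟩ := h y hy
      exact ⟨U, hU, fun s hs _ => hi.mono hs⟩)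
  have : fiberCount f C = fun z => ∑' i, fiberCount f (S i) z := by
    ext z
    rw [← hU, fiberCount_iUnion hf (fun i => (hS i).1) hd]
  rw [this]
  refine Measurable.tsum fun i => ?_
  have hi : fiberCount f (S i) = (f '' S i).indicator 1 :=
    funext fun z => fiberCount_of_injOn (hS i).2.2 z
  rw [hi]
  -- Lusin–Souslin: the image of a Borel set under an injective Borel map is Borel.
  exact measurable_one.indicator ((hS i).1.image_of_measurable_injOn hf (hS i).2.2)

variable {d : ℕ}

/-- `C` is a Borel set with Borel unit normal field `ν`: a countable disjoint union of Borel sets to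
which `ν` is normal. -/
structure IsNormalPair (C : Set (Space d)) (ν : Space d → Space d) : Prop where
  measurableSet : MeasurableSet C
  measurable : Measurable ν
  norm_eq_one : ∀ y ∈ C, ‖ν y‖ = 1
  exists_partition : ∃ P : ℕ → Set (Space d), (∀ k, MeasurableSet (P k)) ∧
    Pairwise (Function.onFun Disjoint P) ∧ ⋃ k, P k = C ∧ ∀ k, ∀ y ∈ P k, TangentAt (P k) (ν y) y

theorem IsNormalPair.mono {C D : Set (Space d)} {ν : Space d → Space d} (h : IsNormalPair C ν)
    (hD : MeasurableSet D) (hDC : D ⊆ C) : IsNormalPair D ν := by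
  obtain ⟨P, hm, hd, hU, ht⟩ := h.exists_partition
  refine ⟨hD, h.measurable, fun y hy => h.norm_eq_one y (hDC hy), fun k => D ∩ P k,
    fun k => hD.inter (hm k), fun i j hij => (hd hij).mono inter_subset_right inter_subset_right,
    ?_, fun k y hy => (ht k y hy.2).mono inter_subset_right⟩
  rw [← inter_iUnion, hU, inter_eq_left.2 hDC]

/-- The area formula up to a factor `q`. -/
def AreaBounds (q : ℝ≥0∞) (f : Space (d + 1) → Space d) (J : Space (d + 1) → ℝ≥0∞)
    (C : Set (Space (d + 1))) : Prop :=
  Measurable (fiberCount f C) ∧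
    ∫⁻ z, fiberCount f C z ≤ q * ∫⁻ y in C, J y ∂surfaceMeasure (d + 1) ∧
    ∫⁻ y in C, J y ∂surfaceMeasure (d + 1) ≤ q * ∫⁻ z, fiberCount f C z

theorem AreaBounds.iUnion {ι : Type*} [Countable ι] {q : ℝ≥0∞} {f : Space (d + 1) → Space d}
    (hf : Measurable f) {J : Space (d + 1) → ℝ≥0∞} {S : ι → Set (Space (d + 1))}
    (hS : ∀ i, MeasurableSet (S i)) (hd : Pairwise (Function.onFun Disjoint S))
    (h : ∀ i, AreaBounds q f J (S i)) : AreaBounds q f J (⋃ i, S i) := by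
  have h1 : fiberCount f (⋃ i, S i) = fun z => ∑' i, fiberCount f (S i) z :=
    funext fun z => fiberCount_iUnion hf hS hd z
  have h2 : ∫⁻ z, fiberCount f (⋃ i, S i) z = ∑' i, ∫⁻ z, fiberCount f (S i) z := by
    rw [h1, lintegral_tsum fun i => (h i).1.aemeasurable]
  refine ⟨?_, ?_, ?_⟩
  · rw [h1]
    exact Measurable.tsum fun i => (h i).1
  · rw [h2, lintegral_iUnion hS hd, ← ENNReal.tsum_mul_left]
    exact ENNReal.tsum_le_tsum fun i => (h i).2.1
  · rw [h2, lintegral_iUnion hS hd, ← ENNReal.tsum_mul_left]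
    exact ENNReal.tsum_le_tsum fun i => (h i).2.2

/-- One factor `q` pays for linearising `f` near a point, the other for replacing the Jacobian by a
constant. Both losses are uniform over the countably many small pieces, so they survive summation.
-/
theorem areaBounds_of_small {C : Set (Space (d + 1))} (hC : MeasurableSet C)
    {ν : Space (d + 1) → Space (d + 1)} {f : Space (d + 1) → Space d} (hfm : Measurable f)
    {L : Space (d + 1) → Space (d + 1) →L[ℝ] Space d}
    (hν : ∀ y ∈ C, ‖ν y‖ = 1) (ht : ∀ y ∈ C, TangentAt C (ν y) y)
    (hf : ∀ y ∈ C, HasStrictFDerivAt f (L y) y) {J : Space (d + 1) → ℝ≥0∞}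
    (hJ : ∀ y ∈ C, J y = ENNReal.ofReal (tangentJacobian (ν y) (L y))) {q : NNReal} (hq : 1 < q)
    {a : ℝ≥0∞} (ha : a ≠ 0) (hJa : ∀ y ∈ C, a ≤ J y ∧ J y ≤ q * a) :
    AreaBounds (q ^ 2) f J C := by
  obtain ⟨S, hS, hd, hU⟩ := exists_countable_partition hC (p := AreaBounds (q ^ 2) f J) (by
      have : fiberCount f (∅ : Set (Space (d + 1))) = fun _ => 0 := by ext; simp [fiberCount]
      refine ⟨?_, ?_, ?_⟩
      · rw [this]; fun_prop
      · simp [this]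
      · simp [this]) (fun y hy => by
    have hJy : tangentJacobian (ν y) (L y) ≠ 0 := fun h0 => by
      have := (hJa y hy).1
      rw [hJ y hy, h0, ENNReal.ofReal_zero] at this
      exact ha (le_zero_iff.1 this)
    obtain ⟨U, hU, hi, hb⟩ := (ht y hy).exists_nhds_measure_image (hν y hy) (hf y hy) hJy hq
    refine ⟨U, hU, fun s hs hsm => ?_⟩
    have hfs : fiberCount f s = (f '' s).indicator 1 :=
      funext fun z => fiberCount_of_injOn (hi.mono hs) z
    have hms := hsm.image_of_measurable_injOn hfm (hi.mono hs)
    have hint : ∫⁻ z, fiberCount f s z = volume (f '' s) := by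
      rw [hfs, lintegral_indicator_one hms]
    obtain ⟨hb1, hb2⟩ := hb s hs
    rw [← hJ y hy] at hb1 hb2
    have hsC : ∀ x ∈ s, x ∈ C := fun x hx => (hs hx).1
    have hlow : a * surfaceMeasure (d + 1) s ≤ ∫⁻ x in s, J x ∂surfaceMeasure (d + 1) := by
      rw [← setLIntegral_const]
      exact setLIntegral_mono' hsm fun x hx => (hJa x (hsC x hx)).1
    have hupp : ∫⁻ x in s, J x ∂surfaceMeasure (d + 1) ≤ q * a * surfaceMeasure (d + 1) s := by
      rw [← setLIntegral_const]
      exact setLIntegral_mono' hsm fun x hx => (hJa x (hsC x hx)).2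
    refine ⟨?_, ?_, ?_⟩
    · rw [hfs]
      exact measurable_one.indicator hms
    · rw [hint]
      calc volume (f '' s) ≤ q * (J y * surfaceMeasure (d + 1) s) := hb2
        _ ≤ q * (q * a * surfaceMeasure (d + 1) s) := by
            gcongr; exact (hJa y hy).2
        _ = q ^ 2 * (a * surfaceMeasure (d + 1) s) := by ring
        _ ≤ _ := by gcongr
    · rw [hint]
      calc _ ≤ q * a * surfaceMeasure (d + 1) s := hupp
        _ ≤ q * (J y * surfaceMeasure (d + 1) s) := by
            rw [mul_assoc]; gcongr; exact (hJa y hy).1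
        _ ≤ q * (q * volume (f '' s)) := by gcongr
        _ = _ := by ring)
  rw [← hU]
  exact AreaBounds.iUnion hfm (fun i => (hS i).1) hd fun i => (hS i).2.2

/-- The area formula for maps of hypersurfaces to a hyperplane, without critical points. -/
theorem IsNormalPair.areaBounds {C : Set (Space (d + 1))}
    {ν : Space (d + 1) → Space (d + 1)} (hC : IsNormalPair C ν)
    {f : Space (d + 1) → Space d} (hfm : Measurable f)
    {L : Space (d + 1) → Space (d + 1) →L[ℝ] Space d}
    (hf : ∀ y ∈ C, HasStrictFDerivAt f (L y) y) {J : Space (d + 1) → ℝ≥0∞} (hJm : Measurable J)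
    (hJ : ∀ y ∈ C, J y = ENNReal.ofReal (tangentJacobian (ν y) (L y)))
    (hJ0 : ∀ y ∈ C, J y ≠ 0) {q : NNReal} (hq : 1 < q) : AreaBounds (q ^ 2) f J C := by
  obtain ⟨P, hm, hd, hU, ht⟩ := hC.exists_partition
  have hPC : ∀ k, P k ⊆ C := fun k => by rw [← hU]; exact subset_iUnion P k
  -- Geometric level sets of `J`: on each of them the Jacobian is constant up to the factor `q`.
  -- They cover because `J` is positive and finite on `C`.
  set S : ℕ × ℤ → Set (Space (d + 1)) := fun p =>
    P p.1 ∩ J ⁻¹' Ico ((q : ℝ≥0∞) ^ p.2) ((q : ℝ≥0∞) ^ (p.2 + 1)) with hS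
  have hq0 : (q : ℝ≥0∞) ≠ 0 := by
    have := zero_lt_one.trans hq
    exact_mod_cast this.ne'
  have hq1 : 1 < (q : ℝ≥0∞) := by exact_mod_cast hq
  have hSU : ⋃ p, S p = C := by
    ext y
    simp only [mem_iUnion, Prod.exists]
    constructor
    · rintro ⟨k, j, hy⟩
      exact hPC k hy.1
    · intro hy
      obtain ⟨k, hk⟩ := mem_iUnion.1 (hU.symm ▸ hy : y ∈ ⋃ k, P k)
      obtain ⟨j, hj⟩ := ENNReal.exists_mem_Ico_zpow (hJ0 y hy)
        (by rw [hJ y hy]; exact ENNReal.ofReal_ne_top) hq1 ENNReal.coe_ne_top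
      exact ⟨k, j, hk, hj⟩
  have hSm : ∀ p, MeasurableSet (S p) := fun p => (hm p.1).inter (hJm measurableSet_Ico)
  have hSd : Pairwise (Function.onFun Disjoint S) := by
    rintro ⟨k, i⟩ ⟨l, j⟩ hne
    by_cases hkl : k = l
    · subst hkl
      have hij : i ≠ j := fun h => hne (by rw [h])
      have hdisj : ∀ i j : ℤ, i < j → Disjoint (Ico ((q : ℝ≥0∞) ^ i) ((q : ℝ≥0∞) ^ (i + 1)))
          (Ico ((q : ℝ≥0∞) ^ j) ((q : ℝ≥0∞) ^ (j + 1))) := by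
        intro i j hij
        rw [Set.disjoint_left]
        intro x hx hx'
        have : (q : ℝ≥0∞) ^ (i + 1) ≤ (q : ℝ≥0∞) ^ j := ENNReal.zpow_le_of_le hq1.le hij
        exact absurd (hx.2.trans_le this) (not_lt.2 hx'.1)
      have : Disjoint (Ico ((q : ℝ≥0∞) ^ i) ((q : ℝ≥0∞) ^ (i + 1)))
          (Ico ((q : ℝ≥0∞) ^ j) ((q : ℝ≥0∞) ^ (j + 1))) := by
        rcases lt_or_gt_of_ne hij with h | h
        · exact hdisj _ _ h
        · exact (hdisj _ _ h).symm
      exact (this.preimage J).mono inter_subset_right inter_subset_right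
    · exact (hd hkl).mono inter_subset_left inter_subset_left
  rw [← hSU]
  refine AreaBounds.iUnion hfm hSm hSd fun p => ?_
  have hSC : ∀ y ∈ S p, y ∈ C := fun y hy => hPC _ hy.1
  refine areaBounds_of_small (hSm p) hfm (fun y hy => hC.norm_eq_one y (hSC y hy))
    (fun y hy => (ht p.1 y hy.1).mono inter_subset_left) (fun y hy => hf y (hSC y hy))
    (fun y hy => hJ y (hSC y hy)) hq (a := (q : ℝ≥0∞) ^ p.2)
    (ENNReal.zpow_pos hq0 ENNReal.coe_ne_top _).ne' fun y hy => ⟨hy.2.1, ?_⟩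
  refine hy.2.2.le.trans_eq ?_
  rw [ENNReal.zpow_add hq0 ENNReal.coe_ne_top, zpow_one, mul_comm]

theorem IsNormalPair.measurable_fiberCount {C : Set (Space (d + 1))}
    {ν : Space (d + 1) → Space (d + 1)} (hC : IsNormalPair C ν)
    {f : Space (d + 1) → Space d} (hfm : Measurable f)
    {L : Space (d + 1) → Space (d + 1) →L[ℝ] Space d}
    (hf : ∀ y ∈ C, HasStrictFDerivAt f (L y) y) {J : Space (d + 1) → ℝ≥0∞} (hJm : Measurable J)
    (hJ : ∀ y ∈ C, J y = ENNReal.ofReal (tangentJacobian (ν y) (L y)))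
    (hJ0 : ∀ y ∈ C, J y ≠ 0) : Measurable (fiberCount f C) :=
  (hC.areaBounds hfm hf hJm hJ hJ0 (q := 2) one_lt_two).1

theorem le_of_forall_sq_mul_le {a b : ℝ≥0∞} (h : ∀ q : NNReal, 1 < q → a ≤ q ^ 2 * b) : a ≤ b := by
  have h1 : Tendsto (fun q : NNReal => ((q ^ 2 : NNReal) : ℝ≥0∞) * b) (𝓝[>] 1) (𝓝 b) := by
    have h2 : Tendsto (fun q : NNReal => ((q ^ 2 : NNReal) : ℝ≥0∞)) (𝓝[>] 1) (𝓝 1) := by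
      have : ContinuousAt (fun q : NNReal => ((q ^ 2 : NNReal) : ℝ≥0∞)) 1 := by fun_prop
      simpa [ContinuousAt] using this.tendsto.mono_left nhdsWithin_le_nhds
    simpa using ENNReal.Tendsto.mul_const h2 (Or.inl one_ne_zero)
  refine ge_of_tendsto h1 ?_
  filter_upwards [self_mem_nhdsWithin] with q hq
  simpa using h q hq

theorem IsNormalPair.lintegral_fiberCount {C : Set (Space (d + 1))}
    {ν : Space (d + 1) → Space (d + 1)} (hC : IsNormalPair C ν)
    {f : Space (d + 1) → Space d} (hfm : Measurable f)
    {L : Space (d + 1) → Space (d + 1) →L[ℝ] Space d}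
    (hf : ∀ y ∈ C, HasStrictFDerivAt f (L y) y) {J : Space (d + 1) → ℝ≥0∞} (hJm : Measurable J)
    (hJ : ∀ y ∈ C, J y = ENNReal.ofReal (tangentJacobian (ν y) (L y)))
    (hJ0 : ∀ y ∈ C, J y ≠ 0) :
    ∫⁻ y in C, J y ∂surfaceMeasure (d + 1) = ∫⁻ z, fiberCount f C z :=
  le_antisymm
    (le_of_forall_sq_mul_le fun _ hq => (hC.areaBounds hfm hf hJm hJ hJ0 hq).2.2)
    (le_of_forall_sq_mul_le fun _ hq => (hC.areaBounds hfm hf hJm hJ hJ0 hq).2.1)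

/-- The area formula, with a weight that depends on the image point only. -/
theorem IsNormalPair.lintegral_comp_mul {C : Set (Space (d + 1))}
    {ν : Space (d + 1) → Space (d + 1)} (hC : IsNormalPair C ν)
    {f : Space (d + 1) → Space d} (hfm : Measurable f)
    {L : Space (d + 1) → Space (d + 1) →L[ℝ] Space d}
    (hf : ∀ y ∈ C, HasStrictFDerivAt f (L y) y) {J : Space (d + 1) → ℝ≥0∞} (hJm : Measurable J)
    (hJ : ∀ y ∈ C, J y = ENNReal.ofReal (tangentJacobian (ν y) (L y)))
    (hJ0 : ∀ y ∈ C, J y ≠ 0) {g : Space d → ℝ≥0∞} (hg : Measurable g) :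
    ∫⁻ y in C, J y * g (f y) ∂surfaceMeasure (d + 1) = ∫⁻ z, fiberCount f C z * g z := by
  have hN := hC.measurable_fiberCount hfm hf hJm hJ hJ0
  -- Weights that depend on the image point are handled by identifying the push-forward measure.
  -- Evaluating it on `E` is the unweighted formula for the part of `C` above `E`.
  have key : (((surfaceMeasure (d + 1)).restrict C).withDensity J).map f =
      volume.withDensity (fiberCount f C) := by
    ext E hE
    rw [Measure.map_apply hfm hE, withDensity_apply _ (hfm hE), withDensity_apply _ hE,
      Measure.restrict_restrict (hfm hE)]
    have hD : IsNormalPair (f ⁻¹' E ∩ C) ν :=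
      hC.mono ((hfm hE).inter hC.measurableSet) inter_subset_right
    rw [hD.lintegral_fiberCount hfm (fun y hy => hf y hy.2) hJm (fun y hy => hJ y hy.2)
      (fun y hy => hJ0 y hy.2), ← lintegral_indicator hE]
    congr 1 with z
    by_cases hz : z ∈ E
    · rw [indicator_of_mem hz, fiberCount, fiberCount]
      congr 1
      ext y
      simp only [mem_inter_iff, mem_preimage, mem_singleton_iff]
      constructor
      · rintro ⟨⟨h1, h2⟩, h3⟩
        exact ⟨h2, h3⟩
      · rintro ⟨h2, rfl⟩
        exact ⟨⟨hz, h2⟩, rfl⟩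
    · rw [indicator_of_notMem hz, fiberCount]
      have : f ⁻¹' E ∩ C ∩ f ⁻¹' {z} = ∅ := by
        ext y
        simp only [mem_inter_iff, mem_preimage, mem_singleton_iff, mem_empty_iff_false, iff_false]
        rintro ⟨⟨h1, h2⟩, rfl⟩
        exact hz h1
      rw [this, measure_empty]
  have h1 := lintegral_map (μ := ((surfaceMeasure (d + 1)).restrict C).withDensity J) hg hfm
  rw [key, lintegral_withDensity_eq_lintegral_mul _ hN hg] at h1
  exact (lintegral_withDensity_eq_lintegral_mul _ hJm (hg.comp hfm)).symm.trans h1.symm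

end

/-! ### Normals of `C¹` hypersurfaces and Borel normal fields. -/

section

variable {n : ℕ}

theorem hasStrictFDerivAt_of_contDiffOn {U : Set (Space n)} {φ : Space n → ℝ} (hU : IsOpen U)
    (hφ : ContDiffOn ℝ 1 φ U) {x : Space n} (hx : x ∈ U) :
    HasStrictFDerivAt φ (innerSL ℝ (gradient φ x)) x := by
  have h1 : ContDiffAt ℝ 1 φ x := hφ.contDiffAt (hU.mem_nhds hx)
  have h2 := h1.hasStrictFDerivAt one_ne_zero
  have h3 : fderiv ℝ φ x = innerSL ℝ (gradient φ x) := by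
    ext v
    simp [gradient]
  rwa [h3] at h2

theorem continuousOn_gradient {U : Set (Space n)} {φ : Space n → ℝ} (hU : IsOpen U)
    (hφ : ContDiffOn ℝ 1 φ U) : ContinuousOn (gradient φ) U :=
  (InnerProductSpace.toDual ℝ (Space n)).symm.continuous.comp_continuousOn
    (hφ.continuousOn_fderiv_of_isOpen hU le_rfl)

theorem IsUnitNormalAt.norm_eq_one {S : Set (Space n)} {x v : Space n}
    (h : IsUnitNormalAt S x v) : ‖v‖ = 1 := by
  obtain ⟨-, U, φ, -, -, -, -, -, hv, -⟩ := h
  exact hv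

/-- The defining function is strictly differentiable and vanishes at both ends of a chord of `S`, so
short chords are nearly orthogonal to the gradient, uniformly in both ends. -/
theorem IsUnitNormalAt.tangentAt {S : Set (Space n)} {x v : Space n}
    (h : IsUnitNormalAt S x v) : TangentAt S v x := by
  obtain ⟨hxS, U, φ, hU, hxU, hφ, hg, hSU, hv, hspan⟩ := h
  obtain ⟨c, rfl⟩ := Submodule.mem_span_singleton.1 hspan
  intro ε hε
  have hc : 0 < |c| + 1 := by positivity
  obtain ⟨V, hV, hVφ⟩ := (hasStrictFDerivAt_of_contDiffOn hU hφ hxU).approximates_deriv_on_nhds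
    (c := ⟨ε / (|c| + 1), (div_pos hε hc).le⟩) (Or.inr (div_pos hε hc))
  refine ⟨U ∩ V, inter_mem (hU.mem_nhds hxU) hV, fun y hy y' hy' => ?_⟩
  have h1 := hVφ y hy.2.2 y' hy'.2.2
  have hy0 : φ y = 0 := (hSU ▸ (⟨hy.1, hy.2.1⟩ : y ∈ S ∩ U) : y ∈ {y ∈ U | φ y = 0}).2
  have hy0' : φ y' = 0 := (hSU ▸ (⟨hy'.1, hy'.2.1⟩ : y' ∈ S ∩ U) : y' ∈ {y ∈ U | φ y = 0}).2
  rw [hy0, hy0', sub_zero, zero_sub, norm_neg, innerSL_apply_apply, Real.norm_eq_abs] at h1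
  rw [real_inner_smul_left, abs_mul]
  change |inner ℝ (gradient φ x) (y - y')| ≤ ε / (|c| + 1) * ‖y - y'‖ at h1
  calc |c| * |inner ℝ (gradient φ x) (y - y')| ≤ |c| * (ε / (|c| + 1) * ‖y - y'‖) := by gcongr
    _ = ε * ‖y - y'‖ * (|c| / (|c| + 1)) := by ring
    _ ≤ ε * ‖y - y'‖ := mul_le_of_le_one_right (by positivity)
        ((div_le_one hc).2 (by linarith))

/-- Lagrange multipliers: the derivative of a function with a local extremum on a hypersurface is a
multiple of the normal. -/
theorem IsUnitNormalAt.exists_eq_smul_of_isLocalExtrOn {S : Set (Space n)} {x v : Space n}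
    (h : IsUnitNormalAt S x v) {ψ : Space n → ℝ} {w : Space n}
    (hψ : HasStrictFDerivAt ψ (innerSL ℝ w) x) (hext : IsLocalExtrOn ψ S x) :
    ∃ c : ℝ, w = c • v := by
  obtain ⟨hxS, U, φ, hU, hxU, hφ, hg, hSU, hv, hspan⟩ := h
  have hφx : φ x = 0 := (hSU ▸ (⟨hxS, hxU⟩ : x ∈ S ∩ U) : x ∈ {y ∈ U | φ y = 0}).2
  have hnhds : 𝓝[{y | φ y = φ x}] x = 𝓝[S] x := by
    rw [hφx]
    refine nhdsWithin_eq_nhdsWithin hxU hU ?_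
    rw [hSU]
    ext y
    simp [and_comm]
  have hext' : IsLocalExtrOn ψ {y | φ y = φ x} x := by
    rw [IsLocalExtrOn, hnhds]
    exact hext
  obtain ⟨a, b, hab, hsum⟩ := hext'.exists_multipliers_of_hasStrictFDerivAt_1d
    (hasStrictFDerivAt_of_contDiffOn hU hφ hxU) hψ
  have hsum' : a • gradient φ x + b • w = 0 := by
    apply ext_inner_right ℝ
    intro u
    have := congrArg (fun L => L u) hsum
    simpa [inner_add_left, real_inner_smul_left] using this
  obtain ⟨c, rfl⟩ := Submodule.mem_span_singleton.1 hspan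
  have hc : c ≠ 0 := by
    rintro rfl
    simp at hv
  have hb : b ≠ 0 := by
    rintro rfl
    rw [zero_smul, add_zero, smul_eq_zero] at hsum'
    exact hab (Prod.ext (hsum'.resolve_right hg) rfl)
  refine ⟨-(a / b) / c, ?_⟩
  rw [smul_smul, div_mul_cancel₀ _ hc]
  have : b • w = -(a • gradient φ x) := (eq_neg_of_add_eq_zero_right hsum')
  calc w = b⁻¹ • (b • w) := by rw [smul_smul, inv_mul_cancel₀ hb, one_smul]
    _ = _ := by rw [this, smul_neg, smul_smul, neg_smul, div_eq_inv_mul]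

/-- A normal is unique up to sign whatever local equation is used: any defining function is constant
on `S`, hence trivially extremal there, and Lagrange multipliers make its gradient parallel to the
given normal. The energy therefore does not see the choice of normal. -/
theorem IsUnitNormalAt.abs_inner_eq {S : Set (Space n)} {x v w : Space n}
    (hv : IsUnitNormalAt S x v) (hw : IsUnitNormalAt S x w) (u : Space n) :
    |inner ℝ v u| = |inner ℝ w u| := by
  obtain ⟨hxS, U, φ, hU, hxU, hφ, hg, hSU, hw1, hspan⟩ := hw
  have hφx : φ x = 0 := (hSU ▸ (⟨hxS, hxU⟩ : x ∈ S ∩ U) : x ∈ {y ∈ U | φ y = 0}).2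
  have hext : IsLocalExtrOn φ S x := by
    left
    filter_upwards [self_mem_nhdsWithin, nhdsWithin_le_nhds (hU.mem_nhds hxU)] with y hy hyU
    have : φ y = 0 := (hSU ▸ (⟨hy, hyU⟩ : y ∈ S ∩ U) : y ∈ {y ∈ U | φ y = 0}).2
    rw [hφx, this]
  obtain ⟨c, hc⟩ := hv.exists_eq_smul_of_isLocalExtrOn
    (hasStrictFDerivAt_of_contDiffOn hU hφ hxU) hext
  obtain ⟨a, rfl⟩ := Submodule.mem_span_singleton.1 hspan
  rw [hc, smul_smul, norm_smul, hv.norm_eq_one, mul_one, Real.norm_eq_abs] at hw1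
  rw [hc, smul_smul, real_inner_smul_left, abs_mul, hw1, one_mul]

theorem exists_nhds_isUnitNormalAt {S : Set (Space n)} (hS : IsC1Hypersurface S) {x : Space n}
    (hx : x ∈ S) : ∃ V ∈ 𝓝 x, ∃ ν : Space n → Space n, Measurable ν ∧
      ∀ y ∈ S ∩ V, IsUnitNormalAt S y (ν y) := by
  obtain ⟨v, hxS, U, φ, hU, hxU, hφ, hg, hSU, hv, hspan⟩ := hS x hx
  have hcont := continuousOn_gradient hU hφ
  have hV : IsOpen (U ∩ gradient φ ⁻¹' {0}ᶜ) := hcont.isOpen_inter_preimage hU isOpen_compl_singleton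
  classical
  refine ⟨_, hV.mem_nhds ⟨hxU, hg⟩, (U ∩ gradient φ ⁻¹' {0}ᶜ).piecewise
    (fun y => ‖gradient φ y‖⁻¹ • gradient φ y) (fun _ => 0), ?_, ?_⟩
  · refine ContinuousOn.measurable_piecewise ?_ continuousOn_const hV.measurableSet
    have h1 := hcont.mono (inter_subset_left (t := gradient φ ⁻¹' {0}ᶜ))
    exact (h1.norm.inv₀ fun y hy => norm_ne_zero_iff.2 hy.2).smul h1
  · intro y hy
    rw [piecewise_eq_of_mem _ _ _ hy.2]
    have hgy : gradient φ y ≠ 0 := hy.2.2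
    refine ⟨hy.1, U, φ, hU, hy.2.1, hφ, hgy, hSU, ?_, ?_⟩
    · rw [norm_smul, norm_inv, norm_norm, inv_mul_cancel₀ (norm_ne_zero_iff.2 hgy)]
    · exact Submodule.smul_mem _ _ (Submodule.mem_span_singleton_self _)

theorem exists_measurable_normal {S M : Set (Space n)} (hS : IsC1Hypersurface S)
    (hM : MeasurableSet M) (hMS : M ⊆ S) :
    ∃ ν : Space n → Space n, Measurable ν ∧ ∀ y ∈ M, IsUnitNormalAt S y (ν y) := by
  obtain ⟨P, hP, hd, hU⟩ := exists_countable_partition hM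
    (p := fun s => ∃ ν : Space n → Space n, Measurable ν ∧ ∀ y ∈ s, IsUnitNormalAt S y (ν y))
    ⟨fun _ => 0, measurable_const, fun y hy => hy.elim⟩ (fun y hy => by
      obtain ⟨V, hV, ν, hν, hn⟩ := exists_nhds_isUnitNormalAt hS (hMS hy)
      exact ⟨V, hV, fun s hs _ => ⟨ν, hν, fun y hy => hn y ⟨hMS (hs hy).1, (hs hy).2⟩⟩⟩)
  choose hPm hPM N hN hNn using hP
  obtain ⟨ν, hν, hνN⟩ := exists_measurable_piecewise P hPm N hN fun i j hij y hy =>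
    ((hd hij).le_bot hy).elim
  refine ⟨ν, hν, fun y hy => ?_⟩
  obtain ⟨i, hi⟩ := mem_iUnion.1 (hU.symm ▸ hy : y ∈ ⋃ i, P i)
  rw [hνN i hi]
  exact hNn i y hi

theorem exists_isNormalPair {S M : Set (Space n)} (hS : IsC1Hypersurface S)
    (hM : MeasurableSet M) (hMS : M ⊆ S) :
    ∃ ν : Space n → Space n, IsNormalPair M ν ∧ ∀ y ∈ M, IsUnitNormalAt S y (ν y) := by
  obtain ⟨ν, hν, hn⟩ := exists_measurable_normal hS hM hMS
  refine ⟨ν, ⟨hM, hν, fun y hy => (hn y hy).norm_eq_one, fun k => if k = 0 then M else ∅,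
    fun k => ?_, fun i j hij => ?_, ?_, fun k y hy => ?_⟩, hn⟩
  · dsimp only
    split_ifs
    exacts [hM, MeasurableSet.empty]
  · rcases eq_or_ne i 0 with rfl | hi
    · simp [Function.onFun, hij.symm]
    · simp [Function.onFun, hi]
  · ext y
    simp only [mem_iUnion]
    constructor
    · rintro ⟨k, hk⟩
      by_cases hk0 : k = 0
      · simpa [hk0] using hk
      · simp [hk0] at hk
    · intro hy
      exact ⟨0, by simpa using hy⟩
  · by_cases hk0 : k = 0
    · simp only [hk0, if_true] at hy ⊢
      exact (hn y hy).tangentAt.mono hMS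
    · simp [hk0] at hy

/-- A unit normal field can be replaced by a Borel one, up to signs and a set of zero area. -/
theorem IsUnitNormalField.exists_isNormalPair {A : Set (Space n)} {ν : Space n → Space n}
    (h : IsUnitNormalField A ν) : ∃ (B : Set (Space n)) (ν' : Space n → Space n), B ⊆ A ∧
      surfaceMeasure n (A \ B) = 0 ∧ IsNormalPair B ν' ∧
      ∀ y ∈ B, ∀ u, |inner ℝ (ν y) u| = |inner ℝ (ν' y) u| := by
  obtain ⟨N, S, M, hM, h0⟩ := h
  have hnu : ∀ i, ∃ ν' : Space n → Space n, Measurable ν' ∧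
      ∀ y ∈ M i, IsUnitNormalAt (S i) y (ν' y) := fun i =>
    exists_measurable_normal (hM i).1 (hM i).2.1 (hM i).2.2.1
  choose nu hnum hnun using hnu
  set Q : ℕ → Set (Space n) := fun k => if hk : k < N then M ⟨k, hk⟩ else ∅ with hQ
  set g : ℕ → Space n → Space n := fun k => if hk : k < N then nu ⟨k, hk⟩ else fun _ => 0 with hg
  have hQm : ∀ k, MeasurableSet (Q k) := fun k => by
    by_cases hk : k < N
    · simp only [hQ, hk, dite_true]
      exact (hM _).2.1
    · simp [hQ, hk]
  have hgm : ∀ k, Measurable (g k) := fun k => by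
    by_cases hk : k < N
    · simp only [hg, hk, dite_true]
      exact hnum _
    · simp [hg, hk]
  have hQU : ⋃ k, Q k = ⋃ i, M i := by
    ext y
    simp only [mem_iUnion]
    constructor
    · rintro ⟨k, hk⟩
      by_cases hkN : k < N
      · exact ⟨⟨k, hkN⟩, by simpa [hQ, hkN] using hk⟩
      · simp [hQ, hkN] at hk
    · rintro ⟨i, hi⟩
      exact ⟨i, by simpa [hQ, i.2] using hi⟩
  have hPm : ∀ k, MeasurableSet (disjointed Q k) := fun k => MeasurableSet.disjointed hQm k
  obtain ⟨ν', hν', hνg⟩ := exists_measurable_piecewise (disjointed Q) hPm g hgm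
    fun i j hij y hy => ((disjoint_disjointed Q hij).le_bot hy).elim
  have key : ∀ k, ∀ y ∈ disjointed Q k, ∃ i, Q k = M i ∧ y ∈ M i ∧
      IsUnitNormalAt (S i) y (ν' y) := by
    intro k y hy
    have hyQ := disjointed_subset Q k hy
    have hkN : k < N := by
      by_contra hkN
      simp [hQ, hkN] at hyQ
    have hQM : Q k = M ⟨k, hkN⟩ := by simp [hQ, hkN]
    refine ⟨⟨k, hkN⟩, hQM, hQM ▸ hyQ, ?_⟩
    rw [hνg k hy]
    simp only [hg, hkN, dite_true]
    exact hnun _ y (hQM ▸ hyQ)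
  have hmem : ∀ y ∈ ⋃ i, M i, ∃ k, y ∈ disjointed Q k := fun y hy => by
    rw [← hQU, ← iUnion_disjointed] at hy
    exact mem_iUnion.1 hy
  refine ⟨⋃ i, M i, ν', iUnion_subset fun i => (hM i).2.2.2.1, h0,
    ⟨MeasurableSet.iUnion fun i => (hM i).2.1, hν', fun y hy => ?_, disjointed Q, hPm,
      disjoint_disjointed Q, by rw [iUnion_disjointed, hQU], fun k y hy => ?_⟩, fun y hy u => ?_⟩
  · obtain ⟨k, hk⟩ := hmem y hy
    obtain ⟨i, -, -, hi⟩ := key k y hk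
    exact hi.norm_eq_one
  · obtain ⟨i, hQi, -, hi⟩ := key k y hy
    exact hi.tangentAt.mono ((disjointed_subset Q k).trans (hQi ▸ (hM i).2.2.1))
  · obtain ⟨k, hk⟩ := hmem y hy
    obtain ⟨i, -, hyi, hi⟩ := key k y hk
    exact ((hM i).2.2.2.2 y hyi).abs_inner_eq hi u

theorem isPiecewiseC1_empty : IsPiecewiseC1 (∅ : Set (Space n)) :=
  ⟨fun _ => 0, 0, Fin.elim0, Fin.elim0, fun i => i.elim0, by simp⟩

/-- The old field is kept on `A`, so the new hypersurface only contributes `M \ A`; measurability of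
`A` is needed for this difference to be an admissible piece. -/
theorem IsPiecewiseC1.union {A S M : Set (Space n)} (hA : IsPiecewiseC1 A) (hAm : MeasurableSet A)
    (hS : IsC1Hypersurface S) (hM : MeasurableSet M) (hMS : M ⊆ S) : IsPiecewiseC1 (A ∪ M) := by
  classical
  obtain ⟨ν, N, T, P, hP, h0⟩ := hA
  obtain ⟨ν', -, hν'⟩ := exists_measurable_normal hS hM hMS
  refine ⟨A.piecewise ν ν', N + 1, Fin.cons S T, Fin.cons (M \ A) P, fun i => ?_, ?_⟩
  · refine Fin.cases ?_ (fun i => ?_) i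
    · refine ⟨hS, hM.diff hAm, sdiff_subset.trans hMS, sdiff_subset.trans subset_union_right,
        fun x hx => ?_⟩
      rw [piecewise_eq_of_notMem _ _ _ hx.2]
      exact hν' x hx.1
    · simp only [Fin.cons_succ]
      refine ⟨(hP i).1, (hP i).2.1, (hP i).2.2.1, (hP i).2.2.2.1.trans subset_union_left,
        fun x hx => ?_⟩
      rw [piecewise_eq_of_mem _ _ _ ((hP i).2.2.2.1 hx)]
      exact (hP i).2.2.2.2 x hx
  · refine measure_mono_null ?_ h0
    rintro x ⟨hx, hx'⟩
    simp only [mem_iUnion, not_exists] at hx'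
    have hxM : ¬(x ∈ M ∧ x ∉ A) := hx' 0
    have hxA : x ∈ A := by
      rcases hx with h | h
      · exact h
      · by_contra hxA
        exact hxM ⟨h, hxA⟩
    refine ⟨hxA, ?_⟩
    simp only [mem_iUnion, not_exists]
    exact fun i => hx' i.succ

theorem IsPiecewiseC1.union_iUnion {m : ℕ} {S : Fin m → Set (Space n)}
    (hS : ∀ i, IsC1Hypersurface (S i)) (hm : ∀ i, MeasurableSet (S i)) :
    IsPiecewiseC1 (⋃ i, S i) := by
  induction m with
  | zero => simpa using isPiecewiseC1_empty
  | succ m ih =>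
    have h : ⋃ i, S i = (⋃ i : Fin m, S i.succ) ∪ S 0 := by
      ext x
      simp [Fin.exists_fin_succ, or_comm]
    rw [h]
    exact (ih (fun i => hS i.succ) fun i => hm i.succ).union
      (MeasurableSet.iUnion fun i => hm i.succ) (hS 0) (hm 0) subset_rfl

end

/-! ### The invariant density of directions and the Crofton constant. -/

section

variable {d : ℕ}

theorem measurePreserving_consL :
    MeasurePreserving (consL d) ((volume : Measure ℝ).prod volume) volume := by
  let e : WithLp 2 (ℝ × Space d) ≃ₗᵢ[ℝ] Space (d + 1) :=
    { (WithLp.linearEquiv 2 ℝ (ℝ × Space d)).trans (consL d).toLinearEquiv with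
      norm_map' := fun x => by
        have h1 := norm_sq_eq_head_tail (consL d (WithLp.ofLp x))
        have h2 := WithLp.prod_norm_sq_eq_of_L2 x
        refine (pow_left_inj₀ (norm_nonneg _) (norm_nonneg _) two_ne_zero).1 (h1.trans ?_)
        rw [h2, head_consL, tail_consL, Real.norm_eq_abs, sq_abs]
        rfl }
  exact e.measurePreserving.comp (WithLp.volume_preserving_toLp ℝ (Space d))

theorem lintegral_eq_pow_mul_lintegral_smul {E : Type*} [NormedAddCommGroup E] [NormedSpace ℝ E]
    [FiniteDimensional ℝ E] [MeasurableSpace E] [BorelSpace E] (μ : Measure E)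
    [μ.IsAddHaarMeasure] {r : ℝ} (hr : r ≠ 0) (g : E → ℝ≥0∞) :
    ∫⁻ z, g z ∂μ = ‖r‖ₑ ^ Module.finrank ℝ E * ∫⁻ z, g (r • z) ∂μ := by
  have h1 := lintegral_map_equiv (μ := μ) g (Homeomorph.smulOfNeZero r hr).toMeasurableEquiv
  have h2 : Measure.map (Homeomorph.smulOfNeZero r hr).toMeasurableEquiv μ =
      ENNReal.ofReal |(r ^ Module.finrank ℝ E)⁻¹| • μ := Measure.map_addHaar_smul μ hr
  rw [h2, lintegral_smul_measure] at h1
  have h3 : ∫⁻ z, g ((Homeomorph.smulOfNeZero r hr).toMeasurableEquiv z) ∂μ =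
    ∫⁻ z, g (r • z) ∂μ := rfl
  rw [← h3, ← h1, smul_eq_mul, ← mul_assoc, abs_inv, abs_pow, ENNReal.ofReal_inv_of_pos
    (by positivity), ENNReal.ofReal_pow (abs_nonneg _), ← Real.enorm_eq_ofReal_abs,
    ENNReal.mul_inv_cancel, one_mul]
  · exact pow_ne_zero _ (enorm_ne_zero.2 hr)
  · exact ENNReal.pow_ne_top enorm_ne_top

theorem continuous_dir : Continuous (dir : Space d → Space (d + 1)) :=
  (consL d).continuous.comp (by fun_prop)

@[fun_prop]
theorem measurable_dir : Measurable (dir : Space d → Space (d + 1)) := continuous_dir.measurable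

theorem dir_ne_zero (b : Space d) : dir b ≠ 0 := fun h => by
  have := congrArg head h
  simp at this

/-- The density, in the chart `b ↦ dir b`, of the invariant measure on lines. -/
def lineWeight (b : Space d) : ℝ≥0∞ := (‖dir b‖ₑ ^ (d + 2))⁻¹

@[fun_prop]
theorem measurable_lineWeight : Measurable (lineWeight : Space d → ℝ≥0∞) := by
  unfold lineWeight
  fun_prop

/-- The mean width of a hypersurface element with normal `ν`. -/
def directionIntegral (ν : Space (d + 1)) : ℝ≥0∞ :=
  ∫⁻ b : Space d, lineWeight b * ‖(inner ℝ ν (dir b) : ℝ)‖ₑ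

/-- Polar-type coordinates `w = s • dir b` have volume element `|s|^d ds db`. Rescaling `s` by `‖dir
b‖` separates the radial integral from the angular one and produces the power `d + 2` in
`lineWeight`. -/
theorem lintegral_ball_inner (ν : Space (d + 1)) :
    ∫⁻ w in Metric.ball (0 : Space (d + 1)) 1, ‖(inner ℝ ν w : ℝ)‖ₑ =
      (∫⁻ r in Metric.ball (0 : ℝ) 1, ‖r‖ₑ ^ (d + 1)) * directionIntegral ν := by
  have hm : Measurable ((Metric.ball (0 : Space (d + 1)) 1).indicator
      fun w => ‖(inner ℝ ν w : ℝ)‖ₑ) := Measurable.indicator (by fun_prop) measurableSet_ball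
  have hm' : Measurable ((Metric.ball (0 : ℝ) 1).indicator
      fun r => ‖r‖ₑ ^ (d + 1)) := Measurable.indicator (by fun_prop) measurableSet_ball
  rw [← lintegral_indicator measurableSet_ball, ← lintegral_indicator measurableSet_ball,
    ← measurePreserving_consL.lintegral_comp hm, lintegral_prod _ (by fun_prop)]
  have h1 : ∀ s : ℝ, s ≠ 0 → ∫⁻ z : Space d, (Metric.ball (0 : Space (d + 1)) 1).indicator
      (fun w => ‖(inner ℝ ν w : ℝ)‖ₑ) (consL d (s, z)) =
      ∫⁻ b : Space d, ‖s‖ₑ ^ d * (Metric.ball (0 : Space (d + 1)) 1).indicator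
      (fun w => ‖(inner ℝ ν w : ℝ)‖ₑ) (s • dir b) := by
    intro s hs
    rw [lintegral_eq_pow_mul_lintegral_smul volume hs, lintegral_const_mul]
    · rw [finrank_euclideanSpace_fin]
      congr 3 with b
      congr 1
      apply ext_head_tail <;> simp
    · exact hm.comp (by fun_prop)
  rw [lintegral_congr_ae (g := fun s : ℝ => ∫⁻ b : Space d, ‖s‖ₑ ^ d *
      (Metric.ball (0 : Space (d + 1)) 1).indicator
      (fun w => ‖(inner ℝ ν w : ℝ)‖ₑ) (s • dir b)), lintegral_lintegral_swap]
  · rw [directionIntegral, ← lintegral_const_mul]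
    · congr 1 with b
      have hd0 : ‖dir b‖ ≠ 0 := norm_ne_zero_iff.2 (dir_ne_zero b)
      have he0 : ‖dir b‖ₑ ≠ 0 := enorm_ne_zero.2 (dir_ne_zero b)
      rw [lintegral_eq_pow_mul_lintegral_smul volume (inv_ne_zero hd0)]
      have h2 : ∀ r : ℝ, ‖‖dir b‖⁻¹ • r‖ₑ ^ d * (Metric.ball (0 : Space (d + 1)) 1).indicator
          (fun w => ‖(inner ℝ ν w : ℝ)‖ₑ) ((‖dir b‖⁻¹ • r) • dir b) =
          (‖dir b‖ₑ⁻¹ ^ (d + 1) * ‖(inner ℝ ν (dir b) : ℝ)‖ₑ) *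
          (Metric.ball (0 : ℝ) 1).indicator (fun r => ‖r‖ₑ ^ (d + 1)) r := by
        intro r
        have hmem : (‖dir b‖⁻¹ • r) • dir b ∈ Metric.ball (0 : Space (d + 1)) 1 ↔
            r ∈ Metric.ball (0 : ℝ) 1 := by
          rw [mem_ball_zero_iff, mem_ball_zero_iff, norm_smul, norm_smul, norm_inv, norm_norm,
            mul_comm ‖dir b‖⁻¹, mul_assoc, inv_mul_cancel₀ hd0, mul_one]
        by_cases hr : r ∈ Metric.ball (0 : ℝ) 1
        · rw [indicator_of_mem (hmem.2 hr), indicator_of_mem hr, real_inner_smul_right, enorm_mul,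
            smul_eq_mul, enorm_mul, enorm_inv hd0, enorm_norm]
          ring
        · rw [indicator_of_notMem (fun h => hr (hmem.1 h)), indicator_of_notMem hr, mul_zero,
            mul_zero]
      simp_rw [h2]
      rw [lintegral_const_mul _ hm', enorm_inv hd0, enorm_norm, Module.finrank_self, pow_one,
        lineWeight, ENNReal.inv_pow]
      ring
    · fun_prop
  · refine Measurable.aemeasurable ?_
    refine Measurable.mul (by fun_prop) (hm.comp ?_)
    fun_prop
  · have : ∀ᵐ s : ℝ, s ≠ 0 := by simp [ae_iff]
    filter_upwards [this] with s hs using h1 s hs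

theorem radialIntegral_ne_zero :
    ∫⁻ r in Metric.ball (0 : ℝ) 1, ‖r‖ₑ ^ (d + 1) ≠ 0 := by
  intro h
  rw [lintegral_eq_zero_iff (by fun_prop)] at h
  have h2 : ∀ᵐ r : ℝ ∂volume.restrict (Metric.ball (0 : ℝ) 1), r = 0 := by
    filter_upwards [h] with r hr
    simpa using hr
  rw [ae_iff, Measure.restrict_apply' measurableSet_ball] at h2
  have h3 : volume ({r : ℝ | ¬r = 0} ∩ Metric.ball 0 1) = volume (Metric.ball (0 : ℝ) 1) := by
    rw [inter_comm]
    exact measure_inter_conull (by simp)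
  rw [h3] at h2
  exact (Metric.measure_ball_pos volume (0 : ℝ) one_pos).ne' h2

theorem radialIntegral_ne_top :
    ∫⁻ r in Metric.ball (0 : ℝ) 1, ‖r‖ₑ ^ (d + 1) ≠ ∞ := by
  refine ne_top_of_le_ne_top (b := ∫⁻ r in Metric.ball (0 : ℝ) 1, 1) (by simp)
    (setLIntegral_mono' measurableSet_ball fun r hr => ?_)
  refine pow_le_one₀ (by positivity) ?_
  rw [mem_ball_zero_iff] at hr
  rw [← ofReal_norm]
  exact ENNReal.ofReal_le_one.2 hr.le

/-- The constant of the Crofton formula. -/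
def croftonConst (d : ℕ) : ℝ≥0∞ := directionIntegral (consL d (1, 0))

theorem norm_consL_one_zero : ‖consL d (1, 0)‖ = 1 := by
  have h := norm_sq_eq_head_tail (consL d (1, 0))
  simp only [head_consL, tail_consL, norm_zero, ne_eq, OfNat.ofNat_ne_zero,
    not_false_eq_true, zero_pow, add_zero] at h
  exact (pow_left_inj₀ (norm_nonneg _) zero_le_one two_ne_zero).1 h

/-- The chart `b ↦ dir b` hides the rotational symmetry, but the integral over the unit ball
displays it; the radial factor cancels because it is neither zero nor infinite. -/
theorem directionIntegral_eq {ν : Space (d + 1)} (hν : ‖ν‖ = 1) :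
    directionIntegral ν = croftonConst d := by
  set R : Space (d + 1) ≃ₗᵢ[ℝ] Space (d + 1) :=
    (Submodule.reflection (Submodule.span ℝ {ν - consL d (1, 0)})ᗮ)
  have hRν : R ν = consL d (1, 0) :=
    Submodule.reflection_sub (hν.trans norm_consL_one_zero.symm)
  have h1 : ∫⁻ w in Metric.ball (0 : Space (d + 1)) 1, ‖(inner ℝ ν w : ℝ)‖ₑ =
      ∫⁻ w in Metric.ball (0 : Space (d + 1)) 1, ‖(inner ℝ (consL d (1, 0)) w : ℝ)‖ₑ := by
    rw [← lintegral_indicator measurableSet_ball, ← lintegral_indicator measurableSet_ball,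
      ← R.measurePreserving.lintegral_comp (Measurable.indicator (by fun_prop) measurableSet_ball)]
    congr 1 with w
    by_cases hw : w ∈ Metric.ball (0 : Space (d + 1)) 1
    · have hRR : R (R w) = w := Submodule.reflection_reflection _ w
      rw [indicator_of_mem hw, indicator_of_mem (by simpa using hw), ← hRν, ← R.inner_map_map,
        hRR]
    · rw [indicator_of_notMem hw, indicator_of_notMem (by simpa using hw)]
  rw [lintegral_ball_inner, lintegral_ball_inner] at h1
  exact (ENNReal.mul_right_inj radialIntegral_ne_zero radialIntegral_ne_top).1 h1

theorem croftonConst_ne_top : croftonConst d ≠ ∞ := by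
  intro h
  have h1 := lintegral_ball_inner (consL d (1, 0))
  rw [← croftonConst, h, ENNReal.mul_top radialIntegral_ne_zero] at h1
  refine absurd h1 (ne_top_of_le_ne_top
    (b := ∫⁻ r in Metric.ball (0 : Space (d + 1)) 1, 1) (by simp [measure_ball_lt_top.ne])
    (setLIntegral_mono' measurableSet_ball fun r hr => ?_))
  rw [mem_ball_zero_iff] at hr
  rw [← ofReal_norm]
  refine ENNReal.ofReal_le_one.2 ((norm_inner_le_norm _ _).trans ?_)
  rw [norm_consL_one_zero, one_mul]
  exact hr.le

end

/-! ### Crofton's formula; parallel and central projections. -/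

section

variable {d : ℕ}

/-- The number of points where `B`, with normal field `ν`, is crossed transversally by the line with
direction `dir b` through the points that `proj b` maps to `a`. -/
def lineCount (B : Set (Space (d + 1))) (ν : Space (d + 1) → Space (d + 1)) (b a : Space d) :
    ℝ≥0∞ :=
  fiberCount (proj b) (B ∩ {y | inner ℝ (ν y) (dir b) ≠ 0}) a

theorem sub_eq_smul_dir {b : Space d} {y y' : Space (d + 1)} (h : proj b y = proj b y') :
    y - y' = head (y - y') • dir b := by
  have h1 : proj b (y - y') = 0 := by rw [map_sub, h, sub_self]
  rw [proj_apply, sub_eq_zero] at h1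
  apply ext_head_tail
  · simp
  · rw [h1, map_smul, tail_dir]

theorem continuous_proj_uncurried :
    Continuous fun p : Space (d + 1) × Space d => proj p.2 p.1 := by
  simp only [proj_apply]
  fun_prop

@[fun_prop]
theorem measurable_proj_uncurried :
    Measurable fun p : Space (d + 1) × Space d => proj p.2 p.1 :=
  continuous_proj_uncurried.measurable

/-- Two points of `P` on one line with direction near `dir b₀` span a chord parallel to that
direction. This chord makes a definite angle with the tangent plane, which tangency excludes for
nearby distinct points. -/
theorem TangentAt.exists_nhds_injOn {P : Set (Space (d + 1))} {ν y₀ : Space (d + 1)}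
    (hP : TangentAt P ν y₀) {b₀ : Space d} (hb : inner ℝ ν (dir b₀) ≠ 0) :
    ∃ U ∈ 𝓝 (y₀, b₀), InjOn (fun p : Space (d + 1) × Space d => (p.2, proj p.2 p.1))
      ((P ×ˢ univ) ∩ U) := by
  set c := |inner ℝ ν (dir b₀)| with hc
  have hc0 : 0 < c := abs_pos.2 hb
  set R := ‖dir b₀‖ + 1 with hR
  have hR0 : 0 < R := by positivity
  obtain ⟨U, hU, hUP⟩ := hP (c / (4 * R)) (by positivity)
  have hV1 : ∀ᶠ b in 𝓝 b₀, c / 2 < |inner ℝ ν (dir b)| := by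
    have : ContinuousAt (fun b => |inner ℝ ν (dir b)|) b₀ :=
      ((continuous_const.inner continuous_dir).abs).continuousAt
    exact this.eventually (lt_mem_nhds (half_lt_self hc0))
  have hV2 : ∀ᶠ b in 𝓝 b₀, ‖dir b‖ < R :=
    (continuous_dir.norm.continuousAt).eventually (gt_mem_nhds (by rw [hR]; linarith))
  refine ⟨U ×ˢ {b | c / 2 < |inner ℝ ν (dir b)| ∧ ‖dir b‖ < R},
    prod_mem_nhds hU (hV1.and hV2), ?_⟩
  rintro ⟨y, b⟩ ⟨⟨hyP, -⟩, hyU, hb1, hb2⟩ ⟨y', b'⟩ ⟨⟨hyP', -⟩, hyU', -⟩ heq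
  obtain ⟨rfl, hpr⟩ := Prod.mk.inj heq
  have h1 := sub_eq_smul_dir hpr
  have h2 := hUP y ⟨hyP, hyU⟩ y' ⟨hyP', hyU'⟩
  set s := head (y - y') with hs
  rw [h1, real_inner_smul_right, abs_mul, norm_smul, Real.norm_eq_abs] at h2
  have h3 : |s| * (c / 2) ≤ |s| * (c / 4) := by
    calc |s| * (c / 2) ≤ |s| * |inner ℝ ν (dir b)| := by gcongr
      _ ≤ c / (4 * R) * (|s| * ‖dir b‖) := h2
      _ ≤ c / (4 * R) * (|s| * R) := by gcongr
      _ = |s| * (c / 4) := by field_simp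
  have h4 : |s| = 0 := by nlinarith [abs_nonneg s]
  rw [abs_eq_zero.1 h4, zero_smul, sub_eq_zero] at h1
  exact Prod.ext h1 rfl

theorem lineCount_eq_fiberCount (B : Set (Space (d + 1))) (ν : Space (d + 1) → Space (d + 1))
    (b a : Space d) :
    lineCount B ν b a = fiberCount (fun p : Space (d + 1) × Space d => (p.2, proj p.2 p.1))
      {p | p.1 ∈ B ∧ inner ℝ (ν p.1) (dir p.2) ≠ 0} (b, a) := by
  rw [lineCount, fiberCount, fiberCount, ← Measure.count_injective_image (f := fun y => (y, b))
    (fun y y' h => (Prod.mk.inj h).1)]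
  congr 1
  ext ⟨y, b'⟩
  simp only [mem_image, mem_inter_iff, mem_preimage, mem_singleton_iff, mem_ofPred_eq,
    Prod.mk.injEq]
  constructor
  · rintro ⟨y, ⟨⟨h1, h2⟩, h3⟩, rfl, rfl⟩
    exact ⟨⟨h1, h2⟩, rfl, h3⟩
  · rintro ⟨⟨h1, h2⟩, rfl, h3⟩
    exact ⟨y, ⟨⟨h1, h2⟩, h3⟩, rfl, rfl⟩

/-- Tonelli needs measurability jointly in direction and offset. So crossings are counted as fibres
of the single map `(y, b) ↦ (b, proj b y)`, which is locally injective at transversal pairs. -/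
theorem IsNormalPair.measurable_lineCount {B : Set (Space (d + 1))}
    {ν : Space (d + 1) → Space (d + 1)} (hB : IsNormalPair B ν) :
    Measurable fun p : Space d × Space d => lineCount B ν p.1 p.2 := by
  obtain ⟨P, hm, hd, hU, ht⟩ := hB.exists_partition
  set T : ℕ → Set (Space (d + 1) × Space d) := fun k =>
    {p | p.1 ∈ P k ∧ inner ℝ (ν p.1) (dir p.2) ≠ 0} with hT
  have hν := hB.measurable
  have hinner : Measurable fun p : Space (d + 1) × Space d => (inner ℝ (ν p.1) (dir p.2) : ℝ) := by
    fun_prop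
  have hTm : ∀ k, MeasurableSet (T k) := fun k =>
    ((hm k).preimage measurable_fst).inter (hinner (measurableSet_singleton 0).compl)
  have hΨ : Measurable fun p : Space (d + 1) × Space d => (p.2, proj p.2 p.1) := by fun_prop
  have h1 : (fun p : Space d × Space d => lineCount B ν p.1 p.2) =
      fun p => ∑' k, fiberCount (fun p : Space (d + 1) × Space d => (p.2, proj p.2 p.1)) (T k) p := by
    ext ⟨b, a⟩
    rw [lineCount_eq_fiberCount, ← fiberCount_iUnion hΨ hTm]
    · congr 1
      ext ⟨y, b⟩
      simp [hT, ← hU]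
    · intro i j hij
      rw [Function.onFun, Set.disjoint_left]
      rintro p ⟨hp, -⟩ ⟨hp', -⟩
      exact (hd hij).le_bot ⟨hp, hp'⟩
  rw [h1]
  refine Measurable.tsum fun k => QuadraticCrofton.measurable_fiberCount hΨ (hTm k) ?_
  rintro ⟨y, b⟩ ⟨hy, hb⟩
  obtain ⟨U, hU, hi⟩ := (ht k y hy).exists_nhds_injOn hb
  exact ⟨U, hU, hi.mono (inter_subset_inter_left _ (t := P k ×ˢ univ) fun p hp => ⟨hp.1, mem_univ _⟩)⟩

theorem setLIntegral_inter_eq {X : Type*} [MeasurableSpace X] {μ : Measure X} {B E : Set X}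
    {F : X → ℝ≥0∞} (hE : MeasurableSet E) (hF : ∀ y ∉ E, F y = 0) :
    ∫⁻ y in B ∩ E, F y ∂μ = ∫⁻ y in B, F y ∂μ := by
  have : F = E.indicator F := by
    ext y
    by_cases hy : y ∈ E
    · rw [indicator_of_mem hy]
    · rw [indicator_of_notMem hy, hF y hy]
  conv_rhs => rw [this]
  rw [setLIntegral_indicator hE, inter_comm]

/-- The area formula for the projection in the direction `dir b`. -/
theorem IsNormalPair.lintegral_proj {B : Set (Space (d + 1))}
    {ν : Space (d + 1) → Space (d + 1)} (hB : IsNormalPair B ν) (b : Space d)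
    {g : Space d → ℝ≥0∞} (hg : Measurable g) :
    ∫⁻ y in B, ‖(inner ℝ (ν y) (dir b) : ℝ)‖ₑ * g (proj b y) ∂surfaceMeasure (d + 1) =
      ∫⁻ a, lineCount B ν b a * g a := by
  have hν := hB.measurable
  have hE : MeasurableSet {y | inner ℝ (ν y) (dir b) ≠ (0 : ℝ)} :=
    (show Measurable fun y => (inner ℝ (ν y) (dir b) : ℝ) by fun_prop)
      (measurableSet_singleton 0).compl
  rw [← setLIntegral_inter_eq hE]
  · refine (hB.mono (hB.measurableSet.inter hE) inter_subset_left).lintegral_comp_mul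
      (proj b).continuous.measurable (L := fun _ => proj b)
      (fun y _ => (proj b).hasStrictFDerivAt) (by fun_prop) (fun y hy => ?_) (fun y hy => ?_) hg
    · rw [tangentJacobian_proj, Real.enorm_eq_ofReal_abs]
    · exact enorm_ne_zero.2 hy.2
  · intro y hy
    have : (inner ℝ (ν y) (dir b) : ℝ) = 0 := by simpa using hy
    rw [this, enorm_zero, zero_mul]

/-- The integral over the lines, with respect to the invariant measure. -/
def lineIntegral (F : Space d → Space d → ℝ≥0∞) : ℝ≥0∞ :=
  ∫⁻ b, lineWeight b * ∫⁻ a, F b a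

/-- Crofton's formula. -/
theorem IsNormalPair.crofton {B : Set (Space (d + 1))}
    {ν : Space (d + 1) → Space (d + 1)} (hB : IsNormalPair B ν)
    (hfin : surfaceMeasure (d + 1) B ≠ ∞) :
    lineIntegral (lineCount B ν) = croftonConst d * surfaceMeasure (d + 1) B := by
  have hν := hB.measurable
  -- Tonelli is not available for Hausdorff measure on the whole space, which is not σ-finite;
  -- finite area makes it available on `B`.
  have : IsFiniteMeasure ((surfaceMeasure (d + 1)).restrict B) :=
    ⟨by rw [Measure.restrict_apply_univ]; exact hfin.lt_top⟩
  have h1 : ∀ b, lineWeight b * ∫⁻ a, lineCount B ν b a =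
      ∫⁻ y in B, lineWeight b * ‖(inner ℝ (ν y) (dir b) : ℝ)‖ₑ ∂surfaceMeasure (d + 1) := by
    intro b
    have := hB.lintegral_proj b (g := fun _ => 1) measurable_const
    simp only [mul_one] at this
    rw [← this, lintegral_const_mul _ (by fun_prop)]
  rw [lineIntegral]
  simp_rw [h1]
  rw [lintegral_lintegral_swap (Measurable.aemeasurable (by unfold Function.uncurry; fun_prop)),
    ← setLIntegral_const]
  exact setLIntegral_congr_fun hB.measurableSet
    fun y hy => directionIntegral_eq (hB.norm_eq_one y hy)

/-- The central projection from `o`, in the chart `b ↦ dir b` of directions. -/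
def centralProj (o y : Space (d + 1)) : Space d := (head (y - o))⁻¹ • tail (y - o)

@[fun_prop]
theorem measurable_centralProj :
    Measurable fun p : Space (d + 1) × Space (d + 1) => centralProj p.1 p.2 := by
  unfold centralProj
  fun_prop

theorem sub_eq_smul_dir_centralProj {o y : Space (d + 1)} (h : head (y - o) ≠ 0) :
    y - o = head (y - o) • dir (centralProj o y) := by
  apply ext_head_tail
  · simp
  · rw [map_smul, tail_dir, centralProj, smul_smul, mul_inv_cancel₀ h, one_smul]

theorem centralProj_eq_iff {o y : Space (d + 1)} (h : head (y - o) ≠ 0) (b : Space d) :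
    centralProj o y = b ↔ proj b y = proj b o := by
  constructor
  · rintro rfl
    rw [← sub_eq_zero, ← map_sub, proj_apply, centralProj, smul_smul, mul_inv_cancel₀ h, one_smul,
      sub_self]
  · intro hb
    rw [centralProj, sub_eq_smul_dir hb]
    simp only [map_smul, head_dir, tail_dir, smul_eq_mul, mul_one]
    rw [smul_smul, inv_mul_cancel₀ h, one_smul]

/-- To first order, central projection is parallel projection along the ray from `o`, scaled by the
inverse of the distance measured in the first coordinate. Its tangential Jacobian is thus known from
the parallel case. -/
theorem hasStrictFDerivAt_centralProj {o y : Space (d + 1)} (h : head (y - o) ≠ 0) :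
    HasStrictFDerivAt (centralProj o) ((head (y - o))⁻¹ • proj (centralProj o y)) y := by
  have h1 : HasStrictFDerivAt (fun y : Space (d + 1) => head (y - o)) head y :=
    head.hasStrictFDerivAt.comp y ((hasStrictFDerivAt_id y).sub_const o)
  have h2 : HasStrictFDerivAt (fun y : Space (d + 1) => tail (y - o)) tail y :=
    tail.hasStrictFDerivAt.comp y ((hasStrictFDerivAt_id y).sub_const o)
  have h3 := ((hasStrictDerivAt_inv h).comp_hasStrictFDerivAt y h1).smul h2
  refine h3.congr_fderiv ?_
  ext1 v
  change (head (y - o))⁻¹ • tail v + (-(head (y - o) ^ 2)⁻¹ * head v) • tail (y - o) =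
    (head (y - o))⁻¹ • (tail v - head v • (head (y - o))⁻¹ • tail (y - o))
  module

end

/-! ### The quadratic Crofton formula. -/

section

variable {d : ℕ}

/-- At almost every point of a horizontal slice of a hypersurface the normal is vertical. -/
theorem IsNormalPair.ae_tail_eq_zero {B : Set (Space (d + 1))}
    {ν : Space (d + 1) → Space (d + 1)} (hB : IsNormalPair B ν) (c : ℝ) :
    ∀ᵐ y ∂(surfaceMeasure (d + 1)).restrict B, head y = c → tail (ν y) = 0 := by
  obtain ⟨P, hm, hd, hU, ht⟩ := hB.exists_partition
  have hPB : ∀ k, P k ⊆ B := fun k => by rw [← hU]; exact subset_iUnion P k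
  rw [ae_restrict_iff' hB.measurableSet]
  have key : ∀ (i : Fin d) (k : ℕ),
      surfaceMeasure (d + 1) {y | y ∈ P k ∧ head y = c ∧ ν y i.succ ≠ 0} = 0 := by
    intro i k
    -- `L` is `tail` with the `i`-th entry replaced by the first coordinate. It sends the slice into
    -- the null hyperplane `z i = c`, yet is nondegenerate on the tangent space when `ν y i.succ ≠
    -- 0`, so that part of the slice has no area.
    set L : Space (d + 1) →L[ℝ] Space d :=
      tail + (head - EuclideanSpace.proj i.succ).smulRight (EuclideanSpace.single i (1 : ℝ)) with hL
    have hLi : ∀ v, L v i = head v := fun v => by simp [hL]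
    have hLj : ∀ v j, j ≠ i → L v j = v j.succ := fun v j hj => by simp [hL, hj]
    refine measure_null_of_locally_null _ ?_
    rintro y ⟨hyP, hyc, hyν⟩
    have hJ : tangentJacobian (ν y) L ≠ 0 := by
      intro h0
      obtain ⟨v, hv, hv0⟩ := Submodule.exists_mem_ne_zero_of_ne_bot
        (LinearMap.bot_lt_ker_of_det_eq_zero (abs_eq_zero.1 h0)).ne'
      have hv' : consL d (inner ℝ (ν y) v, L v) = 0 := hv
      have h1 : (inner ℝ (ν y) v : ℝ) = 0 := by simpa using congrArg head hv'
      have h2 : L v = 0 := by simpa using congrArg tail hv'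
      have h3 : v 0 = 0 := by
        have := hLi v
        rw [h2] at this
        simpa [head_apply] using this.symm
      have h4 : ∀ j, j ≠ i → v j.succ = 0 := fun j hj => by
        rw [← hLj v j hj, h2]; rfl
      have h5 : v i.succ ≠ 0 := by
        intro h5
        apply hv0
        ext j
        refine Fin.cases h3 (fun j => ?_) j
        by_cases hj : j = i
        · rw [hj]; exact h5
        · exact h4 j hj
      rw [PiLp.inner_apply, Fin.sum_univ_succ, h3, inner_zero_right, zero_add,
        Finset.sum_eq_single i (fun j _ hj => by rw [h4 j hj, inner_zero_right]) (by simp)] at h1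
      simp only [RCLike.inner_apply, conj_trivial, mul_eq_zero] at h1
      exact h1.elim h5 hyν
    obtain ⟨U, hU, -, hUC⟩ := (ht k y hyP).exists_nhds_measure_image
      (hB.norm_eq_one y (hPB k hyP)) L.hasStrictFDerivAt hJ (q := 2) one_lt_two
    refine ⟨{y | y ∈ P k ∧ head y = c ∧ ν y i.succ ≠ 0} ∩ U, inter_mem_nhdsWithin _ hU, ?_⟩
    have h1 := (hUC ({y | y ∈ P k ∧ head y = c ∧ ν y i.succ ≠ 0} ∩ U)
      fun x hx => ⟨hx.1.1, hx.2⟩).1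
    have h2 : volume (L '' ({y | y ∈ P k ∧ head y = c ∧ ν y i.succ ≠ 0} ∩ U)) = 0 := by
      have h3 : volume {z : Space d | z i = c} = 0 := by
        have hm : MeasurableSet {z : Fin d → ℝ | z i = c} :=
          measurableSet_eq_fun (measurable_pi_apply i) measurable_const
        have h4 := (PiLp.volume_preserving_ofLp (Fin d)).measure_preimage hm.nullMeasurableSet
        exact h4.trans (by rw [volume_pi]; exact Measure.pi_hyperplane (fun _ => (volume : Measure ℝ)) i c)
      refine measure_mono_null ?_ h3
      rintro _ ⟨x, ⟨hx, -⟩, rfl⟩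
      exact (hLi x).trans hx.2.1
    rw [h2, mul_zero, nonpos_iff_eq_zero, mul_eq_zero] at h1
    refine h1.resolve_left ?_
    rw [ENNReal.ofReal_eq_zero, not_le]
    exact lt_of_le_of_ne (abs_nonneg _) hJ.symm
  refine measure_mono_null ?_ (measure_iUnion_null fun i => measure_iUnion_null fun k => key i k)
  intro y hy
  have hy' : y ∈ B ∧ head y = c ∧ tail (ν y) ≠ 0 := by
    simpa only [mem_compl_iff, mem_ofPred_eq, Classical.not_imp] using hy
  obtain ⟨hyB, hyc, hy0⟩ := hy'
  obtain ⟨k, hk⟩ := mem_iUnion.1 (hU.symm ▸ hyB : y ∈ ⋃ k, P k)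
  have : ∃ i, ν y (Fin.succ i) ≠ 0 := by
    by_contra! h
    exact hy0 (by ext i; exact h i)
  obtain ⟨i, hi⟩ := this
  exact mem_iUnion.2 ⟨i, mem_iUnion.2 ⟨k, hk, hyc, hi⟩⟩

/-- The integrand of the energy of a set with normal field `ν`. -/
def energyKernel (ν : Space (d + 1) → Space (d + 1)) (o y : Space (d + 1)) : ℝ≥0∞ :=
  ENNReal.ofReal (|inner ℝ (ν y) (o - y) * inner ℝ (o - y) (ν o)| / ‖y - o‖ ^ (d + 2))

/-- With `y - o = s • dir b`, the two inner products contribute `s ^ 2` against `|s| ^ (d + 2)` in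
the denominator. The left factor is the Jacobian of the central projection from `o` and the right
one depends on `y` only through `b`, as the weighted area formula requires. -/
theorem energyKernel_eq {ν : Space (d + 1) → Space (d + 1)} {o y : Space (d + 1)}
    (h : head (y - o) ≠ 0) :
    energyKernel ν o y =
      ‖(head (y - o))⁻¹‖ₑ ^ d * ‖(inner ℝ (ν y) (dir (centralProj o y)) : ℝ)‖ₑ *
      (lineWeight (centralProj o y) * ‖(inner ℝ (ν o) (dir (centralProj o y)) : ℝ)‖ₑ) := by
  set b := centralProj o y with hb
  set s := head (y - o) with hs
  have h1 : y - o = s • dir b := sub_eq_smul_dir_centralProj h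
  have h2 : o - y = -(s • dir b) := by rw [← h1, neg_sub]
  have hn : 0 < ‖s • dir b‖ := by
    rw [norm_smul]
    exact mul_pos (norm_pos_iff.2 h) (norm_pos_iff.2 (dir_ne_zero b))
  rw [energyKernel, h1, h2, ENNReal.ofReal_div_of_pos (pow_pos hn _), ← Real.enorm_eq_ofReal_abs,
    ENNReal.ofReal_pow hn.le, ofReal_norm, inner_neg_right, inner_neg_left,
    real_inner_smul_right, real_inner_smul_left, real_inner_comm (ν o), neg_mul_neg, enorm_smul,
    enorm_mul, enorm_mul, enorm_mul, enorm_inv h, lineWeight, div_eq_mul_inv, mul_pow,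
    ENNReal.mul_inv (Or.inr (ENNReal.pow_ne_top enorm_ne_top))
      (Or.inl (ENNReal.pow_ne_top enorm_ne_top)), pow_add ‖s‖ₑ,
    ENNReal.mul_inv (Or.inr (ENNReal.pow_ne_top enorm_ne_top))
      (Or.inl (ENNReal.pow_ne_top enorm_ne_top)), ← ENNReal.inv_pow]
  have hs0 : ‖s‖ₑ ^ 2 * (‖s‖ₑ ^ 2)⁻¹ = 1 :=
    ENNReal.mul_inv_cancel (pow_ne_zero _ (enorm_ne_zero.2 h)) (ENNReal.pow_ne_top enorm_ne_top)
  calc _ = ‖s‖ₑ ^ 2 * (‖s‖ₑ ^ 2)⁻¹ * ((‖s‖ₑ ^ d)⁻¹ * ‖inner ℝ (ν y) (dir b)‖ₑ *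
        ((‖dir b‖ₑ ^ (d + 2))⁻¹ * ‖inner ℝ (ν o) (dir b)‖ₑ)) := by
          ring
    _ = _ := by rw [hs0, one_mul]

/-- The line through `o` crosses the set at `o` itself, a point that the central projection cannot
see. This is the origin of the `- 1` in `N * (N - 1)`. -/
theorem lineCount_eq_add_one {B : Set (Space (d + 1))} {ν : Space (d + 1) → Space (d + 1)}
    {o : Space (d + 1)} (ho : o ∈ B) {b : Space d} (hb : inner ℝ (ν o) (dir b) ≠ 0) :
    lineCount B ν b (proj b o) = fiberCount (centralProj o) (B ∩ {y | head (y - o) ≠ 0 ∧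
      inner ℝ (ν y) (dir (centralProj o y)) ≠ 0}) b + 1 := by
  have h : B ∩ {y | inner ℝ (ν y) (dir b) ≠ 0} ∩ proj b ⁻¹' {proj b o} =
      (B ∩ {y | head (y - o) ≠ 0 ∧ inner ℝ (ν y) (dir (centralProj o y)) ≠ 0} ∩
        centralProj o ⁻¹' {b}) ∪ {o} := by
    ext y
    simp only [mem_inter_iff, mem_ofPred_eq, mem_preimage, mem_singleton_iff, mem_union]
    constructor
    · rintro ⟨⟨hy, hyν⟩, hyo⟩
      by_cases hs : head (y - o) = 0
      · right
        have := sub_eq_smul_dir hyo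
        rwa [hs, zero_smul, sub_eq_zero] at this
      · left
        have := (centralProj_eq_iff hs b).2 hyo
        exact ⟨⟨hy, hs, this.symm ▸ hyν⟩, this⟩
    · rintro (⟨⟨hy, hs, hyν⟩, rfl⟩ | rfl)
      · exact ⟨⟨hy, hyν⟩, (centralProj_eq_iff hs _).1 rfl⟩
      · exact ⟨⟨ho, hb⟩, rfl⟩
  rw [lineCount, fiberCount, h, measure_union, Measure.count_singleton, fiberCount]
  · rw [Set.disjoint_singleton_right]
    rintro ⟨⟨-, hs, -⟩, -⟩
    simp at hs
  · exact measurableSet_singleton o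

theorem IsNormalPair.lintegral_energyKernel {B : Set (Space (d + 1))}
    {ν : Space (d + 1) → Space (d + 1)} (hB : IsNormalPair B ν) {o : Space (d + 1)} (ho : o ∈ B) :
    ∫⁻ y in B, energyKernel ν o y ∂surfaceMeasure (d + 1) =
      ∫⁻ b, lineWeight b *
        (‖(inner ℝ (ν o) (dir b) : ℝ)‖ₑ * (lineCount B ν b (proj b o) - 1)) := by
  have hν := hB.measurable
  have hc : Measurable (centralProj o) := by fun_prop
  have hi : Measurable fun y => (inner ℝ (ν y) (dir (centralProj o y)) : ℝ) := by fun_prop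
  have hE1 : MeasurableSet {y : Space (d + 1) | head (y - o) ≠ 0} :=
    (show Measurable fun y : Space (d + 1) => head (y - o) by fun_prop)
      (measurableSet_singleton 0).compl
  set E : Set (Space (d + 1)) :=
    {y | head (y - o) ≠ 0 ∧ inner ℝ (ν y) (dir (centralProj o y)) ≠ 0} with hEdef
  have hE : MeasurableSet E :=
    hE1.inter (hi (measurableSet_singleton 0).compl)
  set J : Space (d + 1) → ℝ≥0∞ := fun y =>
    ‖(head (y - o))⁻¹‖ₑ ^ d * ‖(inner ℝ (ν y) (dir (centralProj o y)) : ℝ)‖ₑ with hJ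
  have hJm : Measurable J := by fun_prop
  have h1 : ∫⁻ y in B, energyKernel ν o y ∂surfaceMeasure (d + 1) =
      ∫⁻ y in B, E.indicator (fun y => J y *
        (lineWeight (centralProj o y) * ‖(inner ℝ (ν o) (dir (centralProj o y)) : ℝ)‖ₑ)) y
        ∂surfaceMeasure (d + 1) := by
    refine lintegral_congr_ae ?_
    filter_upwards [hB.ae_tail_eq_zero (head o)] with y hy
    -- Horizontal directions lie outside the chart `b ↦ dir b`. Almost everywhere on that slice the
    -- normal is vertical, so the kernel vanishes there.
    by_cases hs : head (y - o) = 0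
    · rw [indicator_of_notMem (fun h : y ∈ E => h.1 hs), energyKernel]
      have h2 : tail (ν y) = 0 := hy (by rwa [map_sub, sub_eq_zero] at hs)
      have h3 : head (o - y) = 0 := by rw [← neg_sub, map_neg, hs, neg_zero]
      rw [inner_eq_head_tail (ν y), h2, h3]
      simp
    · rw [energyKernel_eq hs]
      by_cases hi : inner ℝ (ν y) (dir (centralProj o y)) = (0 : ℝ)
      · rw [indicator_of_notMem (fun h : y ∈ E => h.2 hi), hi]
        simp
      · rw [indicator_of_mem (show y ∈ E from ⟨hs, hi⟩)]
  rw [h1, setLIntegral_indicator hE, inter_comm]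
  rw [(hB.mono (hB.measurableSet.inter hE) inter_subset_left).lintegral_comp_mul hc
    (L := fun y => (head (y - o))⁻¹ • proj (centralProj o y))
    (fun y hy => hasStrictFDerivAt_centralProj hy.2.1) hJm (fun y hy => ?_) (fun y hy => ?_)
    (g := fun b => lineWeight b * ‖(inner ℝ (ν o) (dir b) : ℝ)‖ₑ) (by fun_prop)]
  · congr 1 with b
    by_cases hb : inner ℝ (ν o) (dir b) = (0 : ℝ)
    · simp [hb]
    · rw [lineCount_eq_add_one ho hb, ENNReal.add_sub_cancel_right ENNReal.one_ne_top]
      ring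
  · rw [tangentJacobian_smul, tangentJacobian_proj, ENNReal.ofReal_mul (by positivity),
      ENNReal.ofReal_pow (abs_nonneg _), ← Real.enorm_eq_ofReal_abs, ← Real.enorm_eq_ofReal_abs]
  · exact mul_ne_zero (pow_ne_zero _ (enorm_ne_zero.2 (inv_ne_zero hy.2.1)))
      (enorm_ne_zero.2 hy.2.2)

/-- The quadratic Crofton formula. -/
theorem IsNormalPair.quadratic_crofton {B : Set (Space (d + 1))}
    {ν : Space (d + 1) → Space (d + 1)} (hB : IsNormalPair B ν)
    (hfin : surfaceMeasure (d + 1) B ≠ ∞) :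
    ∫⁻ o in B, ∫⁻ y in B, energyKernel ν o y ∂surfaceMeasure (d + 1) ∂surfaceMeasure (d + 1) =
      lineIntegral fun b a => lineCount B ν b a * (lineCount B ν b a - 1) := by
  have hν := hB.measurable
  have hN := hB.measurable_lineCount
  have : IsFiniteMeasure ((surfaceMeasure (d + 1)).restrict B) :=
    ⟨by rw [Measure.restrict_apply_univ]; exact hfin.lt_top⟩
  have hNp : Measurable fun p : Space (d + 1) × Space d => lineCount B ν p.2 (proj p.2 p.1) := by
    fun_prop
  rw [setLIntegral_congr_fun hB.measurableSet fun o ho => hB.lintegral_energyKernel ho,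
    lintegral_lintegral_swap, lineIntegral]
  · congr 1 with b
    have hNb : Measurable fun a => lineCount B ν b a - 1 := by fun_prop
    -- After the exchange, the projection formula in a fixed direction, with weight `N - 1`,
    -- supplies the second factor `N`.
    rw [← hB.lintegral_proj b hNb, lintegral_const_mul]
    exact Measurable.mul (by fun_prop) (hNb.comp (proj b).continuous.measurable)
  · refine Measurable.aemeasurable (Measurable.mul (by fun_prop) (Measurable.mul (by fun_prop) ?_))
    exact hNp.sub measurable_const

end

/-! ### Energy and area of piecewise `C¹` sets as line integrals; finiteness of area. -/

section

variable {d : ℕ}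

/-- Energy and area of a piecewise `C¹` set, as integrals over the lines. -/
theorem IsPiecewiseC1.exists_lineIntegral {A : Set (Space (d + 1))} (hA : IsPiecewiseC1 A)
    (hfin : surfaceMeasure (d + 1) A ≠ ∞) :
    ∃ (B : Set (Space (d + 1))) (ν : Space (d + 1) → Space (d + 1)), B ⊆ A ∧ IsNormalPair B ν ∧
      lineIntegral (lineCount B ν) = croftonConst d * surfaceMeasure (d + 1) A ∧
      energy A = lineIntegral fun b a => lineCount B ν b a * (lineCount B ν b a - 1) := by
  have hn : IsUnitNormalField A (unitNormal A) := by
    rw [unitNormal, dif_pos hA]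
    exact hA.choose_spec
  obtain ⟨B, ν, hBA, h0, hB, hν⟩ := hn.exists_isNormalPair
  have hae : B =ᵐ[surfaceMeasure (d + 1)] A :=
    (LE.le.eventuallyLE hBA).antisymm (ae_le_set.2 h0)
  have hmeas := measure_congr hae
  have hfinB : surfaceMeasure (d + 1) B ≠ ∞ := hmeas ▸ hfin
  refine ⟨B, ν, hBA, hB, by rw [hB.crofton hfinB, hmeas], ?_⟩
  rw [← hB.quadratic_crofton hfinB, energy, ← Measure.restrict_congr_set hae]
  refine setLIntegral_congr_fun hB.measurableSet fun o ho => ?_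
  refine setLIntegral_congr_fun hB.measurableSet fun y hy => ?_
  change ENNReal.ofReal _ = ENNReal.ofReal _
  congr 1
  rw [abs_mul, abs_mul, hν y hy, real_inner_comm (unitNormal A o) (o - y), hν o ho,
    real_inner_comm (o - y) (ν o)]

theorem lineIntegral_mono {F G : Space d → Space d → ℝ≥0∞}
    (h : ∀ᵐ b, ∀ᵐ a, F b a ≤ G b a) : lineIntegral F ≤ lineIntegral G := by
  refine lintegral_mono_ae ?_
  filter_upwards [h] with b hb
  exact mul_le_mul_right (lintegral_mono_ae hb) _

theorem lineIntegral_add {F G : Space d → Space d → ℝ≥0∞}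
    (hF : Measurable fun p : Space d × Space d => F p.1 p.2) :
    lineIntegral (fun b a => F b a + G b a) = lineIntegral F + lineIntegral G := by
  rw [lineIntegral, lineIntegral, lineIntegral, ← lintegral_add_left]
  · congr 1 with b
    rw [← mul_add, lintegral_add_left (by fun_prop)]
  · exact measurable_lineWeight.mul hF.lintegral_prod_right'

theorem lineIntegral_const_mul {F : Space d → Space d → ℝ≥0∞}
    (hF : Measurable fun p : Space d × Space d => F p.1 p.2) (c : ℝ≥0∞) :
    lineIntegral (fun b a => c * F b a) = c * lineIntegral F := by
  rw [lineIntegral, lineIntegral, ← lintegral_const_mul]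
  · congr 1 with b
    rw [lintegral_const_mul _ (by fun_prop), mul_left_comm]
  · exact measurable_lineWeight.mul hF.lintegral_prod_right'

theorem exists_fiberCount_eq {X Y : Type*} [MeasurableSpace X] [MeasurableSingletonClass X]
    (f : X → Y) (C : Set X) (z : Y) :
    fiberCount f C z = ∞ ∨ ∃ k : ℕ, fiberCount f C z = k := by
  rcases (C ∩ f ⁻¹' {z}).finite_or_infinite with h | h
  · right
    exact ⟨_, Measure.count_apply_finite _ h⟩
  · left
    exact Measure.count_apply_infinite h

theorem fiberCount_mono {X Y : Type*} [MeasurableSpace X] {f : X → Y} {C D : Set X} (h : C ⊆ D)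
    (z : Y) : fiberCount f C z ≤ fiberCount f D z :=
  measure_mono (inter_subset_inter_left _ h)

theorem fiberCount_union_le {X Y : Type*} [MeasurableSpace X] (f : X → Y) (C D : Set X)
    (z : Y) : fiberCount f (C ∪ D) z ≤ fiberCount f C z + fiberCount f D z := by
  rw [fiberCount, union_inter_distrib_right]
  exact measure_union_le _ _

theorem fiberCount_iUnion_le {X Y ι : Type*} [Fintype ι] [MeasurableSpace X] (f : X → Y)
    (C : ι → Set X) (z : Y) : fiberCount f (⋃ i, C i) z ≤ ∑ i, fiberCount f (C i) z := by
  rw [fiberCount, iUnion_inter]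
  exact measure_iUnion_fintype_le _ _

theorem fiberCount_eq_zero {X Y : Type*} [MeasurableSpace X] {f : X → Y} {C : Set X} {z : Y}
    (h : z ∉ f '' C) : fiberCount f C z = 0 := by
  have : C ∩ f ⁻¹' {z} = ∅ := by
    ext y
    simp only [mem_inter_iff, mem_preimage, mem_singleton_iff, mem_empty_iff_false, iff_false]
    exact fun hy => h ⟨y, hy.1, hy.2⟩
  rw [fiberCount, this, measure_empty]

theorem exists_dir_inner_ne_zero {ν : Space (d + 1)} (hν : ν ≠ 0) :
    ∃ b : Space d, inner ℝ ν (dir b) ≠ 0 := by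
  simp only [inner_eq_head_tail, head_dir, tail_dir, mul_one]
  by_cases h : head ν = 0
  · refine ⟨tail ν, ?_⟩
    rw [h, zero_add]
    refine inner_self_ne_zero.2 fun ht => hν (ext_head_tail (by simpa using h) (by simpa using ht))
  · exact ⟨0, by simpa using h⟩

/-- Near each point, projecting along a transversal direction controls the area by the volume of a
bounded set; compactness does the rest. -/
theorem IsC1Hypersurface.measure_lt_top {S C : Set (Space (d + 1))} (hS : IsC1Hypersurface S)
    (hC : IsCompact C) (hCS : C ⊆ S) : surfaceMeasure (d + 1) C < ∞ := by
  refine hC.measure_lt_top_of_nhdsWithin fun y hy => ?_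
  obtain ⟨v, hv⟩ := hS y (hCS hy)
  have hv1 := hv.norm_eq_one
  obtain ⟨b, hb⟩ := exists_dir_inner_ne_zero (ν := v) (by rintro rfl; simp at hv1)
  have hJ : tangentJacobian v (proj b) ≠ 0 := by
    rw [tangentJacobian_proj]
    exact abs_ne_zero.2 hb
  obtain ⟨U, hU, -, hUC⟩ := hv.tangentAt.exists_nhds_measure_image hv1
    (proj b).hasStrictFDerivAt hJ (q := 2) one_lt_two
  refine ⟨C ∩ (U ∩ Metric.ball y 1),
    inter_mem_nhdsWithin _ (inter_mem hU (Metric.ball_mem_nhds y one_pos)), ?_⟩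
  have h1 := (hUC (C ∩ (U ∩ Metric.ball y 1)) fun x hx => ⟨hCS hx.1, hx.2.1⟩).1
  have h2 : volume (proj b '' (C ∩ (U ∩ Metric.ball y 1))) < ∞ := by
    have : Bornology.IsBounded (proj b '' (C ∩ (U ∩ Metric.ball y 1))) :=
      (proj b).lipschitz.isBounded_image (Metric.isBounded_ball.subset fun x hx => hx.2.2)
    exact this.measure_lt_top
  by_contra! h3
  rw [top_le_iff] at h3
  rw [h3, ENNReal.mul_top] at h1
  · exact absurd h1 (not_le.2 (ENNReal.mul_lt_top (by simp) h2))
  · rw [ne_eq, ENNReal.ofReal_eq_zero, not_le]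
    exact lt_of_le_of_ne (abs_nonneg _) hJ.symm

/-- The exceptional parameters form a proper affine subspace of `ℝ^d`. -/
theorem ae_inner_dir_ne_zero {v : Space (d + 1)} (hv : v ≠ 0) :
    ∀ᵐ b : Space d, inner ℝ v (dir b) ≠ 0 := by
  obtain ⟨b₀, hb₀⟩ := exists_dir_inner_ne_zero hv
  let f : Space d →ᵃ[ℝ] ℝ := (innerSL ℝ (tail v)).toLinearMap.toAffineMap +
    AffineMap.const ℝ (Space d) (head v)
  have hf : ∀ b, f b = inner ℝ v (dir b) := fun b => by
    rw [inner_eq_head_tail, head_dir, tail_dir, mul_one, add_comm]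
    rfl
  let s : AffineSubspace ℝ (Space d) := (AffineSubspace.mk' (0 : ℝ) ⊥).comap f
  have hs : ∀ b, b ∈ s ↔ inner ℝ v (dir b) = 0 := fun b => by
    rw [AffineSubspace.mem_comap, ← hf]
    simp [AffineSubspace.mem_mk']
  have h := Measure.addHaar_affineSubspace (volume : Measure (Space d)) s
    (fun h => hb₀ ((hs b₀).1 (h ▸ AffineSubspace.mem_top ℝ _ _)))
  refine measure_mono_null (fun b hb => ?_) h
  exact (hs b).2 (not_not.1 hb)

end

/-! ### Crossings of lines with flat pieces and with boundaries of convex sets. -/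

section

theorem HasC1Boundary.isC1Hypersurface_frontier {n : ℕ} {Ω : Set (Space n)}
    (hΩ : HasC1Boundary Ω) (ho : IsOpen Ω) : IsC1Hypersurface (frontier Ω) := by
  intro x hx
  obtain ⟨U, φ, hU, hxU, hφ, hg, hΩU⟩ := hΩ x hx
  have hcont := continuousOn_gradient hU hφ
  have hV : IsOpen (U ∩ gradient φ ⁻¹' {0}ᶜ) := hcont.isOpen_inter_preimage hU isOpen_compl_singleton
  refine ⟨‖gradient φ x‖⁻¹ • gradient φ x, hx, _, φ, hV, ⟨hxU, hg⟩, hφ.mono inter_subset_left, hg,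
    ?_, ?_, Submodule.smul_mem _ _ (Submodule.mem_span_singleton_self _)⟩
  · have hmem : ∀ y ∈ U, (y ∈ Ω ↔ φ y < 0) := fun y hy => by
      have := Set.ext_iff.1 hΩU y
      simp only [mem_inter_iff, mem_ofPred_eq, hy, and_true, true_and] at this
      exact this
    have hcU : ∀ y ∈ U, ContinuousAt φ y := fun y hy => hφ.continuousOn.continuousAt (hU.mem_nhds hy)
    ext y
    simp only [mem_inter_iff, mem_ofPred_eq]
    refine ⟨fun ⟨hy, hyV⟩ => ⟨hyV, ?_⟩, fun ⟨hyV, hy0⟩ => ⟨?_, hyV⟩⟩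
    · rw [ho.frontier_eq] at hy
      have h1 : 0 ≤ φ y := not_lt.1 fun h => hy.2 ((hmem y hyV.1).2 h)
      refine le_antisymm (not_lt.1 fun h => ?_) h1
      have h2 : ∀ᶠ z in 𝓝 y, 0 < φ z ∧ z ∈ U :=
        ((hcU y hyV.1).eventually (lt_mem_nhds h)).and (hU.mem_nhds hyV.1)
      obtain ⟨z, hz, hzΩ⟩ := (mem_closure_iff_nhds.1 hy.1) _ h2
      exact lt_asymm hz.1 ((hmem z hz.2).1 hzΩ)
    · rw [ho.frontier_eq]
      refine ⟨?_, fun h => hy0.not_lt ((hmem y hyV.1).1 h)⟩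
      by_contra hcl
      have h2 : ∀ᶠ z in 𝓝 y, z ∉ closure Ω ∧ z ∈ U :=
        Filter.Eventually.and (isClosed_closure.isOpen_compl.mem_nhds hcl) (hU.mem_nhds hyV.1)
      -- A zero of `φ` away from the closure of `Ω` would be a local minimum, hence critical. This
      -- is why the neighbourhood was shrunk to where the gradient does not vanish.
      have hmin : IsLocalMin φ y := by
        filter_upwards [h2] with z hz
        rw [hy0]
        exact not_lt.1 fun h => hz.1 (subset_closure ((hmem z hz.2).2 h))
      have h3 := hmin.hasFDerivAt_eq_zero
        (hasStrictFDerivAt_of_contDiffOn hU hφ hyV.1).hasFDerivAt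
      have h4 : (inner ℝ (gradient φ y) (gradient φ y) : ℝ) = 0 :=
        congrArg (fun L => L (gradient φ y)) h3
      exact hyV.2 (inner_self_eq_zero.1 h4)
  · rw [norm_smul, norm_inv, norm_norm, inv_mul_cancel₀ (norm_ne_zero_iff.2 hg)]

theorem isC1Hypersurface_hyperplane {n : ℕ} {v : Space n} (hv : v ≠ 0) (b : ℝ) (x : Space n)
    (hx : x ∈ hyperplane v b) : IsUnitNormalAt (hyperplane v b) x (‖v‖⁻¹ • v) := by
  have hgr : gradient (fun y => (inner ℝ v y : ℝ) - b) x = v := by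
    refine HasGradientAt.gradient ?_
    rw [hasGradientAt_iff_hasFDerivAt]
    exact ((innerSL ℝ v).hasFDerivAt (x := x)).sub_const b
  refine ⟨hx, univ, fun y => inner ℝ v y - b, isOpen_univ, mem_univ x, ?_, ?_, ?_, ?_, ?_⟩
  · exact ((innerSL ℝ v).contDiff.sub contDiff_const).contDiffOn
  · rw [hgr]; exact hv
  · ext y
    simp [hyperplane, sub_eq_zero]
  · rw [norm_smul, norm_inv, norm_norm, inv_mul_cancel₀ (norm_ne_zero_iff.2 hv)]
  · rw [hgr]
    exact Submodule.smul_mem _ _ (Submodule.mem_span_singleton_self _)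

variable {d : ℕ}

theorem IsFlatPiece.isNormalPair {Ω K : Set (Space d)} (hK : IsFlatPiece Ω K) :
    ∃ v : Space d, v ≠ 0 ∧ IsNormalPair K fun _ => v := by
  obtain ⟨hm, v, b, hv, hKv⟩ := hK
  have hvn : ‖‖v‖⁻¹ • v‖ = 1 := by
    rw [norm_smul, norm_inv, norm_norm, inv_mul_cancel₀ (norm_ne_zero_iff.2 hv)]
  refine ⟨‖v‖⁻¹ • v, fun h => by simp [h] at hvn, hm, measurable_const, fun _ _ => hvn,
    fun k => if k = 0 then K else ∅, fun k => ?_, fun i j hij => ?_, ?_, fun k y hy => ?_⟩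
  · dsimp only
    split_ifs
    exacts [hm, MeasurableSet.empty]
  · rcases eq_or_ne i 0 with rfl | hi
    · simp [Function.onFun, hij.symm]
    · simp [Function.onFun, hi]
  · ext y
    simp only [mem_iUnion]
    constructor
    · rintro ⟨k, hk⟩
      by_cases hk0 : k = 0
      · simpa [hk0] using hk
      · simp [hk0] at hk
    · intro hy
      exact ⟨0, by simpa using hy⟩
  · by_cases hk0 : k = 0
    · simp only [hk0, if_true] at hy ⊢
      exact (isC1Hypersurface_hyperplane hv b y (hKv hy).2).tangentAt.mono
        fun z hz => (hKv hz).2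
    · simp [hk0] at hy

theorem IsFlatPiece.measure_lt_top {Ω K : Set (Space (d + 1))} (hK : IsFlatPiece Ω K)
    (hΩ : Bornology.IsBounded Ω) : surfaceMeasure (d + 1) K < ∞ := by
  obtain ⟨hm, v, b, hv, hKv⟩ := hK
  have hS : IsC1Hypersurface (hyperplane v b) := fun x hx =>
    ⟨_, isC1Hypersurface_hyperplane hv b x hx⟩
  have hcl : IsClosed (hyperplane v b) :=
    isClosed_eq (continuous_const.inner continuous_id) continuous_const
  refine (measure_mono ?_).trans_lt (hS.measure_lt_top (C := closure Ω ∩ hyperplane v b)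
    (hΩ.isCompact_closure.inter_right hcl) inter_subset_right)
  exact hKv.trans (inter_subset_inter_left _ subset_closure)

theorem IsFlatPiece.fiberCount_le_one {Ω K : Set (Space (d + 1))} (hK : IsFlatPiece Ω K) :
    ∀ᵐ b, ∀ a, fiberCount (proj b) K a ≤ 1 := by
  obtain ⟨hm, v, c, hv, hKv⟩ := hK
  filter_upwards [ae_inner_dir_ne_zero hv] with b hb a
  have hinj : InjOn (proj b) K := by
    intro y hy y' hy' h
    have h1 := sub_eq_smul_dir h
    have h2 : (inner ℝ v (y - y') : ℝ) = 0 := by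
      rw [inner_sub_right, (hKv hy).2, (hKv hy').2, sub_self]
    rw [h1, real_inner_smul_right, mul_eq_zero] at h2
    rw [h2.resolve_right hb, zero_smul, sub_eq_zero] at h1
    exact h1
  rw [fiberCount_of_injOn hinj]
  exact indicator_le_self' (fun _ _ => zero_le_one) a |>.trans le_rfl

theorem lineCount_const (K : Set (Space (d + 1))) {v : Space (d + 1)} (hv : v ≠ 0) :
    ∀ᵐ b, ∀ a, lineCount K (fun _ => v) b a = fiberCount (proj b) K a := by
  filter_upwards [ae_inner_dir_ne_zero hv] with b hb a
  simp [lineCount, hb]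

section Convex

variable {D : Set (Space (d + 1))}

/-- A ray from an interior point of a bounded convex set leaves it at exactly one point. -/
theorem exists_ray_frontier (ho : IsOpen D) (hc : Convex ℝ D) (hb : Bornology.IsBounded D)
    {o u : Space (d + 1)} (hoD : o ∈ D) (hu : u ≠ 0) :
    ∃ β : ℝ, 0 < β ∧ ∀ s : ℝ, 0 < s → (o + s • u ∈ frontier D ↔ s = β) := by
  have hg : Continuous fun s : ℝ => o + s • u := by fun_prop
  have hcl : IsClosed ({s : ℝ | 0 ≤ s ∧ o + s • u ∈ closure D}) :=
    isClosed_Ici.inter (isClosed_closure.preimage hg)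
  have hbd : Bornology.IsBounded {s : ℝ | 0 ≤ s ∧ o + s • u ∈ closure D} := by
    obtain ⟨R, hR⟩ := hb.closure.exists_norm_le
    refine (Metric.isBounded_Icc (0 : ℝ) ((R + ‖o‖) / ‖u‖)).subset fun s hs => ⟨hs.1, ?_⟩
    rw [le_div_iff₀ (norm_pos_iff.2 hu)]
    have h1 := hR _ hs.2
    have h2 := norm_sub_le (o + s • u) o
    rw [add_sub_cancel_left, norm_smul, Real.norm_eq_abs, abs_of_nonneg hs.1] at h2
    linarith
  -- `β` is the last parameter at which the ray is in the closure; by convexity all earlier points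
  -- are interior, so the boundary is met only there.
  obtain ⟨β, ⟨hβ0, hβ⟩, hmax⟩ := (Metric.isCompact_of_isClosed_isBounded hcl hbd).exists_isGreatest
    ⟨0, le_rfl, by simpa using subset_closure hoD⟩
  have hβD : o + β • u ∉ D := by
    intro h
    have h1 : ∀ᶠ s in 𝓝[>] β, o + s • u ∈ D :=
      nhdsWithin_le_nhds (hg.continuousAt.preimage_mem_nhds (ho.mem_nhds h))
    obtain ⟨s, hsD, hs⟩ := (h1.and self_mem_nhdsWithin).exists
    exact absurd (hmax ⟨hβ0.trans (le_of_lt hs), subset_closure hsD⟩) (not_le.2 hs)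
  have hβpos : 0 < β := lt_of_le_of_ne hβ0 (by rintro rfl; simp [hoD] at hβD)
  refine ⟨β, hβpos, fun s hs => ⟨fun h => ?_, ?_⟩⟩
  · rw [ho.frontier_eq] at h
    refine (hmax ⟨hs.le, h.1⟩).eq_of_not_lt fun hlt => h.2 ?_
    have := hc.openSegment_interior_closure_subset_interior (ho.interior_eq.symm ▸ hoD) hβ
      (show o + s • u ∈ openSegment ℝ o (o + β • u) from
        ⟨1 - s / β, s / β, by rw [sub_pos, div_lt_one hβpos]; exact hlt, by positivity, by ring, by
          have : s / β * β = s := div_mul_cancel₀ _ hβpos.ne'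
          rw [smul_add, ← add_assoc, ← add_smul, smul_smul, this]
          simp⟩)
    exact interior_subset this
  · rintro rfl
    rw [ho.frontier_eq]
    exact ⟨hβ, hβD⟩

/-- A line through a bounded convex open set meets its boundary in two points. -/
theorem fiberCount_frontier_eq_two (ho : IsOpen D) (hc : Convex ℝ D) (hb : Bornology.IsBounded D)
    {b a : Space d} (ha : a ∈ proj b '' D) : fiberCount (proj b) (frontier D) a = 2 := by
  obtain ⟨o, hoD, rfl⟩ := ha
  obtain ⟨β, hβ, h1⟩ := exists_ray_frontier ho hc hb hoD (dir_ne_zero b)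
  obtain ⟨γ, hγ, h2⟩ := exists_ray_frontier ho hc hb hoD (neg_ne_zero.2 (dir_ne_zero b))
  have hset : frontier D ∩ proj b ⁻¹' {proj b o} = {o + β • dir b, o + γ • -dir b} := by
    ext y
    simp only [mem_inter_iff, mem_preimage, mem_singleton_iff, mem_insert_iff]
    constructor
    · rintro ⟨hy, hyo⟩
      have h := sub_eq_smul_dir hyo
      have hy' : y = o + head (y - o) • dir b := by rw [← h]; abel
      rcases lt_trichotomy (head (y - o)) 0 with hs | hs | hs
      · right
        have hy2 : y = o + (-head (y - o)) • -dir b := by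
          rw [smul_neg, neg_smul, neg_neg]; exact hy'
        rw [hy2] at hy
        rw [← (h2 _ (neg_pos.2 hs)).1 hy]
        exact hy2
      · rw [hs, zero_smul, add_zero] at hy'
        rw [hy', ho.frontier_eq] at hy
        exact (hy.2 hoD).elim
      · left
        rw [hy'] at hy
        rw [← (h1 _ hs).1 hy]
        exact hy'
    · have hd0 : proj b (dir b) = 0 := by simp [proj_apply]
      rintro (rfl | rfl)
      · exact ⟨(h1 β hβ).2 rfl, by simp [hd0]⟩
      · exact ⟨(h2 γ hγ).2 rfl, by simp [hd0]⟩
  have hne : o + β • dir b ≠ o + γ • -dir b := by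
    intro h
    have := congrArg head h
    simp at this
    linarith
  rw [fiberCount, hset]
  have := Measure.count_apply_finset ({o + β • dir b, o + γ • -dir b} : Finset (Space (d + 1)))
  rw [Finset.card_pair hne] at this
  simpa using this

/-- Lines through a convex open set are transversal to its boundary. -/
theorem IsUnitNormalAt.inner_ne_zero (ho : IsOpen D) (hc : Convex ℝ D) {o y v : Space (d + 1)}
    (hoD : o ∈ D) (hv : IsUnitNormalAt (frontier D) y v) : inner ℝ v (y - o) ≠ 0 := by
  have hy : y ∈ frontier D := hv.1
  rw [ho.frontier_eq] at hy
  obtain ⟨f, hf⟩ := geometric_hahn_banach_open_point hc ho hy.2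
  set w := (InnerProductSpace.toDual ℝ (Space (d + 1))).symm f with hw
  have hwf : innerSL ℝ w = f := by
    ext z
    simp [hw]
  have hext : IsLocalExtrOn f (frontier D) y := by
    right
    filter_upwards [self_mem_nhdsWithin] with z hz
    exact closure_minimal (fun x hx => (hf x hx).le)
      (isClosed_le f.continuous continuous_const) (frontier_subset_closure hz)
  obtain ⟨c, hcw⟩ := hv.exists_eq_smul_of_isLocalExtrOn (w := w)
    (hwf ▸ f.hasStrictFDerivAt) hext
  intro h0
  have h1 : f (y - o) = 0 := by
    rw [← hwf, innerSL_apply_apply, hcw, real_inner_smul_left, h0, mul_zero]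
  rw [map_sub, sub_eq_zero] at h1
  exact (hf o hoD).ne h1.symm

/-- The indicator function of the lines that meet a set. -/
def hit (D : Set (Space (d + 1))) (b a : Space d) : ℝ≥0∞ := (proj b '' D).indicator 1 a

theorem isOpen_hits (ho : IsOpen D) : IsOpen {p : Space d × Space d | p.2 ∈ proj p.1 '' D} := by
  have : {p : Space d × Space d | p.2 ∈ proj p.1 '' D} =
      ⋃ s : ℝ, (fun p : Space d × Space d => consL d (s, p.2 + s • p.1)) ⁻¹' D := by
    ext ⟨b, a⟩
    simp only [mem_ofPred_eq, mem_image, mem_iUnion, mem_preimage]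
    constructor
    · rintro ⟨y, hy, rfl⟩
      refine ⟨head y, ?_⟩
      rwa [proj_apply, sub_add_cancel, consL_head_tail]
    · rintro ⟨s, hs⟩
      exact ⟨_, hs, by simp [proj_apply]⟩
  rw [this]
  exact isOpen_iUnion fun s => ho.preimage (by fun_prop)

theorem measurable_hit (ho : IsOpen D) : Measurable fun p : Space d × Space d => hit D p.1 p.2 :=
  measurable_one.indicator (isOpen_hits ho).measurableSet

/-- Almost no line touches a convex open set without meeting it. -/
theorem ae_mem_image_or_notMem (ho : IsOpen D) (hc : Convex ℝ D) (b : Space d) :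
    ∀ᵐ a, a ∈ proj b '' D ∨ a ∉ proj b '' closure D := by
  have h1 : IsOpen (proj b '' D) :=
    (isOpen_hits ho).preimage (f := fun a => (b, a)) (by fun_prop)
  have h2 : Convex ℝ (proj b '' D) := hc.linear_image (proj b).toLinearMap
  refine measure_mono_null ?_ (h2.addHaar_frontier volume)
  intro a ha
  rw [mem_compl_iff, mem_ofPred_eq, not_or, not_not] at ha
  rw [h1.frontier_eq]
  exact ⟨image_closure_subset_closure_image (proj b).continuous ha.2, ha.1⟩

theorem fiberCount_frontier_le (ho : IsOpen D) (hc : Convex ℝ D) (hb : Bornology.IsBounded D)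
    (b : Space d) : ∀ᵐ a, fiberCount (proj b) (frontier D) a ≤ 2 := by
  filter_upwards [ae_mem_image_or_notMem ho hc b] with a ha
  rcases ha with ha | ha
  · exact (fiberCount_frontier_eq_two ho hc hb ha).le
  · rw [fiberCount_eq_zero fun h => ha (image_mono frontier_subset_closure h)]
    exact zero_le

/-- Lines that meet `D` cross the boundary exactly twice, and transversally; lines that miss the
closure do not cross it; and lines that only touch it are negligible. Crofton's formula does the
rest. -/
theorem croftonConst_mul_frontier (ho : IsOpen D) (hc : Convex ℝ D) (hb : Bornology.IsBounded D)
    (hD : HasC1Boundary D) :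
    croftonConst d * surfaceMeasure (d + 1) (frontier D) = 2 * lineIntegral (hit D) := by
  have hS := hD.isC1Hypersurface_frontier ho
  have hcomp : IsCompact (frontier D) := hb.isCompact_closure.of_isClosed_subset isClosed_frontier
    frontier_subset_closure
  obtain ⟨ν, hν, hn⟩ := exists_isNormalPair hS hcomp.isClosed.measurableSet subset_rfl
  rw [← hν.crofton (hS.measure_lt_top hcomp subset_rfl).ne,
    ← lineIntegral_const_mul (measurable_hit ho)]
  have key : ∀ b, ∀ᵐ a, lineCount (frontier D) ν b a = 2 * hit D b a := by
    intro b
    filter_upwards [ae_mem_image_or_notMem ho hc b] with a ha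
    rcases ha with ha | ha
    · rw [hit, indicator_of_mem ha, Pi.one_apply, mul_one]
      refine Eq.trans ?_ (fiberCount_frontier_eq_two ho hc hb ha)
      rw [lineCount, fiberCount, fiberCount]
      congr 1
      ext y
      simp only [mem_inter_iff, mem_ofPred_eq, mem_preimage, mem_singleton_iff]
      refine ⟨fun h => ⟨h.1.1, h.2⟩, fun h => ⟨⟨h.1, fun h0 => ?_⟩, h.2⟩⟩
      obtain ⟨o, hoD, rfl⟩ := ha
      have h1 := (hn y h.1).inner_ne_zero ho hc hoD
      rw [sub_eq_smul_dir h.2, real_inner_smul_right, h0, mul_zero] at h1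
      exact h1 rfl
    · rw [hit, indicator_of_notMem fun h => ha (image_mono subset_closure h), mul_zero, lineCount,
        fiberCount_eq_zero]
      exact fun h => ha (image_mono (inter_subset_left.trans frontier_subset_closure) h)
  exact le_antisymm
    (lineIntegral_mono (Eventually.of_forall fun b => (key b).mono fun a ha => ha.le))
    (lineIntegral_mono (Eventually.of_forall fun b => (key b).mono fun a ha => ha.ge))

end Convex

end

/-! ### Integer inequalities and the two bounds for the energy. -/

section

/-- This is `(k - 2m) * (k - 2m - 1) ≥ 0` expanded; no integer lies strictly between `2m` and `2m +
1`. The truncated `k - 1` is harmless, being multiplied by `k`. -/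
theorem four_mul_le_of_nat (m k : ℕ) : 4 * m * k ≤ k * (k - 1) + 2 * m * (2 * m + 1) := by
  cases k with
  | zero => simp
  | succ k =>
    rw [Nat.add_sub_cancel]
    rcases le_or_gt k (2 * m) with h | h
    · rcases h.eq_or_lt with rfl | h
      · apply le_of_eq; ring
      · obtain ⟨j, hj⟩ := Nat.exists_eq_add_of_lt h
        zify at hj ⊢
        nlinarith [mul_nonneg (Int.natCast_nonneg j) (Int.natCast_nonneg j), Int.natCast_nonneg j]
    · obtain ⟨j, hj⟩ := Nat.exists_eq_add_of_lt h
      subst hj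
      nlinarith [Nat.zero_le j]

/-- With `s = k + j`, expanding `(2m + s) * (2m + s - 1)` leaves the remainder `s * (s - 1) = 2 * k
* j ≤ 2 * j`. Without the correction piece (`j = 0`) the bound matches the lower one. -/
theorem mul_pred_le_of_nat {m k j N : ℕ} (hk : k ≤ 1) (hj : j ≤ 1) (h : N ≤ 2 * m + k + j) :
    N * (N - 1) ≤ 2 * m * (2 * m - 1) + 4 * m * (k + j) + 2 * j := by
  refine (Nat.mul_le_mul h (Nat.sub_le_sub_right h 1)).trans ?_
  rcases m with _ | m
  · interval_cases k <;> interval_cases j <;> simp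
  · have e : 2 * (m + 1) - 1 = 2 * m + 1 := by omega
    rw [e]
    interval_cases k <;> interval_cases j
    · have e2 : 2 * (m + 1) + 0 + 0 - 1 = 2 * m + 1 := by omega
      rw [e2]; apply le_of_eq; ring
    · have e2 : 2 * (m + 1) + 0 + 1 - 1 = 2 * m + 2 := by omega
      rw [e2]; nlinarith
    · have e2 : 2 * (m + 1) + 1 + 0 - 1 = 2 * m + 2 := by omega
      rw [e2]; apply le_of_eq; ring
    · have e2 : 2 * (m + 1) + 1 + 1 - 1 = 2 * m + 3 := by omega
      rw [e2]; apply le_of_eq; ring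

variable {d : ℕ} {Ω : Set (Space (d + 1))}

/-- The lower bound for the energy: the number `N` of intersections with a line is an integer, so
that `(N - 2 * m) * (N - (2 * m + 1))` is nonnegative. -/
theorem le_energy (ho : IsOpen Ω) (hc : Convex ℝ Ω) {A : Set (Space (d + 1))}
    (hAΩ : A ⊆ closure Ω) (hA : IsPiecewiseC1 A) (hfin : surfaceMeasure (d + 1) A ≠ ∞) (m : ℕ) :
    ((4 * m : ℕ) : ℝ≥0∞) * (croftonConst d * surfaceMeasure (d + 1) A) ≤
      energy A + ((2 * m * (2 * m + 1) : ℕ) : ℝ≥0∞) * lineIntegral (hit Ω) := by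
  obtain ⟨B, ν, hBA, hB, hArea, hEn⟩ := hA.exists_lineIntegral hfin
  have hN := hB.measurable_lineCount
  have hNm : Measurable fun p : Space d × Space d =>
      lineCount B ν p.1 p.2 * (lineCount B ν p.1 p.2 - 1) := hN.mul (hN.sub measurable_const)
  rw [← hArea, hEn, ← lineIntegral_const_mul hN, ← lineIntegral_const_mul (measurable_hit ho),
    ← lineIntegral_add hNm]
  refine lineIntegral_mono (Eventually.of_forall fun b => ?_)
  filter_upwards [ae_mem_image_or_notMem ho hc b] with a ha
  rcases ha with ha | ha
  · rw [hit, indicator_of_mem ha, Pi.one_apply, mul_one]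
    rcases exists_fiberCount_eq (proj b) (B ∩ {y | inner ℝ (ν y) (dir b) ≠ 0}) a with h | ⟨k, h⟩
    · rw [lineCount, h]
      simp
    · rw [lineCount, h]
      have h1 : (k : ℝ≥0∞) - 1 = ((k - 1 : ℕ) : ℝ≥0∞) := by
        rw [ENNReal.natCast_sub, Nat.cast_one]
      rw [h1]
      exact_mod_cast four_mul_le_of_nat m k
  · have : lineCount B ν b a = 0 := fiberCount_eq_zero fun h =>
      ha (image_mono ((inter_subset_left.trans hBA).trans hAΩ) h)
    rw [this, mul_zero]
    exact zero_le

/-- The upper bound for the energy of a set covered by boundaries of convex sets and by two flat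
pieces. -/
theorem energy_le (ho : IsOpen Ω) (hc : Convex ℝ Ω) {A : Set (Space (d + 1))}
    (hAΩ : A ⊆ closure Ω) (hA : IsPiecewiseC1 A) (hfin : surfaceMeasure (d + 1) A ≠ ∞) {m : ℕ}
    {D : Fin m → Set (Space (d + 1))} (hDo : ∀ i, IsOpen (D i)) (hDc : ∀ i, Convex ℝ (D i))
    (hDb : ∀ i, Bornology.IsBounded (D i)) {K J : Set (Space (d + 1))} (hK : IsFlatPiece Ω K)
    (hJ : IsFlatPiece Ω J) (hKfin : surfaceMeasure (d + 1) K ≠ ∞)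
    (hJfin : surfaceMeasure (d + 1) J ≠ ∞) (hsub : A ⊆ (⋃ i, frontier (D i)) ∪ K ∪ J) :
    energy A ≤ ((2 * m * (2 * m - 1) : ℕ) : ℝ≥0∞) * lineIntegral (hit Ω) +
      ((4 * m : ℕ) : ℝ≥0∞) * (croftonConst d * surfaceMeasure (d + 1) K +
        croftonConst d * surfaceMeasure (d + 1) J) +
      2 * (croftonConst d * surfaceMeasure (d + 1) J) := by
  obtain ⟨B, ν, hBA, hB, -, hEn⟩ := hA.exists_lineIntegral hfin
  obtain ⟨v, hv, hKv⟩ := hK.isNormalPair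
  obtain ⟨w, hw, hJw⟩ := hJ.isNormalPair
  have hKm := hKv.measurable_lineCount
  have hJm := hJw.measurable_lineCount
  have hHm := measurable_hit ho
  have hKJm : Measurable fun p : Space d × Space d =>
      lineCount K (fun _ => v) p.1 p.2 + lineCount J (fun _ => w) p.1 p.2 := hKm.add hJm
  rw [hEn, ← hKv.crofton hKfin, ← hJw.crofton hJfin, ← lineIntegral_add hKm,
    ← lineIntegral_const_mul (F := fun b a => lineCount K (fun _ => v) b a +
      lineCount J (fun _ => w) b a) hKJm, ← lineIntegral_const_mul hJm,
    ← lineIntegral_const_mul hHm, ← lineIntegral_add (hHm.const_mul _),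
    ← lineIntegral_add (F := fun b a => ((2 * m * (2 * m - 1) : ℕ) : ℝ≥0∞) * hit Ω b a +
      ((4 * m : ℕ) : ℝ≥0∞) * (lineCount K (fun _ => v) b a + lineCount J (fun _ => w) b a))
      ((hHm.const_mul _).add (hKJm.const_mul _))]
  refine lineIntegral_mono ?_
  filter_upwards [hK.fiberCount_le_one, hJ.fiberCount_le_one, lineCount_const K hv,
    lineCount_const J hw] with b hb1 hb2 hb3 hb4
  filter_upwards [ae_mem_image_or_notMem ho hc b,
    ae_all_iff.2 fun i => fiberCount_frontier_le (hDo i) (hDc i) (hDb i) b] with a ha haD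
  have hle : lineCount B ν b a ≤
      2 * m + fiberCount (proj b) K a + fiberCount (proj b) J a := by
    have h1 : lineCount B ν b a ≤ fiberCount (proj b) ((⋃ i, frontier (D i)) ∪ K ∪ J) a :=
      fiberCount_mono ((inter_subset_left.trans hBA).trans hsub) a
    refine h1.trans ((fiberCount_union_le _ _ _ _).trans (add_le_add_left
      ((fiberCount_union_le _ _ _ _).trans (add_le_add_left ?_ _)) _))
    refine (fiberCount_iUnion_le _ _ _).trans ((Finset.sum_le_sum fun i _ => haD i).trans_eq ?_)
    simp [mul_comm]
  rw [hb3, hb4]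
  rcases ha with ha | ha
  · rw [hit, indicator_of_mem ha, Pi.one_apply, mul_one]
    have hk1 := hb1 a
    have hj1 := hb2 a
    obtain hk | ⟨k, hk⟩ := exists_fiberCount_eq (proj b) K a
    · rw [hk] at hk1; exact absurd hk1 (by simp)
    obtain hj | ⟨j, hj⟩ := exists_fiberCount_eq (proj b) J a
    · rw [hj] at hj1; exact absurd hj1 (by simp)
    rw [hk] at hk1 hle
    rw [hj] at hj1 hle
    rw [hk, hj]
    rcases exists_fiberCount_eq (proj b) (B ∩ {y | inner ℝ (ν y) (dir b) ≠ 0}) a with h | ⟨N, h⟩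
    · rw [lineCount, h] at hle
      exact absurd hle (not_le.2 (by exact_mod_cast ENNReal.natCast_lt_top (2 * m + k + j)))
    · rw [lineCount, h] at hle
      rw [lineCount, h]
      have h1 : (N : ℝ≥0∞) - 1 = ((N - 1 : ℕ) : ℝ≥0∞) := by
        rw [ENNReal.natCast_sub, Nat.cast_one]
      rw [h1]
      exact_mod_cast mul_pred_le_of_nat (m := m) (k := k) (j := j) (N := N)
        (by exact_mod_cast hk1) (by exact_mod_cast hj1) (by exact_mod_cast hle)
  · have : lineCount B ν b a = 0 := fiberCount_eq_zero fun h =>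
      ha (image_mono ((inter_subset_left.trans hBA).trans hAΩ) h)
    rw [this, zero_mul]
    exact zero_le

end

/-! ### Homotheties of convex sets and flat pieces of prescribed area. -/

section

section Homothety

variable {n : ℕ}

/-- A homothety with nonzero factor, as a homeomorphism. -/
def homothetyHomeo (p : Space n) {t : ℝ} (ht : t ≠ 0) : Space n ≃ₜ Space n where
  toFun := AffineMap.homothety p t
  invFun := AffineMap.homothety p t⁻¹
  left_inv y := by
    rw [← AffineMap.homothety_mul_apply, inv_mul_cancel₀ ht, AffineMap.homothety_one]
    rfl
  right_inv y := by
    rw [← AffineMap.homothety_mul_apply, mul_inv_cancel₀ ht, AffineMap.homothety_one]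
    rfl
  continuous_toFun := AffineMap.homothety_continuous p t
  continuous_invFun := AffineMap.homothety_continuous p t⁻¹

theorem image_homothety_eq_preimage (p : Space n) {t : ℝ} (ht : t ≠ 0) (S : Set (Space n)) :
    AffineMap.homothety p t '' S = AffineMap.homothety p t⁻¹ ⁻¹' S :=
  (homothetyHomeo p ht).image_eq_preimage_symm S

theorem frontier_image_homothety (p : Space n) {t : ℝ} (ht : t ≠ 0) (S : Set (Space n)) :
    frontier (AffineMap.homothety p t '' S) = AffineMap.homothety p t '' frontier S :=
  ((homothetyHomeo p ht).image_frontier S).symm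

theorem IsOpen.image_homothety {S : Set (Space n)} (hS : IsOpen S) (p : Space n) {t : ℝ}
    (ht : t ≠ 0) : IsOpen (AffineMap.homothety p t '' S) :=
  (homothetyHomeo p ht).isOpenMap S hS

theorem Convex.image_homothety {S : Set (Space n)} (hS : Convex ℝ S) (p : Space n) (t : ℝ) :
    Convex ℝ (AffineMap.homothety p t '' S) :=
  hS.affine_image _

theorem IsC1Hypersurface.image_homothety {S : Set (Space n)} (hS : IsC1Hypersurface S)
    (p : Space n) {t : ℝ} (ht : t ≠ 0) : IsC1Hypersurface (AffineMap.homothety p t '' S) := by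
  rintro _ ⟨x, hx, rfl⟩
  obtain ⟨v, -, U, φ, hU, hxU, hφ, hg, hSU, -, -⟩ := hS x hx
  have hinv : ∀ y, AffineMap.homothety p t⁻¹ (AffineMap.homothety p t y) = y :=
    (homothetyHomeo p ht).left_inv
  have hh : ∀ y : Space n, AffineMap.homothety p t⁻¹ y = t⁻¹ • (y - p) + p := fun y => rfl
  have hcd : ContDiff ℝ 1 fun y : Space n => AffineMap.homothety p t⁻¹ y := by
    simp only [hh]
    fun_prop
  set ψ : Space n → ℝ := fun y => φ (AffineMap.homothety p t⁻¹ y) with hψ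
  have hgr : gradient ψ (AffineMap.homothety p t x) = t⁻¹ • gradient φ x := by
    refine HasGradientAt.gradient ?_
    rw [hasGradientAt_iff_hasFDerivAt]
    have h1 : HasFDerivAt (fun y : Space n => AffineMap.homothety p t⁻¹ y)
        (t⁻¹ • ContinuousLinearMap.id ℝ (Space n)) (AffineMap.homothety p t x) := by
      simp only [hh]
      exact (((hasFDerivAt_id _).sub_const p).const_smul t⁻¹).add_const p
    have h2 : HasFDerivAt φ (innerSL ℝ (gradient φ x))
        (AffineMap.homothety p t⁻¹ (AffineMap.homothety p t x)) := by
      rw [hinv]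
      exact (hasStrictFDerivAt_of_contDiffOn hU hφ hxU).hasFDerivAt
    refine (h2.comp _ h1).congr_fderiv ?_
    ext u
    simp
  have hgn : gradient ψ (AffineMap.homothety p t x) ≠ 0 := by
    rw [hgr]
    exact smul_ne_zero (inv_ne_zero ht) hg
  refine ⟨‖gradient ψ (AffineMap.homothety p t x)‖⁻¹ • gradient ψ (AffineMap.homothety p t x),
    mem_image_of_mem _ hx, AffineMap.homothety p t⁻¹ ⁻¹' U, ψ,
    hU.preimage (AffineMap.homothety_continuous p t⁻¹), by rwa [mem_preimage, hinv],
    hφ.comp hcd.contDiffOn fun y hy => hy, hgn, ?_, ?_,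
    Submodule.smul_mem _ _ (Submodule.mem_span_singleton_self _)⟩
  · rw [image_homothety_eq_preimage p ht, ← preimage_inter, hSU]
    rfl
  · rw [norm_smul, norm_inv, norm_norm, inv_mul_cancel₀ (norm_ne_zero_iff.2 hgn)]

theorem homothety_mem {S : Set (Space n)} (hc : Convex ℝ S) {p y : Space n} (hp : p ∈ S)
    (hy : y ∈ S) {t : ℝ} (ht : t ∈ Icc (0 : ℝ) 1) : AffineMap.homothety p t y ∈ S := by
  rw [AffineMap.homothety_eq_lineMap]
  exact hc.lineMap_mem hp hy ht

theorem image_homothety_closure_subset {S : Set (Space n)} (ho : IsOpen S) (hc : Convex ℝ S)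
    {p : Space n} (hp : p ∈ S) {s t : ℝ} (hs : 0 < s) (hst : s < t) :
    AffineMap.homothety p s '' closure S ⊆ AffineMap.homothety p t '' S := by
  rintro _ ⟨y, hy, rfl⟩
  have ht : 0 < t := hs.trans hst
  refine ⟨AffineMap.homothety p (s / t) y, ?_, ?_⟩
  · have h := hc.openSegment_interior_closure_subset_interior (ho.interior_eq.symm ▸ hp) hy
    refine interior_subset (h ?_)
    rw [AffineMap.homothety_eq_lineMap]
    exact lineMap_mem_openSegment ℝ p y ⟨div_pos hs ht, (div_lt_one ht).2 hst⟩
  · rw [← AffineMap.homothety_mul_apply, mul_div_cancel₀ _ ht.ne']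

theorem image_homothety_subset {S : Set (Space n)} (ho : IsOpen S) (hc : Convex ℝ S)
    {p : Space n} (hp : p ∈ S) {s t : ℝ} (hs : 0 < s) (hst : s ≤ t) :
    AffineMap.homothety p s '' S ⊆ AffineMap.homothety p t '' S := by
  rcases hst.eq_or_lt with rfl | hst
  · rfl
  · exact (image_mono subset_closure).trans (image_homothety_closure_subset ho hc hp hs hst)

theorem eventually_mem_image_homothety {S : Set (Space n)} (ho : IsOpen S) (p : Space n)
    {x : Space n} (hx : x ∈ S) : ∀ᶠ r : ℝ in 𝓝 1, x ∈ AffineMap.homothety p r '' S := by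
  have h1 : ContinuousAt (fun r : ℝ => AffineMap.homothety p r⁻¹ x) 1 := by
    have : (fun r : ℝ => AffineMap.homothety p r⁻¹ x) = fun r : ℝ => r⁻¹ • (x - p) + p := rfl
    rw [this]
    exact ((continuousAt_inv₀ one_ne_zero).smul continuousAt_const).add continuousAt_const
  have h2 : ∀ᶠ r : ℝ in 𝓝 1, AffineMap.homothety p r⁻¹ x ∈ S :=
    h1.preimage_mem_nhds (ho.mem_nhds (by simpa using hx))
  filter_upwards [h2, isOpen_ne.mem_nhds (one_ne_zero : (1 : ℝ) ≠ 0)] with r hr hr0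
  rw [image_homothety_eq_preimage p hr0]
  exact hr

end Homothety

variable {d : ℕ} {Ω : Set (Space (d + 1))}

/-- Shrinking `X` towards one of its points stays inside by convexity and scales area by the `d`-th
power of the factor, so any smaller area is reached; `d ≠ 0` allows the `d`-th root. -/
theorem exists_convex_subpiece (hd : d ≠ 0) {X : Set (Space (d + 1))} (hX : IsFlatPiece Ω X)
    (hXc : Convex ℝ X) {δ : ℝ≥0∞} (hδ : δ ≤ surfaceMeasure (d + 1) X)
    (hfin : surfaceMeasure (d + 1) X ≠ ∞) :
    ∃ K ⊆ X, IsFlatPiece Ω K ∧ Convex ℝ K ∧ surfaceMeasure (d + 1) K = δ := by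
  obtain ⟨hXm, v, b, hv, hXv⟩ := hX
  rcases eq_or_ne δ 0 with rfl | hδ0
  · exact ⟨∅, empty_subset X, ⟨MeasurableSet.empty, v, b, hv, empty_subset _⟩, convex_empty,
      measure_empty⟩
  have hX0 : surfaceMeasure (d + 1) X ≠ 0 := fun h => hδ0 (le_zero_iff.1 (h ▸ hδ))
  obtain ⟨p, hp⟩ := nonempty_of_measure_ne_zero hX0
  set θ : NNReal := (δ / surfaceMeasure (d + 1) X).toNNReal with hθ
  have hθe : (θ : ℝ≥0∞) = δ / surfaceMeasure (d + 1) X :=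
    ENNReal.coe_toNNReal (ENNReal.div_ne_top (ne_top_of_le_ne_top hfin hδ) hX0)
  have hθ0 : θ ≠ 0 := fun h => by
    rw [h, ENNReal.coe_zero] at hθe
    exact (ENNReal.div_pos hδ0 hfin).ne hθe
  have hθ1 : θ ≤ 1 := by
    rw [← ENNReal.coe_le_one_iff, hθe]
    exact ENNReal.div_le_of_le_mul (by rwa [one_mul])
  set s : NNReal := θ ^ ((d : ℝ)⁻¹) with hs
  have hsd : s ^ d = θ := by
    rw [hs, ← NNReal.rpow_natCast, ← NNReal.rpow_mul,
      inv_mul_cancel₀ (Nat.cast_ne_zero.2 hd), NNReal.rpow_one]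
  have hs0 : s ≠ 0 := fun h => hθ0 (by rw [← hsd, h, zero_pow hd])
  have hs1 : s ≤ 1 := NNReal.rpow_le_one hθ1 (by positivity)
  have hs0' : (s : ℝ) ≠ 0 := by exact_mod_cast hs0
  have hsub : AffineMap.homothety p (s : ℝ) '' X ⊆ X := by
    rintro _ ⟨y, hy, rfl⟩
    exact homothety_mem hXc hp hy ⟨s.2, hs1⟩
  refine ⟨_, hsub, ⟨?_, v, b, hv, hsub.trans hXv⟩, Convex.image_homothety hXc p s, ?_⟩
  · rw [image_homothety_eq_preimage p hs0']
    exact (AffineMap.homothety_continuous p _).measurable hXm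
  · rw [surfaceMeasure_succ, euclideanHausdorffMeasure_homothety_image d p hs0',
      ← surfaceMeasure_succ, NNReal.nnnorm_eq, hsd, ENNReal.smul_def, smul_eq_mul, hθe,
      ENNReal.div_mul_cancel hX0 hfin]

/-- The disc of radius `ρ` about `q` in the hyperplane of constant first coordinate. -/
def disc (q : Space (d + 1)) (ρ : ℝ) : Set (Space (d + 1)) :=
  Metric.ball q ρ ∩ hyperplane (consL d (1, 0)) (head q)

theorem consL_one_zero_ne_zero : consL d (1, 0) ≠ 0 := fun h => by
  have := norm_consL_one_zero (d := d)
  rw [h, norm_zero] at this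
  exact zero_ne_one this

theorem convex_hyperplane {n : ℕ} (v : Space n) (b : ℝ) : Convex ℝ (hyperplane v b) :=
  (convex_singleton b).linear_preimage (innerSL ℝ v).toLinearMap

theorem isClosed_hyperplane {n : ℕ} (v : Space n) (b : ℝ) : IsClosed (hyperplane v b) :=
  isClosed_eq (continuous_const.inner continuous_id) continuous_const

theorem isFlatPiece_disc (q : Space (d + 1)) (ρ : ℝ) :
    IsFlatPiece (Metric.ball q ρ) (disc q ρ) :=
  ⟨measurableSet_ball.inter (isClosed_hyperplane _ _).measurableSet, _, _, consL_one_zero_ne_zero,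
    subset_rfl⟩

theorem convex_disc (q : Space (d + 1)) (ρ : ℝ) : Convex ℝ (disc q ρ) :=
  (convex_ball q ρ).inter (convex_hyperplane _ _)

theorem measure_disc_pos (q : Space (d + 1)) {ρ : ℝ} (hρ : 0 < ρ) :
    0 < surfaceMeasure (d + 1) (disc q ρ) := by
  have hiso : Isometry fun z : Space d => q + incl z := by
    refine Isometry.of_dist_eq fun x y => ?_
    rw [dist_add_left, incl.dist_map]
  have h1 : surfaceMeasure (d + 1) ((fun z : Space d => q + incl z) '' Metric.ball 0 ρ) =
      volume (Metric.ball (0 : Space d) ρ) := by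
    rw [surfaceMeasure_succ, hiso.euclideanHausdorffMeasure_image,
      EuclideanSpace.euclideanHausdorffMeasure_eq_volume]
  refine (Metric.measure_ball_pos volume (0 : Space d) hρ).trans_le (h1 ▸ measure_mono ?_)
  rintro _ ⟨z, hz, rfl⟩
  constructor
  · rw [mem_ball_iff_norm, add_sub_cancel_left, incl.norm_map]
    simpa using hz
  · change inner ℝ (consL d (1, 0)) (q + incl z) = head q
    rw [inner_eq_head_tail]
    simp

end

/-! ### The value of the minimum and the approximating families of boundary copies. -/

section

/-- A bounded open convex set with `C¹` boundary. -/
structure IsC1ConvexBody {n : ℕ} (Ω : Set (Space n)) : Prop where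
  isOpen : IsOpen Ω
  convex : Convex ℝ Ω
  isBounded : Bornology.IsBounded Ω
  hasC1Boundary : HasC1Boundary Ω

variable {d : ℕ} {Ω : Set (Space (d + 1))}

namespace IsC1ConvexBody

theorem measure_frontier_ne_top (h : IsC1ConvexBody Ω) :
    surfaceMeasure (d + 1) (frontier Ω) ≠ ∞ :=
  ((h.hasC1Boundary.isC1Hypersurface_frontier h.isOpen).measure_lt_top
    (h.isBounded.isCompact_closure.of_isClosed_subset isClosed_frontier frontier_subset_closure)
    subset_rfl).ne

theorem lineIntegral_hit_ne_top (h : IsC1ConvexBody Ω) : lineIntegral (hit Ω) ≠ ∞ := by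
  intro htop
  have h1 := croftonConst_mul_frontier h.isOpen h.convex h.isBounded h.hasC1Boundary
  rw [htop, ENNReal.mul_top two_ne_zero] at h1
  exact ENNReal.mul_ne_top croftonConst_ne_top h.measure_frontier_ne_top h1

/-- The minimal energy of sets of area `m * |∂Ω| + κ`. -/
def minEnergy (Ω : Set (Space (d + 1))) (m : ℕ) (κ : ℝ≥0∞) : ℝ≥0∞ :=
  ((2 * m * (2 * m - 1) : ℕ) : ℝ≥0∞) * lineIntegral (hit Ω) +
    ((4 * m : ℕ) : ℝ≥0∞) * (croftonConst d * κ)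

/-- By `c * |∂Ω| = 2 * T` the claim reduces to `8m² = 2m * (2m - 1) + 2m * (2m + 1)`. The sum form
avoids subtraction in `ℝ≥0∞`. -/
theorem minEnergy_add (h : IsC1ConvexBody Ω) (m : ℕ) (κ : ℝ≥0∞) :
    ((4 * m : ℕ) : ℝ≥0∞) *
        (croftonConst d * (m * surfaceMeasure (d + 1) (frontier Ω) + κ)) =
      minEnergy Ω m κ + ((2 * m * (2 * m + 1) : ℕ) : ℝ≥0∞) * lineIntegral (hit Ω) := by
  have h1 := croftonConst_mul_frontier h.isOpen h.convex h.isBounded h.hasC1Boundary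
  have h2 : 4 * m * (m * 2) = 2 * m * (2 * m - 1) + 2 * m * (2 * m + 1) := by
    cases m with
    | zero => rfl
    | succ m =>
      have : 2 * (m + 1) - 1 = 2 * m + 1 := by omega
      rw [this]
      ring
  have h3 : ((4 * m : ℕ) : ℝ≥0∞) * (m * 2) =
      ((2 * m * (2 * m - 1) : ℕ) : ℝ≥0∞) + ((2 * m * (2 * m + 1) : ℕ) : ℝ≥0∞) := by
    exact_mod_cast h2
  calc _ = ((4 * m : ℕ) : ℝ≥0∞) * (m * (croftonConst d * surfaceMeasure (d + 1) (frontier Ω))) +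
        ((4 * m : ℕ) : ℝ≥0∞) * (croftonConst d * κ) := by ring
    _ = ((4 * m : ℕ) : ℝ≥0∞) * (m * 2) * lineIntegral (hit Ω) +
        ((4 * m : ℕ) : ℝ≥0∞) * (croftonConst d * κ) := by rw [h1]; ring
    _ = _ := by rw [h3, minEnergy]; ring

theorem minEnergy_le (h : IsC1ConvexBody Ω) (m : ℕ) {κ : ℝ≥0∞} (hκ : κ ≠ ∞)
    {A : Set (Space (d + 1))}
    (hA : A ∈ competitors Ω (m * surfaceMeasure (d + 1) (frontier Ω) + κ)) :
    minEnergy Ω m κ ≤ energy A := by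
  obtain ⟨hAΩ, hAp, hAm⟩ := hA
  have hfin : surfaceMeasure (d + 1) A ≠ ∞ := by
    rw [hAm]
    exact ENNReal.add_ne_top.2
      ⟨ENNReal.mul_ne_top (ENNReal.natCast_ne_top _) h.measure_frontier_ne_top, hκ⟩
  have h1 := le_energy h.isOpen h.convex hAΩ hAp hfin m
  rw [hAm, h.minEnergy_add] at h1
  exact (ENNReal.add_le_add_iff_right
    (ENNReal.mul_ne_top (ENNReal.natCast_ne_top _) h.lineIntegral_hit_ne_top)).1 h1

section Copies

variable {p : Space (d + 1)} {m : ℕ} {t : Fin m → ℝ}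

theorem boundaryCopies_eq (ht : t ∈ distinctFactors m) :
    boundaryCopies Ω p t = ⋃ i, frontier (AffineMap.homothety p (t i) '' Ω) := by
  simp only [boundaryCopies]
  exact iUnion_congr fun i => (frontier_image_homothety p (ht.2 i).1.ne' Ω).symm

theorem boundaryCopies_subset (h : IsC1ConvexBody Ω) (hp : p ∈ Ω) (ht : t ∈ distinctFactors m) :
    boundaryCopies Ω p t ⊆ closure Ω := by
  refine iUnion_subset fun i => ?_
  rintro _ ⟨y, hy, rfl⟩
  exact homothety_mem h.convex.closure (subset_closure hp) (frontier_subset_closure hy)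
    ⟨(ht.2 i).1.le, (ht.2 i).2⟩

theorem measurableSet_boundaryCopies (ht : t ∈ distinctFactors m) :
    MeasurableSet (boundaryCopies Ω p t) := by
  rw [boundaryCopies_eq ht]
  exact MeasurableSet.iUnion fun i => isClosed_frontier.measurableSet

theorem isPiecewiseC1_boundaryCopies (h : IsC1ConvexBody Ω) (ht : t ∈ distinctFactors m) :
    IsPiecewiseC1 (boundaryCopies Ω p t) := by
  refine IsPiecewiseC1.union_iUnion (fun i => ?_) fun i => ?_
  · exact (h.hasC1Boundary.isC1Hypersurface_frontier h.isOpen).image_homothety p (ht.2 i).1.ne'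
  · rw [← frontier_image_homothety p (ht.2 i).1.ne']
    exact isClosed_frontier.measurableSet

theorem measure_boundaryCopies (h : IsC1ConvexBody Ω) (hp : p ∈ Ω) (ht : t ∈ distinctFactors m) :
    surfaceMeasure (d + 1) (boundaryCopies Ω p t) =
      ∑ i, ENNReal.ofReal (t i) ^ d * surfaceMeasure (d + 1) (frontier Ω) := by
  rw [boundaryCopies, measure_iUnion, tsum_fintype]
  · refine Finset.sum_congr rfl fun i _ => ?_
    rw [surfaceMeasure_succ, euclideanHausdorffMeasure_homothety_image d p (ht.2 i).1.ne',
      ← surfaceMeasure_succ, ENNReal.smul_def, smul_eq_mul, ENNReal.coe_pow]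
    congr 2
    change ‖t i‖ₑ = _
    rw [Real.enorm_eq_ofReal (ht.2 i).1.le]
  · have key : ∀ i j, t i < t j → Disjoint (AffineMap.homothety p (t i) '' frontier Ω)
        (AffineMap.homothety p (t j) '' frontier Ω) := by
      intro i j hij
      rw [← frontier_image_homothety p (ht.2 j).1.ne']
      refine Disjoint.mono_left ((image_mono frontier_subset_closure).trans
        (image_homothety_closure_subset h.isOpen h.convex hp (ht.2 i).1 hij)) ?_
      exact disjoint_frontier_iff_isOpen.2
        (IsOpen.image_homothety h.isOpen p (ht.2 j).1.ne') |>.symm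
    intro i j hij
    rcases lt_or_gt_of_ne (ht.1.ne hij) with hlt | hlt
    · exact key i j hlt
    · exact (key j i hlt).symm
  · intro i
    rw [← frontier_image_homothety p (ht.2 i).1.ne']
    exact isClosed_frontier.measurableSet

theorem measure_boundaryCopies_le (h : IsC1ConvexBody Ω) (hp : p ∈ Ω)
    (ht : t ∈ distinctFactors m) :
    surfaceMeasure (d + 1) (boundaryCopies Ω p t) ≤
      m * surfaceMeasure (d + 1) (frontier Ω) := by
  rw [h.measure_boundaryCopies hp ht]
  refine (Finset.sum_le_sum (g := fun _ => surfaceMeasure (d + 1) (frontier Ω)) fun i _ => ?_).trans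
    (by simp)
  exact mul_le_of_le_one_left zero_le
    (pow_le_one₀ zero_le (ENNReal.ofReal_le_one.2 (ht.2 i).2))

/-- The copies may cut through `K`, so areas need not simply add. But the part of `K` inside a fixed
smaller copy of `Ω` is disjoint from all copies with larger factors, and these parts exhaust `K`. -/
theorem tendsto_measure_copies (h : IsC1ConvexBody Ω) (hp : p ∈ Ω) {K : Set (Space (d + 1))}
    (hK : IsFlatPiece Ω K) :
    Tendsto (fun t : Fin m → ℝ => surfaceMeasure (d + 1) (boundaryCopies Ω p t ∪ K))
      (𝓝[distinctFactors m] fun _ => 1)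
      (𝓝 (m * surfaceMeasure (d + 1) (frontier Ω) + surfaceMeasure (d + 1) K)) := by
  have hKm := hK.1
  have hKΩ : K ⊆ Ω := hK.2.choose_spec.choose_spec.2.trans inter_subset_left
  refine tendsto_order.2 ⟨fun a ha => ?_, fun a ha => ?_⟩
  · set r : ℕ → ℝ := fun k => 1 - 1 / ((k : ℝ) + 2) with hr
    have hr0 : ∀ k, 0 < r k := fun k => by
      rw [hr, sub_pos, div_lt_one (by positivity)]
      linarith [(Nat.cast_nonneg k : (0 : ℝ) ≤ k)]
    have hr1 : ∀ k, r k < 1 := fun k => by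
      rw [hr, sub_lt_self_iff]
      positivity
    have hrm : Monotone r := fun k l hkl => by
      have : (k : ℝ) ≤ l := Nat.cast_le.2 hkl
      simp only [hr]
      gcongr
    have hrl : Tendsto r atTop (𝓝 1) := by
      have h1 : Tendsto (fun k : ℕ => 1 / ((k : ℝ) + 2)) atTop (𝓝 0) := by
        simp only [one_div]
        exact tendsto_inv_atTop_zero.comp
          (tendsto_atTop_add_const_right _ _ tendsto_natCast_atTop_atTop)
      have h2 := (tendsto_const_nhds (x := (1 : ℝ))).sub h1
      rwa [sub_zero] at h2
    have hU : ⋃ k, K ∩ AffineMap.homothety p (r k) '' Ω = K := by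
      rw [← inter_iUnion, inter_eq_left]
      intro x hx
      obtain ⟨k, hk⟩ := (hrl.eventually
        (eventually_mem_image_homothety h.isOpen p (hKΩ hx))).exists
      exact mem_iUnion.2 ⟨k, hk⟩
    have hmon : Monotone fun k => K ∩ AffineMap.homothety p (r k) '' Ω := fun k l hkl =>
      inter_subset_inter_right _ (image_homothety_subset h.isOpen h.convex hp (hr0 k) (hrm hkl))
    have hlim := tendsto_measure_iUnion_atTop (μ := surfaceMeasure (d + 1)) hmon
    rw [hU] at hlim
    obtain ⟨k, hk⟩ := ((hlim.const_add (m * surfaceMeasure (d + 1) (frontier Ω))).eventually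
      (lt_mem_nhds ha)).exists
    have hsum : Tendsto (fun t : Fin m → ℝ =>
        (∑ i, ENNReal.ofReal (t i) ^ d * surfaceMeasure (d + 1) (frontier Ω)) +
          surfaceMeasure (d + 1) (K ∩ AffineMap.homothety p (r k) '' Ω))
        (𝓝 fun _ => 1) (𝓝 (m * surfaceMeasure (d + 1) (frontier Ω) +
          surfaceMeasure (d + 1) (K ∩ AffineMap.homothety p (r k) '' Ω))) := by
      refine Tendsto.add_const _ ?_
      have h1 : (m : ℝ≥0∞) * surfaceMeasure (d + 1) (frontier Ω) =
          ∑ _i : Fin m, 1 ^ d * surfaceMeasure (d + 1) (frontier Ω) := by simp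
      rw [h1]
      refine tendsto_finsetSum _ fun i _ => ENNReal.Tendsto.mul_const ?_
        (Or.inr h.measure_frontier_ne_top)
      refine ENNReal.Tendsto.pow ?_
      have h2 : Tendsto (fun t : Fin m → ℝ => ENNReal.ofReal (t i)) (𝓝 fun _ => 1)
          (𝓝 (ENNReal.ofReal 1)) :=
        ENNReal.tendsto_ofReal ((continuous_apply i).tendsto _)
      rwa [ENNReal.ofReal_one] at h2
    have hrt : ∀ᶠ t : Fin m → ℝ in 𝓝 fun _ => 1, ∀ i, r k < t i :=
      eventually_all.2 fun i => ((continuous_apply i).tendsto _).eventually (lt_mem_nhds (hr1 k))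
    filter_upwards [self_mem_nhdsWithin, nhdsWithin_le_nhds (hsum.eventually (lt_mem_nhds hk)),
      nhdsWithin_le_nhds hrt] with t ht hta htr
    refine hta.trans_le ?_
    rw [← h.measure_boundaryCopies hp ht, ← measure_union']
    · exact measure_mono (union_subset_union_right _ inter_subset_left)
    · rw [boundaryCopies_eq ht, disjoint_iUnion_left]
      intro i
      refine Disjoint.mono_right (inter_subset_right.trans
        (image_homothety_subset h.isOpen h.convex hp (hr0 k) (htr i).le)) ?_
      exact disjoint_frontier_iff_isOpen.2 (IsOpen.image_homothety h.isOpen p (ht.2 i).1.ne')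
    · exact measurableSet_boundaryCopies ht
  · filter_upwards [self_mem_nhdsWithin] with t ht
    exact ((measure_union_le _ _).trans
      (add_le_add_left (h.measure_boundaryCopies_le hp ht) _)).trans_lt ha

/-- `J` is the small flat piece that corrects the area; with `J = ∅` the extra term disappears.
Disjointness is not needed, since overlaps only lower the crossing numbers. -/
theorem energy_copies_le (h : IsC1ConvexBody Ω) (hp : p ∈ Ω) (ht : t ∈ distinctFactors m)
    {K J A : Set (Space (d + 1))} (hK : IsFlatPiece Ω K) (hJ : IsFlatPiece Ω J)
    (hA : A = boundaryCopies Ω p t ∪ K ∪ J) :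
    IsPiecewiseC1 A ∧ A ⊆ closure Ω ∧ surfaceMeasure (d + 1) A ≠ ∞ ∧
    energy A ≤ minEnergy Ω m (surfaceMeasure (d + 1) K) +
      (4 * m + 2 : ℕ) * (croftonConst d * surfaceMeasure (d + 1) J) := by
  have hKfin := (hK.measure_lt_top h.isBounded).ne
  have hJfin := (hJ.measure_lt_top h.isBounded).ne
  have hp1 : IsPiecewiseC1 A := by
    obtain ⟨hKm, v, b, hv, hKv⟩ := hK
    obtain ⟨hJm, w, c, hw, hJw⟩ := hJ
    rw [hA]
    exact ((h.isPiecewiseC1_boundaryCopies ht).union (measurableSet_boundaryCopies ht)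
      (fun x hx => ⟨_, isC1Hypersurface_hyperplane hv b x hx⟩) hKm
      (hKv.trans inter_subset_right)).union ((measurableSet_boundaryCopies ht).union hKm)
      (fun x hx => ⟨_, isC1Hypersurface_hyperplane hw c x hx⟩) hJm (hJw.trans inter_subset_right)
  have hKΩ : K ⊆ Ω := hK.2.choose_spec.choose_spec.2.trans inter_subset_left
  have hJΩ : J ⊆ Ω := hJ.2.choose_spec.choose_spec.2.trans inter_subset_left
  have hAΩ : A ⊆ closure Ω := by
    rw [hA]
    exact union_subset (union_subset (h.boundaryCopies_subset hp ht) (hKΩ.trans subset_closure))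
      (hJΩ.trans subset_closure)
  have hAfin : surfaceMeasure (d + 1) A ≠ ∞ := by
    rw [hA]
    refine measure_union_ne_top (measure_union_ne_top ?_ hKfin) hJfin
    exact ne_top_of_le_ne_top
      (ENNReal.mul_ne_top (ENNReal.natCast_ne_top m) h.measure_frontier_ne_top)
      (h.measure_boundaryCopies_le hp ht)
  refine ⟨hp1, hAΩ, hAfin, ?_⟩
  refine (energy_le h.isOpen h.convex hAΩ hp1 hAfin
    (D := fun i => AffineMap.homothety p (t i) '' Ω)
    (fun i => IsOpen.image_homothety h.isOpen p (ht.2 i).1.ne')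
    (fun i => Convex.image_homothety h.convex p (t i)) (fun i => ?_) hK hJ hKfin hJfin
    (by rw [hA, boundaryCopies_eq ht])).trans_eq ?_
  · refine h.isBounded.subset ?_
    rintro _ ⟨y, hy, rfl⟩
    exact homothety_mem h.convex hp hy ⟨(ht.2 i).1.le, (ht.2 i).2⟩
  · rw [minEnergy]
    push_cast
    ring

end Copies

end IsC1ConvexBody

end

/-! ### The infimum, its attainment, and the theorem. -/

section

/-- Without this, limits along the filter would carry no information and could not bound the
infimum. The factors `1 - e * i / (m + 1)` approach it. -/
theorem nhdsWithin_distinctFactors_neBot (m : ℕ) :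
    (𝓝[distinctFactors m] fun _ : Fin m => (1 : ℝ)).NeBot := by
  set f : ℝ → Fin m → ℝ := fun e i => 1 - e * (((i : ℕ) : ℝ) / (m + 1)) with hf
  have hlim : Tendsto f (𝓝[>] 0) (𝓝[distinctFactors m] fun _ => 1) := by
    refine tendsto_nhdsWithin_iff.2 ⟨?_, ?_⟩
    · have hc : Continuous f := by fun_prop
      have h0 : f 0 = fun _ => 1 := by
        funext i
        simp [hf]
      exact (h0 ▸ hc.tendsto 0).mono_left nhdsWithin_le_nhds
    · filter_upwards [Ioo_mem_nhdsGT (zero_lt_one (α := ℝ))] with e he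
      have hm : (0 : ℝ) < m + 1 := by positivity
      refine ⟨fun i j hij => ?_, fun i => ⟨?_, ?_⟩⟩
      · have h1 : e * (((i : ℕ) : ℝ) / (m + 1)) = e * (((j : ℕ) : ℝ) / (m + 1)) :=
          sub_right_injective hij
        have h2 := (div_left_inj' hm.ne').1 (mul_left_cancel₀ he.1.ne' h1)
        exact Fin.ext (Nat.cast_injective h2)
      · have h1 : (((i : ℕ) : ℝ) / (m + 1)) < 1 := by
          rw [div_lt_one hm]
          have : ((i : ℕ) : ℝ) < m := Nat.cast_lt.2 i.2
          linarith
        have h2 : 0 ≤ (((i : ℕ) : ℝ) / (m + 1)) := by positivity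
        exact sub_pos.2 (mul_lt_one_of_nonneg_of_lt_one_left he.1.le he.2 h1.le)
      · have h2 : 0 ≤ (((i : ℕ) : ℝ) / (m + 1)) := by positivity
        exact sub_le_self _ (mul_nonneg he.1.le h2)
  exact hlim.neBot

theorem exists_mem_notMem_hyperplane {n : ℕ} {Ω : Set (Space n)} (ho : IsOpen Ω)
    (hne : Ω.Nonempty) {v : Space n} (hv : v ≠ 0) (b : ℝ) : ∃ q ∈ Ω, q ∉ hyperplane v b := by
  obtain ⟨p, hp⟩ := hne
  have hc : Continuous fun e : ℝ => p + e • v := by fun_prop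
  have h1 : ∀ᶠ e : ℝ in 𝓝[>] 0, p + e • v ∈ Ω :=
    nhdsWithin_le_nhds ((hc.tendsto 0).eventually (ho.mem_nhds (by simpa using hp)))
  obtain ⟨e, he, he0⟩ := (h1.and self_mem_nhdsWithin).exists
  by_cases hpb : p ∈ hyperplane v b
  · refine ⟨_, he, fun h => ?_⟩
    have h2 : inner ℝ v (p + e • v) = b := h
    have h3 : inner ℝ v p = b := hpb
    rw [inner_add_right, h3, inner_smul_right, add_eq_left] at h2
    exact (mul_ne_zero (ne_of_gt he0) (inner_self_ne_zero.2 hv)) h2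
  · exact ⟨p, hp, hpb⟩

variable {d : ℕ} {Ω : Set (Space (d + 1))}

namespace IsC1ConvexBody

/-- Competitors must have area exactly `L`, while shrinking the copies may lose some. A flat piece
disjoint from everything else supplies the deficit, and its contribution to the energy bound is
proportional to its area, which tends to zero. -/
theorem iInf_energy_le (h : IsC1ConvexBody Ω) (hd : d ≠ 0) (hne : Ω.Nonempty) (m : ℕ)
    {K : Set (Space (d + 1))} (hK : IsFlatPiece Ω K) :
    ⨅ A ∈ competitors Ω (m * surfaceMeasure (d + 1) (frontier Ω) + surfaceMeasure (d + 1) K),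
      energy A ≤ minEnergy Ω m (surfaceMeasure (d + 1) K) := by
  set L := m * surfaceMeasure (d + 1) (frontier Ω) + surfaceMeasure (d + 1) K with hL
  have hLfin : L ≠ ∞ := ENNReal.add_ne_top.2 ⟨ENNReal.mul_ne_top (ENNReal.natCast_ne_top _)
    h.measure_frontier_ne_top, (hK.measure_lt_top h.isBounded).ne⟩
  obtain ⟨hKm, v, b, hv, hKv⟩ := id hK
  obtain ⟨q, hq, hqv⟩ := exists_mem_notMem_hyperplane h.isOpen hne hv b
  have hhalf : IsOpen (AffineMap.homothety q (1 / 2 : ℝ) '' Ω) :=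
    IsOpen.image_homothety h.isOpen q (by norm_num)
  -- A ball off the hyperplane of `K` and inside the half-size copy of `Ω` is disjoint from `K` and
  -- from every boundary copy with factor above `1 / 2`.
  obtain ⟨ρ, hρ, hball⟩ := Metric.isOpen_iff.1 (hhalf.inter (isClosed_hyperplane v b).isOpen_compl)
    q ⟨⟨q, hq, AffineMap.homothety_apply_same _ _⟩, hqv⟩
  have hballΩ : Metric.ball q ρ ⊆ Ω := by
    intro x hx
    obtain ⟨y, hy, rfl⟩ := (hball hx).1
    exact homothety_mem h.convex hq hy ⟨by norm_num, by norm_num⟩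
  have hdisc := isFlatPiece_disc q ρ
  have hdfin := (hdisc.measure_lt_top Metric.isBounded_ball).ne
  have hlim := h.tendsto_measure_copies (m := m) hq hK
  rw [← hL] at hlim
  have hsub : Tendsto (fun t : Fin m → ℝ =>
      L - surfaceMeasure (d + 1) (boundaryCopies Ω q t ∪ K))
      (𝓝[distinctFactors m] fun _ => 1) (𝓝 0) := by
    have h1 := ENNReal.Tendsto.sub (tendsto_const_nhds (x := L)) hlim (Or.inl hLfin)
    rwa [tsub_self] at h1
  have hE : Tendsto (fun t : Fin m → ℝ => minEnergy Ω m (surfaceMeasure (d + 1) K) +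
      (4 * m + 2 : ℕ) * (croftonConst d *
        (L - surfaceMeasure (d + 1) (boundaryCopies Ω q t ∪ K))))
      (𝓝[distinctFactors m] fun _ => 1) (𝓝 (minEnergy Ω m (surfaceMeasure (d + 1) K))) := by
    have h1 := (ENNReal.Tendsto.const_mul (ENNReal.Tendsto.const_mul hsub
      (Or.inr (croftonConst_ne_top (d := d)))) (Or.inr (ENNReal.natCast_ne_top (4 * m + 2)))).const_add
      (minEnergy Ω m (surfaceMeasure (d + 1) K))
    rwa [mul_zero, mul_zero, add_zero] at h1
  have hhalf_lt : ∀ᶠ t : Fin m → ℝ in 𝓝 fun _ => 1, ∀ i, (1 / 2 : ℝ) < t i :=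
    eventually_all.2 fun i => ((continuous_apply i).tendsto _).eventually
      (lt_mem_nhds (by norm_num))
  have := nhdsWithin_distinctFactors_neBot m
  refine ge_of_tendsto hE ?_
  filter_upwards [self_mem_nhdsWithin, nhdsWithin_le_nhds hhalf_lt,
    hsub.eventually (gt_mem_nhds (measure_disc_pos q hρ))] with t ht htt htd
  obtain ⟨J, hJd, ⟨hJm, w, c, hw, hJw⟩, -, hJ⟩ :=
    exists_convex_subpiece hd hdisc (convex_disc q ρ) htd.le hdfin
  have hJb : J ⊆ Metric.ball q ρ := hJw.trans inter_subset_left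
  have hJΩ : IsFlatPiece Ω J := ⟨hJm, w, c, hw, hJw.trans (inter_subset_inter_left _ hballΩ)⟩
  obtain ⟨hp1, hAΩ, -, hAE⟩ := h.energy_copies_le hq ht hK hJΩ rfl
  rw [hJ] at hAE
  refine (iInf₂_le _ ⟨hAΩ, hp1, ?_⟩).trans hAE
  have hdisj : Disjoint (boundaryCopies Ω q t ∪ K) J := by
    refine Disjoint.union_left ?_ ?_
    · rw [boundaryCopies_eq ht, disjoint_iUnion_left]
      intro i
      refine Disjoint.mono_right (hJb.trans ((hball.trans inter_subset_left).trans
        (image_homothety_subset h.isOpen h.convex hq (by norm_num) (htt i).le))) ?_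
      exact disjoint_frontier_iff_isOpen.2 (IsOpen.image_homothety h.isOpen q (ht.2 i).1.ne')
    · exact disjoint_left.2 fun x hxK hxJ => (hball (hJb hxJ)).2 (hKv hxK).2
  rw [measure_union hdisj hJm, hJ]
  refine add_tsub_cancel_of_le ((measure_union_le _ _).trans ?_)
  exact add_le_add_left (h.measure_boundaryCopies_le hq ht) _

theorem iInf_energy (h : IsC1ConvexBody Ω) (hd : d ≠ 0) (hne : Ω.Nonempty) (m : ℕ)
    {K : Set (Space (d + 1))} (hK : IsFlatPiece Ω K) :
    ⨅ A ∈ competitors Ω (m * surfaceMeasure (d + 1) (frontier Ω) + surfaceMeasure (d + 1) K),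
      energy A = minEnergy Ω m (surfaceMeasure (d + 1) K) :=
  (h.iInf_energy_le hd hne m hK).antisymm
    (le_iInf₂ fun _ hA => h.minEnergy_le m (hK.measure_lt_top h.isBounded).ne hA)

/-- The shrunk configurations need not have area `L`. The lower bound holds for any area, however,
and its value tends to `minEnergy`, so the energies are squeezed between it and the constant upper
bound. -/
theorem tendsto_energy_copies (h : IsC1ConvexBody Ω) {p : Space (d + 1)} (hp : p ∈ Ω) (m : ℕ)
    {K : Set (Space (d + 1))} (hK : IsFlatPiece Ω K) :
    Tendsto (fun t : Fin m → ℝ => energy (boundaryCopies Ω p t ∪ K))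
      (𝓝[distinctFactors m] fun _ => 1)
      (𝓝 (minEnergy Ω m (surfaceMeasure (d + 1) K))) := by
  have hKfin := (hK.measure_lt_top h.isBounded).ne
  have hT : ((2 * m * (2 * m + 1) : ℕ) : ℝ≥0∞) * lineIntegral (hit Ω) ≠ ∞ :=
    ENNReal.mul_ne_top (ENNReal.natCast_ne_top _) h.lineIntegral_hit_ne_top
  have hlow : Tendsto (fun t : Fin m → ℝ => ((4 * m : ℕ) : ℝ≥0∞) *
      (croftonConst d * surfaceMeasure (d + 1) (boundaryCopies Ω p t ∪ K)) -
      ((2 * m * (2 * m + 1) : ℕ) : ℝ≥0∞) * lineIntegral (hit Ω))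
      (𝓝[distinctFactors m] fun _ => 1) (𝓝 (minEnergy Ω m (surfaceMeasure (d + 1) K))) := by
    have h1 := ENNReal.Tendsto.sub (ENNReal.Tendsto.const_mul (ENNReal.Tendsto.const_mul
      (h.tendsto_measure_copies (m := m) hp hK) (Or.inr (croftonConst_ne_top (d := d))))
      (Or.inr (ENNReal.natCast_ne_top (4 * m)))) (tendsto_const_nhds
      (x := ((2 * m * (2 * m + 1) : ℕ) : ℝ≥0∞) * lineIntegral (hit Ω))) (Or.inr hT)
    rwa [h.minEnergy_add, ENNReal.add_sub_cancel_right hT] at h1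
  have hJ : IsFlatPiece Ω (∅ : Set (Space (d + 1))) :=
    ⟨MeasurableSet.empty, _, 0, consL_one_zero_ne_zero, empty_subset _⟩
  refine tendsto_of_tendsto_of_tendsto_of_le_of_le' hlow tendsto_const_nhds ?_ ?_
  · filter_upwards [self_mem_nhdsWithin] with t ht
    obtain ⟨hp1, hAΩ, hfin, -⟩ := h.energy_copies_le hp ht hK hJ (union_empty _).symm
    exact tsub_le_iff_right.2 (le_energy h.isOpen h.convex hAΩ hp1 hfin m)
  · filter_upwards [self_mem_nhdsWithin] with t ht
    have h1 := (h.energy_copies_le hp ht hK hJ (union_empty _).symm).2.2.2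
    rwa [measure_empty, mul_zero, mul_zero, add_zero] at h1

theorem iUnion_frontier_union_mem (h : IsC1ConvexBody Ω) (hne : Ω.Nonempty) {m : ℕ} (hm : m ≤ 1)
    {K : Set (Space (d + 1))} (hK : IsFlatPiece Ω K) :
    (⋃ _ : Fin m, frontier Ω) ∪ K ∈ competitors Ω
        (m * surfaceMeasure (d + 1) (frontier Ω) + surfaceMeasure (d + 1) K) ∧
      energy ((⋃ _ : Fin m, frontier Ω) ∪ K) ≤ minEnergy Ω m (surfaceMeasure (d + 1) K) := by
  obtain ⟨p, hp⟩ := hne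
  have hsing : Subsingleton (Fin m) := Fin.subsingleton_iff_le_one.2 hm
  -- With at most one copy the factors are vacuously distinct, so the factor `1` itself is allowed
  -- and no limit is needed.
  have ht : (fun _ : Fin m => (1 : ℝ)) ∈ distinctFactors m :=
    ⟨Function.injective_of_subsingleton _, fun _ => ⟨zero_lt_one, le_rfl⟩⟩
  have hU : (⋃ _ : Fin m, frontier Ω) = boundaryCopies Ω p fun _ : Fin m => 1 := by
    refine iUnion_congr fun _ => ?_
    rw [AffineMap.homothety_one]
    exact (image_id _).symm
  have hJ : IsFlatPiece Ω (∅ : Set (Space (d + 1))) :=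
    ⟨MeasurableSet.empty, _, 0, consL_one_zero_ne_zero, empty_subset _⟩
  have hKΩ : K ⊆ Ω := hK.2.choose_spec.choose_spec.2.trans inter_subset_left
  rw [hU]
  obtain ⟨hp1, hAΩ, hfin, hE⟩ := h.energy_copies_le hp ht hK hJ (union_empty _).symm
  rw [measure_empty, mul_zero, mul_zero, add_zero] at hE
  refine ⟨⟨hAΩ, hp1, ?_⟩, hE⟩
  rw [measure_union _ hK.1, h.measure_boundaryCopies hp ht]
  · simp
  · rw [← hU, disjoint_iUnion_left]
    exact fun _ => (disjoint_frontier_iff_isOpen.2 h.isOpen).mono_right hKΩ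

/-- The section `X` serves only to produce one admissible convex `K`; the limit and the minimality
hold for every flat piece of the right area. -/
theorem minimizedByCopies (h : IsC1ConvexBody Ω) (hd : d ≠ 0) (hne : Ω.Nonempty)
    {X : Set (Space (d + 1))} (hX : IsFlatPiece Ω X) (hXc : Convex ℝ X) (m : ℕ) {L : ℝ≥0∞}
    (hL : m * surfaceMeasure (d + 1) (frontier Ω) ≤ L)
    (hLX : L ≤ m * surfaceMeasure (d + 1) (frontier Ω) + surfaceMeasure (d + 1) X) :
    MinimizedByCopies Ω m L := by
  refine ⟨?_, ?_⟩
  · obtain ⟨K, -, hK, hKc, hKm⟩ := exists_convex_subpiece hd hX hXc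
      (tsub_le_iff_left.2 hLX) (hX.measure_lt_top h.isBounded).ne
    exact ⟨K, hK, hKc, by rw [hKm, add_tsub_cancel_of_le hL]⟩
  · rintro K hK rfl
    rw [h.iInf_energy hd hne m hK]
    refine ⟨fun p hp => h.tendsto_energy_copies hp m hK, fun hm => ?_⟩
    obtain ⟨h1, h2⟩ := h.iUnion_frontier_union_mem hne hm hK
    exact ⟨h1, fun A hA => h2.trans (h.minEnergy_le m (hK.measure_lt_top h.isBounded).ne hA)⟩

end IsC1ConvexBody

theorem isFlatPiece_inter_hyperplane {n : ℕ} {Ω : Set (Space n)} (ho : IsOpen Ω) {v : Space n}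
    (hv : v ≠ 0) (b : ℝ) : IsFlatPiece Ω (Ω ∩ hyperplane v b) :=
  ⟨ho.measurableSet.inter (isClosed_hyperplane v b).measurableSet, v, b, hv, subset_rfl⟩

theorem exists_hyperplane_measure_pos (ho : IsOpen Ω) (hne : Ω.Nonempty) :
    ∃ (v : Space (d + 1)) (b : ℝ), v ≠ 0 ∧ 0 < surfaceMeasure (d + 1) (Ω ∩ hyperplane v b) := by
  obtain ⟨p, hp⟩ := hne
  obtain ⟨ρ, hρ, hball⟩ := Metric.isOpen_iff.1 ho p hp
  exact ⟨_, _, consL_one_zero_ne_zero, (measure_disc_pos p hρ).trans_le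
    (measure_mono (inter_subset_inter_left _ hball))⟩

end

end QuadraticCrofton

end

theorem theorem2 (n : ℕ) (hn : 2 ≤ n) (Ω : Set (QuadraticCrofton.Space n))
    (hopen : IsOpen Ω) (hne : Ω.Nonempty) (hconv : Convex ℝ Ω)
    (hbdd : Bornology.IsBounded Ω) (hC1 : QuadraticCrofton.HasC1Boundary Ω) :
    (∃ c : ENNReal, 0 < c ∧ ∀ (m : ℕ) (L : ENNReal),
      m * QuadraticCrofton.surfaceMeasure n (frontier Ω) ≤ L →
      L ≤ m * QuadraticCrofton.surfaceMeasure n (frontier Ω) + c →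
      QuadraticCrofton.MinimizedByCopies Ω m L) ∧
    (∀ (v : QuadraticCrofton.Space n) (b : ℝ), v ≠ 0 → ∀ (m : ℕ) (L : ENNReal),
      m * QuadraticCrofton.surfaceMeasure n (frontier Ω) ≤ L →
      L ≤ m * QuadraticCrofton.surfaceMeasure n (frontier Ω) +
        QuadraticCrofton.surfaceMeasure n (Ω ∩ QuadraticCrofton.hyperplane v b) →
      QuadraticCrofton.MinimizedByCopies Ω m L) := by
  obtain ⟨d, rfl⟩ : ∃ d, n = d + 1 := ⟨n - 1, by omega⟩
  -- Here `2 ≤ n` enters: flat pieces have positive dimension, so their area can be adjusted by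
  -- scaling.
  have hd : d ≠ 0 := by omega
  have h : QuadraticCrofton.IsC1ConvexBody Ω := ⟨hopen, hconv, hbdd, hC1⟩
  have key : ∀ (v : QuadraticCrofton.Space (d + 1)) (b : ℝ), v ≠ 0 → ∀ (m : ℕ) (L : ENNReal),
      m * QuadraticCrofton.surfaceMeasure (d + 1) (frontier Ω) ≤ L →
      L ≤ m * QuadraticCrofton.surfaceMeasure (d + 1) (frontier Ω) +
        QuadraticCrofton.surfaceMeasure (d + 1) (Ω ∩ QuadraticCrofton.hyperplane v b) →
      QuadraticCrofton.MinimizedByCopies Ω m L := fun v b hv m L hL hLX =>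
    h.minimizedByCopies hd hne (QuadraticCrofton.isFlatPiece_inter_hyperplane hopen hv b)
      (hconv.inter (QuadraticCrofton.convex_hyperplane v b)) m hL hLX
  -- The constant `c` is the area of a hyperplane section through a point of `Ω`, positive since it
  -- contains a disc.
  obtain ⟨v, b, hv, hpos⟩ := QuadraticCrofton.exists_hyperplane_measure_pos hopen hne
  exact ⟨⟨_, hpos, key v b hv⟩, key⟩
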